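/- For a C*-algebra $B$ (unital or not) let $\mathcal U(B)$ denote the unitary group of $B$ if $B$ is unital, and of $B+\mathbb C1$ (the C*-algebra obtained by adjoining a unit) otherwise; for $u\in\mathcal U(B)$ put $\mathrm{Ad}\,u(x)=uxu^*$, $x\in B$. Two pure states $\omega_1,\omega_2$ of $B$ are called equivalent, $\omega_1\sim\omega_2$, if their GNS representations are unitarily equivalent. Let $C\ge\pi$ be a real constant. We say that a C*-algebra $A$ has property $(P_C)$ if for every finite subset $\mathcal F$ of $A$ and every $\varepsilon>0$ there exist a finite subset $\mathcal G$ of $A$ and $\delta>0$ such that the following holds: if $B$ is a C*-algebra containing $A$ as a C*-subalgebra and $\omega_1,\omega_2$ are pure states of $B$ with $\omega_1\sim\omega_2$ and $$|\omega_1(x)-\omega_2(x)|<\delta,\qquad x\in\mathcal G,$$ then for every $\varepsilon'>0$ there is a (norm-continuous) rectifiable path $(u_t)_{t\in[0,1]}$ in $\mathcal U(B)$ such that $u_0=1$, $\omega_1=\omega_2\circ\mathrm{Ad}\,u_1$, $\mathrm{length}((u_t))<C+\varepsilon'$, and $$\|\mathrm{Ad}\,u_t(x)-x\|<\varepsilon,\qquad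 x\in\mathcal F,\ t\in[0,1].$$ **Proposition.** If a C*-algebra $A$ has property $(P_C)$ for a constant $C\ge\pi$ and $A_1$ is a hereditary C*-subalgebra of $A$, then $A_1$ has property $(P_C)$ for the same constant $C$. -/

import Mathlib

open scoped ComplexOrder

namespace PureStateHomogeneity

noncomputable section

universe u

/-! ### States, pure states, equivalence of pure states -/

section States

variable (B : Type u) [NonUnitalCStarAlgebra B] [PartialOrder B] [StarOrderedRing B]

/-- The state space of a (possibly non-unital) C*-algebra: the positive linear functionals of
norm one. -/
def stateSpace : Set (B →L[ℂ] ℂ) :=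
  {φ | (∀ b : B, 0 ≤ b → 0 ≤ φ b) ∧ ‖φ‖ = 1}

variable {B}

/-- A positive linear functional on a C*-algebra as a (continuous) element of the dual space.
Continuity is automatic. -/
def toDual (ω : B →ₚ[ℂ] ℂ) : B →L[ℂ] ℂ :=
  { ω.toLinearMap with cont := map_continuous ω }

/-- A pure state is an extreme point of the state space. -/
def IsPureState (ω : B →ₚ[ℂ] ℂ) : Prop :=
  toDual ω ∈ Set.extremePoints ℝ (stateSpace B)

/-- Two positive functionals are equivalent if their GNS representations are unitarily
equivalent. -/
def GNSEquivalent (ω₁ ω₂ : B →ₚ[ℂ] ℂ) : Prop :=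
  ∃ V : ω₁.GNS ≃ₗᵢ[ℂ] ω₂.GNS, ∀ (b : B) (ξ : ω₁.GNS),
    V (ω₁.gnsNonUnitalStarAlgHom b ξ) = ω₂.gnsNonUnitalStarAlgHom b (V ξ)

end States

/-! ### The unitary group and inner automorphisms -/

section Unitaries

variable (B : Type u) [NonUnitalCStarAlgebra B]

/-- `B` has a multiplicative unit. -/
def HasUnit : Prop := ∃ e : B, ∀ b : B, e * b = b ∧ b * e = b

/-- The unitary group `𝒰(B)` of a C*-algebra `B`, realised inside the C*-algebra
`Unitization ℂ B = B + ℂ1`.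

If `B` has no unit, this is the unitary group of `B + ℂ1`.

If `B` has a unit `e`, this is the unitary group of `B` itself: a unitary `w` of `B`
(`w* w = w w* = e`) is identified with the element `w + (1 - e)` of `Unitization ℂ B`, and the
elements of this form are exactly the unitaries of `Unitization ℂ B` with scalar part `1`.
The identification is an isometric group isomorphism that does not change `w x w*` for `x` in
`B`. -/
def unitaryGroup : Set (Unitization ℂ B) :=
  {w | w ∈ unitary (Unitization ℂ B) ∧ (HasUnit B → w.fst = 1)}

variable {B}

/-- `Ad w (x) = w x w*`, an element of `B` for `x` in `B` since `B` is an ideal of `B + ℂ1`. -/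
def Ad (w : Unitization ℂ B) (x : B) : B :=
  (w * (x : Unitization ℂ B) * star w).snd

end Unitaries

/-! ### The property -/

/-- The homogeneity property of a C*-algebra `A` with constant `C`: for every finite `F ⊆ A` and
`ε > 0` there are a finite `G ⊆ A` and `δ > 0` such that, whenever `B` is a C*-algebra containing
`A` (through an injective *-homomorphism `ι`) and `ω₁ ∼ ω₂` are equivalent pure states of `B` with
`|ω₁(x) - ω₂(x)| < δ` on `G`, then for each `ε' > 0` there is a rectifiable path in `𝒰(B)` of
length less than `C + ε'` that starts at `1`, ends at some `u₁` with `ω₁ = ω₂ ∘ Ad u₁`, and moves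
each element of `F` by less than `ε`. The partial order on `B` is the usual one: it is determined
by `StarOrderedRing B`. -/
def HasPathProperty (A : Type u) [NonUnitalCStarAlgebra A] (C : ℝ) : Prop :=
  ∀ (F : Finset A) (ε : ℝ), 0 < ε →
    ∃ (G : Finset A) (δ : ℝ), 0 < δ ∧
      ∀ (B : Type u) [NonUnitalCStarAlgebra B] [PartialOrder B] [StarOrderedRing B]
        (ι : A →⋆ₙₐ[ℂ] B), Function.Injective ι →
        ∀ ω₁ ω₂ : B →ₚ[ℂ] ℂ, IsPureState ω₁ → IsPureState ω₂ → GNSEquivalent ω₁ ω₂ →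
          (∀ x ∈ G, ‖ω₁ (ι x) - ω₂ (ι x)‖ < δ) →
          ∀ ε' : ℝ, 0 < ε' →
            ∃ w : ℝ → Unitization ℂ B,
              ContinuousOn w (Set.Icc 0 1) ∧
              (∀ t ∈ Set.Icc (0 : ℝ) 1, w t ∈ unitaryGroup B) ∧
              w 0 = 1 ∧
              (∀ b : B, ω₁ b = ω₂ (Ad (w 1) b)) ∧
              eVariationOn w (Set.Icc 0 1) < ENNReal.ofReal (C + ε') ∧
              ∀ x ∈ F, ∀ t ∈ Set.Icc (0 : ℝ) 1, ‖Ad (w t) (ι x) - ι x‖ < ε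

/-- A *-subalgebra `S` is hereditary if `0 ≤ a ≤ b` and `b ∈ S` imply `a ∈ S`. (A hereditary
C*-subalgebra is a norm-closed hereditary *-subalgebra.) -/
def IsHereditary {A : Type u} [NonUnitalCStarAlgebra A] [PartialOrder A]
    (S : NonUnitalStarSubalgebra ℂ A) : Prop :=
  ∀ a b : A, 0 ≤ a → a ≤ b → b ∈ S → a ∈ S

end

end PureStateHomogeneity

/-! The test algebra `B` contains only `A₁`, while the property of `A` speaks about algebras
containing `A`. Hereditariness bridges this gap: for self-adjoint `c` in `A₁` the map `a ↦ c a c`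
sends the unitization of `A` into `A₁`, hence completely positively into `B`. Its Stinespring
dilation `ρ` over a faithful representation of `B` satisfies `V₁* ρ(a) V₁ = c a c`. The operators on
the dilation space that are adjointable for the Hilbert `B`-module behind it form a C*-algebra which
contains the image of `ρ` and whose compressions by `V₁` lie in `B`. Vector states at vectors fixed
by `c` become equivalent pure states of this algebra (`isPureState_of_compression`,
`gnsEquivalent_of_vectors`). The property of `A` therefore yields a unitary `W` there which almost
commutes with the given finite set and carries one vector functional to the other
(`exists_unitary_dilation`). Only the endpoint of the path is used.

A path in `B` has to be rebuilt from `W`. A logarithm of `W` need not be a continuous function of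
`W`, so it need not inherit almost-commutation. Instead a rotation `l W` is given a truncated
logarithm `h`, continuous in `W` and of norm at most `π - c₀`. Averaging over finitely many `l`
shows that for some `l` its error at the given vector is at most `κ c₀` (`exists_rotations`,
`exists_rotation_truncLog`). The comparison with the gap `c₀` is the crux: `G` and `δ` are fixed
before `ε'`, so correcting the error must be paid for out of the gap. The compression `k = V₁* h V₁`
lies in `B` and performs nearly the same rotation (`exists_compression`, `exists_corner_rotation`).

The vectors `ξ₁, ξ₂` of the given states need not be fixed by any element of `A₁`. Take positive
contractions `f_j` in `A₁`, each a unit for its predecessors. By pigeonhole some `j` nearly splits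
both vectors into `f_j ξ` and `ξ - g ξ` with `g = f_{j+3}`. The first parts are rotated as above.
The second parts are rotated by an element orthogonal to everything on which `g` acts as a unit,
obtained from Kadison transitivity and a Cayley transform, of norm at most `2 arctan 16 < π`
(`exists_complement_rotation`). Both rotations must produce the same phase, and the second needs a
nonnegative real part of an inner product; for this `l W` and `-l W` are treated together and the
sign is chosen at the end. The two generators are orthogonal, so their sum has norm at most `π - c₀`
(`exists_rotation_add`). A last exact Cayley rotation of norm at most `c₀ / 2` removes the remaining
error, and the path has length at most `π - c₀ / 2`. -/

namespace PureStateHomogeneity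

open scoped InnerProductSpace

/-! ### Exponentials of self-adjoint elements -/

section UnitaryExponential

/-- The exponential `exp (i h)`. -/
noncomputable def uexp {E : Type*} [CStarAlgebra E] (h : E) : E := NormedSpace.exp (Complex.I • h)

variable {E : Type*} [CStarAlgebra E]

lemma uexp_zero : uexp (0 : E) = 1 := by simp [uexp]

lemma uexp_mem_unitary {h : E} (hh : IsSelfAdjoint h) : uexp h ∈ unitary E :=
  (selfAdjoint.expUnitary ⟨h, hh⟩).2

lemma norm_le_one_of_mem_unitary {u : E} (hu : u ∈ unitary E) : ‖u‖ ≤ 1 := by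
  rcases subsingleton_or_nontrivial E with h | h
  · rw [Subsingleton.elim u 0]; simp
  · exact (CStarRing.norm_of_mem_unitary hu).le

lemma norm_uexp_le {h : E} (hh : IsSelfAdjoint h) : ‖uexp h‖ ≤ 1 :=
  norm_le_one_of_mem_unitary (uexp_mem_unitary hh)

lemma uexp_add {h k : E} (hk : Commute h k) : uexp (h + k) = uexp h * uexp k := by
  let +nondep : NormedAlgebra ℚ E := .restrictScalars ℚ ℂ E
  rw [uexp, smul_add]
  exact NormedSpace.exp_add_of_commute ((hk.smul_left _).smul_right _)

lemma uexp_neg_mul_uexp (h : E) : uexp (-h) * uexp h = 1 := by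
  rw [← uexp_add ((Commute.refl h).neg_left)]; simp [uexp_zero]

lemma uexp_mul_uexp_neg (h : E) : uexp h * uexp (-h) = 1 := by
  rw [← uexp_add ((Commute.refl h).neg_right)]; simp [uexp_zero]

lemma star_uexp {h : E} (hh : IsSelfAdjoint h) : star (uexp h) = uexp (-h) := by
  have h1 := (Unitary.mem_iff.mp (uexp_mem_unitary hh)).1
  calc star (uexp h) = star (uexp h) * (uexp h * uexp (-h)) := by rw [uexp_mul_uexp_neg, mul_one]
    _ = _ := by rw [← mul_assoc, h1, one_mul]

lemma hasDerivAt_uexp_smul (h : E) (t : ℝ) :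
    HasDerivAt (fun s : ℝ => uexp (s • h)) ((Complex.I • h) * uexp (t • h)) t := by
  have := hasDerivAt_exp_smul_const' (𝕂 := ℝ) (Complex.I • h) t
  simpa only [uexp, smul_comm Complex.I] using this

lemma hasDerivAt_uexp_smul' (h : E) (t : ℝ) :
    HasDerivAt (fun s : ℝ => uexp (s • h)) (uexp (t • h) * (Complex.I • h)) t := by
  have := hasDerivAt_exp_smul_const (𝕂 := ℝ) (Complex.I • h) t
  simpa only [uexp, smul_comm Complex.I] using this

lemma IsSelfAdjoint.real_smul {h : E} (hh : IsSelfAdjoint h) (s : ℝ) : IsSelfAdjoint (s • h) :=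
  (IsSelfAdjoint.all s).smul hh

lemma norm_mul_le_right {a b : E} (ha : ‖a‖ ≤ 1) : ‖a * b‖ ≤ ‖b‖ :=
  (norm_mul_le _ _).trans (mul_le_of_le_one_left (norm_nonneg _) ha)

lemma norm_mul_le_left {a b : E} (hb : ‖b‖ ≤ 1) : ‖a * b‖ ≤ ‖a‖ :=
  (norm_mul_le _ _).trans (mul_le_of_le_one_right (norm_nonneg _) hb)

lemma norm_uexp_smul_sub_le {h : E} (hh : IsSelfAdjoint h) (s t : ℝ) :
    ‖uexp (s • h) - uexp (t • h)‖ ≤ ‖h‖ * |s - t| := by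
  refine Convex.norm_image_sub_le_of_norm_hasDerivWithin_le (s := Set.univ)
    (fun x _ => (hasDerivAt_uexp_smul h x).hasDerivWithinAt) (fun x _ => ?_) convex_univ
    (Set.mem_univ t) (Set.mem_univ s)
  refine (norm_mul_le_left (norm_uexp_le (IsSelfAdjoint.real_smul hh x))).trans ?_
  simp [norm_smul]

/-- The curve `s ↦ exp(ish) x exp(-ish)` has as derivative a unitary conjugate of `i(hx - xh)`, so
it moves by at most the norm of the commutator in unit time. -/
lemma norm_uexp_commutator_le {h : E} (hh : IsSelfAdjoint h) (x : E) :
    ‖uexp h * x - x * uexp h‖ ≤ ‖h * x - x * h‖ := by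
  have hd (t : ℝ) : HasDerivAt (fun s : ℝ => uexp (s • h) * x * uexp (s • (-h)))
      (uexp (t • h) * (Complex.I • (h * x - x * h)) * uexp (t • (-h))) t := by
    refine (((hasDerivAt_uexp_smul' h t).mul_const x).mul
      (hasDerivAt_uexp_smul (-h) t)).congr_deriv ?_
    simp only [mul_assoc, smul_mul_assoc, mul_smul_comm, smul_neg,
      mul_neg, neg_mul, sub_eq_add_neg, mul_add, add_mul, smul_add]
  have key := Convex.norm_image_sub_le_of_norm_hasDerivWithin_le (s := Set.univ)
    (C := ‖h * x - x * h‖) (fun t _ => (hd t).hasDerivWithinAt) (fun t _ => by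
      refine (norm_mul_le_left (norm_uexp_le (IsSelfAdjoint.real_smul hh.neg t))).trans
        ((norm_mul_le_right (norm_uexp_le (IsSelfAdjoint.real_smul hh t))).trans ?_)
      simp [norm_smul]) convex_univ (Set.mem_univ 0) (Set.mem_univ 1)
  simp only [one_smul, zero_smul, uexp_zero, one_mul, mul_one, sub_zero, norm_one] at key
  have e : uexp h * x - x * uexp h = (uexp h * x * uexp (-h) - x) * uexp h := by
    rw [sub_mul, mul_assoc _ (uexp (-h)), uexp_neg_mul_uexp, mul_one]
  rw [e]
  exact (norm_mul_le_left (norm_uexp_le hh)).trans key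

end UnitaryExponential

/-! ### Unitary groups on Hilbert space and almost intertwiners -/

section Operators

variable {H K : Type*} [NormedAddCommGroup H] [InnerProductSpace ℂ H] [CompleteSpace H]
  [NormedAddCommGroup K] [InnerProductSpace ℂ K] [CompleteSpace K]

lemma norm_uexp_apply_le {T : H →L[ℂ] H} (hT : IsSelfAdjoint T) (x : H) : ‖uexp T x‖ ≤ ‖x‖ :=
  ((uexp T).le_opNorm x).trans (mul_le_of_le_one_left (norm_nonneg _) (norm_uexp_le hT))

lemma norm_uexp_apply {T : H →L[ℂ] H} (hT : IsSelfAdjoint T) (x : H) : ‖uexp T x‖ = ‖x‖ := by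
  refine le_antisymm (norm_uexp_apply_le hT x) ?_
  have : uexp (-T) (uexp T x) = x := by
    change (uexp (-T) * uexp T) x = x
    rw [uexp_neg_mul_uexp]; rfl
  calc ‖x‖ = ‖uexp (-T) (uexp T x)‖ := by rw [this]
    _ ≤ _ := norm_uexp_apply_le hT.neg _

/-- Comparison of two unitary one-parameter groups along an almost intertwining operator. -/
lemma norm_intertwine_uexp_sub_le {T : K →L[ℂ] K} {S : H →L[ℂ] H} (hS : IsSelfAdjoint S)
    (X : K →L[ℂ] H) (y : K) (r : ℝ)
    (hr : ∀ s ∈ Set.Icc (0 : ℝ) 1, ‖X (T (uexp (s • T) y)) - S (X (uexp (s • T) y))‖ ≤ r) :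
    ‖X (uexp T y) - uexp S (X y)‖ ≤ r := by
  -- Duhamel: the derivative of `exp(-isS) X exp(isT) y` is a unitary applied to `i(XT - SX)
  -- exp(isT) y`. The defect of `X` matters only along the orbit of `y`.
  have hd (t : ℝ) : HasDerivAt (fun s : ℝ => uexp (s • (-S)) (X (uexp (s • T) y)))
      (uexp (t • (-S)) (Complex.I • (X (T (uexp (t • T) y)) - S (X (uexp (t • T) y))))) t := by
    have h1 : HasDerivAt (fun s : ℝ => X (uexp (s • T) y)) (X ((Complex.I • T) (uexp (t • T) y)))
        t := by
      have h2 : HasDerivAt (fun s : ℝ => uexp (s • T) y) (((Complex.I • T) * uexp (t • T)) y) t :=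
        ((ContinuousLinearMap.apply ℂ K y).restrictScalars ℝ).hasFDerivAt.comp_hasDerivAt t
          (hasDerivAt_uexp_smul T t)
      exact ((X.restrictScalars ℝ).hasFDerivAt.comp_hasDerivAt t h2)
    have h3 : HasDerivAt (fun s : ℝ => (uexp (s • (-S))).restrictScalars ℝ)
        ((uexp (t • (-S)) * (Complex.I • (-S))).restrictScalars ℝ) t :=
      (ContinuousLinearMap.restrictScalarsL ℂ H H ℝ ℝ).hasFDerivAt.comp_hasDerivAt t
        (hasDerivAt_uexp_smul' (-S) t)
    refine (h3.clm_apply h1).congr_deriv ?_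
    change uexp (t • (-S)) ((Complex.I • (-S)) (X (uexp (t • T) y))) +
      uexp (t • (-S)) (X (Complex.I • T (uexp (t • T) y))) = _
    rw [← map_add, map_smul X, smul_sub]
    congr 1
    rw [sub_eq_neg_add]
    congr 1
    simp
  have key := Convex.norm_image_sub_le_of_norm_hasDerivWithin_le (s := Set.Icc (0 : ℝ) 1)
    (C := r) (fun t _ => (hd t).hasDerivWithinAt) (fun t ht => by
      refine (norm_uexp_apply_le (IsSelfAdjoint.real_smul hS.neg t) _).trans ?_
      rw [norm_smul, Complex.norm_I, one_mul]
      exact hr t ht) (convex_Icc 0 1) (Set.left_mem_Icc.2 zero_le_one)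
      (Set.right_mem_Icc.2 zero_le_one)
  simp only [one_smul, zero_smul, uexp_zero, sub_zero, norm_one, mul_one, one_apply_eq_self] at key
  have e : X (uexp T y) - uexp S (X y) = uexp S (uexp (-S) (X (uexp T y)) - X y) := by
    rw [map_sub]
    congr 1
    change _ = (uexp S * uexp (-S)) (X (uexp T y))
    rw [uexp_mul_uexp_neg]; rfl
  rw [e]
  exact (norm_uexp_apply_le hS _).trans key

end Operators

/-! ### The logarithm of the Cayley transform -/

section Cayley

variable {E : Type*} [CStarAlgebra E]

lemma uexp_cfc {W : E} [hW : IsStarNormal W] {g : ℂ → ℝ} (hg : ContinuousOn g (spectrum ℂ W)) :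
    uexp (cfc (fun z => (g z : ℂ)) W) = cfc (fun z => Complex.exp (Complex.I * g z)) W := by
  have hg' : ContinuousOn (fun z => (g z : ℂ)) (spectrum ℂ W) :=
    Complex.continuous_ofReal.comp_continuousOn hg
  have hg2 : ContinuousOn (fun z => Complex.I * (g z : ℂ)) (spectrum ℂ W) :=
    continuousOn_const.mul hg'
  have h1 : Complex.I • cfc (fun z => (g z : ℂ)) W = cfc (fun z => Complex.I * (g z : ℂ)) W :=
    (cfc_const_mul _ _ W hg').symm
  rw [uexp, h1, ← CFC.exp_eq_normedSpace_exp (𝕜 := ℂ) (cfc_predicate _ W), ← cfc_comp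
    (NormedSpace.exp) (fun z => Complex.I * (g z : ℂ)) W hW
    (NormedSpace.exp_continuous.continuousOn) hg2]
  simp only [Function.comp_def, Complex.exp_eq_exp_ℂ]

/-- `exp(i arctan t) = (1 + it) / √(1 + t²)`; squaring gives the Cayley transform `(1 + it) / (1 -
it)`. The form without a quotient carries over to elements of an algebra. -/
lemma Complex.exp_I_two_arctan_mul (t : ℝ) :
    Complex.exp (Complex.I * ((2 * Real.arctan t : ℝ) : ℂ)) * (1 - Complex.I * t) =
      1 + Complex.I * t := by
  have hc : (1 - Complex.I * t) ≠ 0 := by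
    intro h
    have := congrArg Complex.re h
    simp at this
  have h0 : (1 + (t : ℝ) ^ 2) ≠ 0 := by positivity
  have h1 : Complex.exp (Complex.I * (Real.arctan t : ℂ)) =
      (1 + Complex.I * t) / (Real.sqrt (1 + t ^ 2) : ℝ) := by
    rw [mul_comm, Complex.exp_mul_I, ← Complex.ofReal_cos, ← Complex.ofReal_sin, Real.cos_arctan,
      Real.sin_arctan]
    push_cast
    ring
  have h2 : ((2 * Real.arctan t : ℝ) : ℂ) = Real.arctan t + Real.arctan t := by push_cast; ring
  have h3 : ((Real.sqrt (1 + t ^ 2) : ℝ) : ℂ) * (Real.sqrt (1 + t ^ 2) : ℝ) = 1 + (t : ℂ) ^ 2 := by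
    rw [← Complex.ofReal_mul, Real.mul_self_sqrt (by positivity)]; push_cast; rfl
  have h4 : (1 + (t : ℂ) ^ 2) ≠ 0 := by exact_mod_cast h0
  rw [h2, mul_add, Complex.exp_add, h1, div_mul_div_comm, h3]
  field_simp
  linear_combination ((1 : ℂ) + Complex.I * t) * (-t ^ 2 ) * Complex.I_sq

/-- `2 arctan b`, whose exponential is the Cayley transform of `b`. -/
noncomputable def cayleyLog {B : Type*} [NonUnitalCStarAlgebra B] (b : B) : B :=
  cfcₙ (fun t : ℝ => 2 * Real.arctan t) b

lemma uexp_cfc_real {b : E} (hb : IsSelfAdjoint b) {g : ℝ → ℝ} (hg : Continuous g) :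
    uexp (cfc g b) = cfc (fun z : ℂ => Complex.exp (Complex.I * g z.re)) b := by
  have := hb.isStarNormal
  rw [cfc_real_eq_complex g hb]
  exact uexp_cfc (g := fun z => g z.re) (hg.comp Complex.continuous_re).continuousOn

lemma uexp_cfc_two_arctan_mul {b : E} (hb : IsSelfAdjoint b) :
    uexp (cfc (fun t : ℝ => 2 * Real.arctan t) b) * (1 - Complex.I • b) = 1 + Complex.I • b := by
  have hn := hb.isStarNormal
  have hc : Continuous (fun z : ℂ => Complex.exp (Complex.I * ((2 * Real.arctan z.re : ℝ) : ℂ))) :=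
    Complex.continuous_exp.comp (continuous_const.mul (Complex.continuous_ofReal.comp
      (continuous_const.mul (Real.continuous_arctan.comp Complex.continuous_re))))
  have hid : cfc (fun z : ℂ => 1 - Complex.I * z) b = 1 - Complex.I • b := by
    rw [cfc_sub (fun _ => (1 : ℂ)) (fun z => Complex.I * z) b, cfc_const_mul Complex.I _ b,
      cfc_const_one ℂ b, cfc_id' ℂ b]
  have hid' : cfc (fun z : ℂ => 1 + Complex.I * z) b = 1 + Complex.I • b := by
    rw [cfc_add b (fun _ => (1 : ℂ)) (fun z => Complex.I * z), cfc_const_mul Complex.I _ b,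
      cfc_const_one ℂ b, cfc_id' ℂ b]
  rw [uexp_cfc_real hb (by fun_prop), ← hid, ← cfc_mul _ _ b hc.continuousOn
    (by fun_prop), ← hid']
  refine cfc_congr fun z hz => ?_
  have hz' : z = (z.re : ℂ) := hb.mem_spectrum_eq_re hz
  rw [hz']
  simpa using Complex.exp_I_two_arctan_mul z.re

variable {B : Type*} [NonUnitalCStarAlgebra B]

lemma isSelfAdjoint_cayleyLog (b : B) : IsSelfAdjoint (cayleyLog b) := cfcₙ_predicate _ b

lemma inr_cayleyLog (b : B) :
    ((cayleyLog b : B) : Unitization ℂ B) = cfc (fun t : ℝ => 2 * Real.arctan t) (b : Unitization ℂ B) :=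
  Unitization.real_cfcₙ_eq_cfc_inr b _ (by simp)

lemma uexp_cayleyLog_mul {b : B} (hb : IsSelfAdjoint b) :
    uexp ((cayleyLog b : B) : Unitization ℂ B) * (1 - Complex.I • (b : Unitization ℂ B)) =
      1 + Complex.I • (b : Unitization ℂ B) := by
  rw [inr_cayleyLog]
  exact uexp_cfc_two_arctan_mul (hb.inr ℂ)

lemma Real.abs_arctan_le (t : ℝ) : |Real.arctan t| ≤ |t| := by
  have h : ∀ t : ℝ, 0 ≤ t → Real.arctan t ≤ t := fun t ht => by
    have h1 := Real.arctan_nonneg.2 ht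
    have := Real.le_tan h1 (Real.arctan_lt_pi_div_two t)
    rwa [Real.tan_arctan] at this
  rcases le_total 0 t with ht | ht
  · rw [abs_of_nonneg ht, abs_of_nonneg (Real.arctan_nonneg.2 ht)]; exact h t ht
  · rw [abs_of_nonpos ht, abs_of_nonpos (Real.arctan_le_zero.2 ht), ← Real.arctan_neg]
    exact h _ (by linarith)

lemma norm_cayleyLog_le {b : B} (hb : IsSelfAdjoint b) : ‖cayleyLog b‖ ≤ 2 * ‖b‖ := by
  refine norm_cfcₙ_le fun t ht => ?_
  have h1 : |t| ≤ ‖b‖ := NonUnitalIsometricContinuousFunctionalCalculus.norm_quasispectrum_le (𝕜 := ℝ) b ht hb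
  rw [Real.norm_eq_abs, abs_mul, abs_two]
  linarith [Real.abs_arctan_le t]

lemma Real.abs_arctan_le_of_abs_le {t M : ℝ} (h : |t| ≤ M) : |Real.arctan t| ≤ Real.arctan M := by
  rw [abs_le] at h ⊢
  rw [← Real.arctan_neg]
  exact ⟨Real.arctan_mono h.1, Real.arctan_mono h.2⟩

lemma norm_cayleyLog_le_of_norm_le {b : B} (hb : IsSelfAdjoint b) {M : ℝ} (hM : ‖b‖ ≤ M) :
    ‖cayleyLog b‖ ≤ 2 * Real.arctan M := by
  refine norm_cfcₙ_le fun t ht => ?_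
  have h1 : |t| ≤ ‖b‖ := NonUnitalIsometricContinuousFunctionalCalculus.norm_quasispectrum_le (𝕜 := ℝ) b ht hb
  rw [Real.norm_eq_abs, abs_mul, abs_two]
  linarith [Real.abs_arctan_le_of_abs_le (h1.trans hM)]

/-- From `(2 arctan t)² ≤ 4t²` the square of the logarithm is at most `4b²`; conjugation by `k`
turns the right side into `0`. -/
lemma mul_cayleyLog_eq_zero {b k : B} (hb : IsSelfAdjoint b) (h : k * b = 0) :
    k * cayleyLog b = 0 := by
  let := CStarAlgebra.spectralOrder B
  let := CStarAlgebra.spectralOrderedRing B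
  have h1 : cayleyLog b * cayleyLog b ≤ (4 : ℝ) • (b * b) := by
    have e1 : cayleyLog b * cayleyLog b =
        cfcₙ (fun t : ℝ => (2 * Real.arctan t) * (2 * Real.arctan t)) b :=
      (cfcₙ_mul (fun t : ℝ => 2 * Real.arctan t) (fun t : ℝ => 2 * Real.arctan t) b
        (by fun_prop) (by simp) (by fun_prop) (by simp)).symm
    have e2 : (4 : ℝ) • (b * b) = cfcₙ (fun t : ℝ => (4 : ℝ) • (t * t)) b := by
      rw [cfcₙ_smul (4 : ℝ) (fun t : ℝ => t * t) b (by fun_prop) (by simp),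
        cfcₙ_mul (fun t : ℝ => t) (fun t : ℝ => t) b (by fun_prop) (by simp) (by fun_prop) (by simp),
        cfcₙ_id' ℝ b]
    rw [e1, e2]
    refine cfcₙ_mono (fun t _ => ?_) (by fun_prop) (by fun_prop) (by simp) (by simp)
    have := Real.abs_arctan_le t
    have h2 := mul_self_le_mul_self (abs_nonneg _) this
    rw [abs_mul_abs_self, abs_mul_abs_self] at h2
    simp only [smul_eq_mul]
    linarith
  have h2 := star_right_conjugate_le_conjugate h1 k
  have h3 : k * ((4 : ℝ) • (b * b)) * star k = 0 := by
    rw [mul_smul_comm, ← mul_assoc, h]; simp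
  rw [h3] at h2
  have h4 : k * (cayleyLog b * cayleyLog b) * star k = (k * cayleyLog b) * star (k * cayleyLog b) := by
    rw [star_mul, (isSelfAdjoint_cayleyLog b).star_eq]; simp only [mul_assoc]
  rw [h4] at h2
  exact CStarRing.mul_star_self_eq_zero_iff _ |>.1 (le_antisymm h2 (mul_star_self_nonneg _))

lemma cayleyLog_mul_eq_zero {b k : B} (hb : IsSelfAdjoint b) (h : b * k = 0) :
    cayleyLog b * k = 0 := by
  have : star k * cayleyLog b = 0 := by
    refine mul_cayleyLog_eq_zero hb ?_
    rw [← hb.star_eq, ← star_mul, h, star_zero]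
  rw [← (isSelfAdjoint_cayleyLog b).star_eq, ← star_star k, ← star_mul, this, star_zero]

end Cayley

/-! ### Commutators with continuous functions of a unitary -/

section Commutator

/-- Continuous functions of a unitary almost commute with whatever almost commutes with the
unitary, uniformly over all C*-algebras. -/
lemma exists_commutator_cfc_lt (f : C(Metric.sphere (0 : ℂ) 1, ℂ)) :
    ∀ F : ℂ → ℂ, (∀ z : Metric.sphere (0 : ℂ) 1, F z = f z) → ∀ ε : ℝ, 0 < ε → ∀ R : ℝ, ∃ δ : ℝ,
      0 < δ ∧ ∀ (E : Type*) [CStarAlgebra E] (W x : E), W ∈ unitary E → ‖x‖ ≤ R →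
        ‖W * x - x * W‖ ≤ δ → ‖cfc F W * x - x * cfc F W‖ ≤ ε := by
  classical
  have ext_cont : ∀ g : C(Metric.sphere (0 : ℂ) 1, ℂ), ∀ G : ℂ → ℂ,
      (∀ z : Metric.sphere (0 : ℂ) 1, G z = g z) → ContinuousOn G (Metric.sphere (0 : ℂ) 1) := by
    intro g G hG
    rw [continuousOn_iff_continuous_domRestrict]
    convert g.continuous using 1
    ext z; exact hG z
  have ext_ex : ∀ g : C(Metric.sphere (0 : ℂ) 1, ℂ), ∃ G : ℂ → ℂ,
      ∀ z : Metric.sphere (0 : ℂ) 1, G z = g z := fun g =>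
    ⟨fun z => if h : z ∈ Metric.sphere (0 : ℂ) 1 then g ⟨z, h⟩ else 0, fun z => by simp⟩
  have normal : ∀ (E : Type _) [CStarAlgebra E] (W : E), W ∈ unitary E → IsStarNormal W :=
    fun E _ W hW => ⟨by
      rw [Unitary.mem_iff] at hW
      rw [Commute, SemiconjBy, hW.1, hW.2]⟩
  -- Stone–Weierstrass: the functions with the property contain `z` and its conjugate and are stable
  -- under sums, products and uniform limits. At each stage `δ` depends only on `f`, `ε` and `R`,
  -- never on the algebra. The values of `F` off the circle are irrelevant because the spectrum of
  -- `W` lies on it.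
  induction f using ContinuousMap.induction_on_of_compact with
  | const r =>
    intro F hF ε hε R
    refine ⟨1, one_pos, fun E _ W x hW hx h => ?_⟩
    have := normal E W hW
    have e : cfc F W = cfc (fun _ => r) W := cfc_congr fun z hz => by
      simpa using hF ⟨z, spectrum.subset_circle_of_unitary hW hz⟩
    rw [e, cfc_const r W, Algebra.commutes, sub_self, norm_zero]
    exact hε.le
  | id =>
    intro F hF ε hε R
    refine ⟨ε, hε, fun E _ W x hW hx h => ?_⟩
    have := normal E W hW
    have e : cfc F W = W := by
      conv_rhs => rw [← cfc_id' ℂ W]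
      exact cfc_congr fun z hz => by
        simpa using hF ⟨z, spectrum.subset_circle_of_unitary hW hz⟩
    rwa [e]
  | star_id =>
    intro F hF ε hε R
    refine ⟨ε, hε, fun E _ W x hW hx h => ?_⟩
    have := normal E W hW
    have e : cfc F W = star W := by
      have h1 : star W = cfc (fun z : ℂ => star z) W := by
        rw [cfc_star (fun z : ℂ => z) W, cfc_id' ℂ W]
      rw [h1]
      exact cfc_congr fun z hz => by
        simpa using hF ⟨z, spectrum.subset_circle_of_unitary hW hz⟩
    rw [e]
    have hW' := Unitary.mem_iff.1 hW
    -- The commutator with `W*` is `-W* [W, x] W*`, so the same `δ` serves.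
    have e2 : star W * x - x * star W = star W * (-(W * x - x * W)) * star W := by
      rw [neg_sub, mul_sub, sub_mul]
      congr 1
      · rw [mul_assoc, mul_assoc x, hW'.2, mul_one]
      · rw [← mul_assoc, hW'.1, one_mul]
    rw [e2]
    refine (norm_mul_le_left (norm_le_one_of_mem_unitary (Unitary.star_mem hW))).trans
      ((norm_mul_le_right (norm_le_one_of_mem_unitary (Unitary.star_mem hW))).trans ?_)
    rwa [norm_neg]
  | add g₁ g₂ h₁ h₂ =>
    intro F hF ε hε R
    obtain ⟨G₁, hG₁⟩ := ext_ex g₁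
    obtain ⟨G₂, hG₂⟩ := ext_ex g₂
    obtain ⟨δ₁, hδ₁, k₁⟩ := h₁ G₁ hG₁ (ε / 2) (half_pos hε) R
    obtain ⟨δ₂, hδ₂, k₂⟩ := h₂ G₂ hG₂ (ε / 2) (half_pos hε) R
    refine ⟨min δ₁ δ₂, lt_min hδ₁ hδ₂, fun E _ W x hW hx h => ?_⟩
    have := normal E W hW
    have hs := spectrum.subset_circle_of_unitary (𝕜 := ℂ) hW
    have e : cfc F W = cfc G₁ W + cfc G₂ W := by
      rw [← cfc_add W G₁ G₂ ((ext_cont _ _ hG₁).mono hs) ((ext_cont _ _ hG₂).mono hs)]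
      exact cfc_congr fun z hz => by
        have h0 := hF ⟨z, hs hz⟩
        have h1 := hG₁ ⟨z, hs hz⟩
        have h2 := hG₂ ⟨z, hs hz⟩
        simp only at h0 h1 h2 ⊢
        rw [h0, h1, h2]; rfl
    rw [e, show (cfc G₁ W + cfc G₂ W) * x - x * (cfc G₁ W + cfc G₂ W) =
      (cfc G₁ W * x - x * cfc G₁ W) + (cfc G₂ W * x - x * cfc G₂ W) by noncomm_ring]
    refine (norm_add_le _ _).trans ?_
    linarith [k₁ E W x hW hx (h.trans (min_le_left _ _)),
      k₂ E W x hW hx (h.trans (min_le_right _ _))]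
  | mul g₁ g₂ h₁ h₂ =>
    intro F hF ε hε R
    obtain ⟨G₁, hG₁⟩ := ext_ex g₁
    obtain ⟨G₂, hG₂⟩ := ext_ex g₂
    have p₁ : 0 < ‖g₁‖ + 1 := by positivity
    have p₂ : 0 < ‖g₂‖ + 1 := by positivity
    obtain ⟨δ₁, hδ₁, k₁⟩ := h₁ G₁ hG₁ (ε / 2 / (‖g₂‖ + 1)) (by positivity) R
    obtain ⟨δ₂, hδ₂, k₂⟩ := h₂ G₂ hG₂ (ε / 2 / (‖g₁‖ + 1)) (by positivity) R
    refine ⟨min δ₁ δ₂, lt_min hδ₁ hδ₂, fun E _ W x hW hx h => ?_⟩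
    have := normal E W hW
    have hs := spectrum.subset_circle_of_unitary (𝕜 := ℂ) hW
    have e : cfc F W = cfc G₁ W * cfc G₂ W := by
      rw [← cfc_mul G₁ G₂ W ((ext_cont _ _ hG₁).mono hs) ((ext_cont _ _ hG₂).mono hs)]
      exact cfc_congr fun z hz => by
        have h0 := hF ⟨z, hs hz⟩
        have h1 := hG₁ ⟨z, hs hz⟩
        have h2 := hG₂ ⟨z, hs hz⟩
        simp only at h0 h1 h2 ⊢
        rw [h0, h1, h2]; rfl
    have n₁ : ‖cfc G₁ W‖ ≤ ‖g₁‖ + 1 := norm_cfc_le p₁.le fun z hz => by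
      have h1 := hG₁ ⟨z, hs hz⟩
      simp only at h1
      rw [h1]; linarith [g₁.norm_coe_le_norm ⟨z, hs hz⟩]
    have n₂ : ‖cfc G₂ W‖ ≤ ‖g₂‖ + 1 := norm_cfc_le p₂.le fun z hz => by
      have h1 := hG₂ ⟨z, hs hz⟩
      simp only at h1
      rw [h1]; linarith [g₂.norm_coe_le_norm ⟨z, hs hz⟩]
    rw [e, show (cfc G₁ W * cfc G₂ W) * x - x * (cfc G₁ W * cfc G₂ W) =
      cfc G₁ W * (cfc G₂ W * x - x * cfc G₂ W) + (cfc G₁ W * x - x * cfc G₁ W) * cfc G₂ W by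
        noncomm_ring]
    refine (norm_add_le _ _).trans ?_
    have a₁ := k₁ E W x hW hx (h.trans (min_le_left _ _))
    have a₂ := k₂ E W x hW hx (h.trans (min_le_right _ _))
    have b₁ : ‖cfc G₁ W * (cfc G₂ W * x - x * cfc G₂ W)‖ ≤ ε / 2 :=
      (norm_mul_le _ _).trans ((mul_le_mul n₁ a₂ (norm_nonneg _) p₁.le).trans
        (by rw [mul_div_cancel₀ _ p₁.ne']))
    have b₂ : ‖(cfc G₁ W * x - x * cfc G₁ W) * cfc G₂ W‖ ≤ ε / 2 :=
      (norm_mul_le _ _).trans ((mul_le_mul a₁ n₂ (norm_nonneg _) (by positivity)).trans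
        (by rw [div_mul_cancel₀ _ p₂.ne']))
    linarith
  | frequently g hg =>
    intro F hF ε hε R
    have hR : 0 < 4 * (|R| + 1) := by positivity
    obtain ⟨g', hg', hd⟩ := (hg.and_eventually
      (Metric.ball_mem_nhds g (div_pos hε hR))).exists
    obtain ⟨G, hG⟩ := ext_ex g'
    obtain ⟨δ, hδ, k⟩ := hg' G hG (ε / 2) (half_pos hε) R
    refine ⟨δ, hδ, fun E _ W x hW hx h => ?_⟩
    have := normal E W hW
    have hs := spectrum.subset_circle_of_unitary (𝕜 := ℂ) hW
    have hn : ‖cfc F W - cfc G W‖ ≤ ε / (4 * (|R| + 1)) := by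
      rw [← cfc_sub F G W ((ext_cont _ _ hF).mono hs) ((ext_cont _ _ hG).mono hs)]
      refine norm_cfc_le (by positivity) fun z hz => ?_
      have h0 := hF ⟨z, hs hz⟩
      have h1 := hG ⟨z, hs hz⟩
      simp only at h0 h1 ⊢
      rw [h0, h1, ← dist_eq_norm]
      rw [dist_comm] at hd
      exact (ContinuousMap.dist_apply_le_dist _).trans hd.le
    rw [show cfc F W * x - x * cfc F W = (cfc F W - cfc G W) * x - x * (cfc F W - cfc G W) +
      (cfc G W * x - x * cfc G W) by noncomm_ring]
    have hx' : ‖x‖ ≤ |R| + 1 := hx.trans ((le_abs_self R).trans (by linarith))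
    have hp : 0 < |R| + 1 := by positivity
    have c0 : ‖cfc F W - cfc G W‖ * ‖x‖ ≤ ε / 4 :=
      (mul_le_mul hn hx' (norm_nonneg _) (by positivity)).trans (le_of_eq (by field_simp))
    have c1 : ‖(cfc F W - cfc G W) * x‖ ≤ ε / 4 := (norm_mul_le _ _).trans c0
    have c2 : ‖x * (cfc F W - cfc G W)‖ ≤ ε / 4 :=
      (norm_mul_le _ _).trans (by rwa [mul_comm])
    refine (norm_add_le _ _).trans ?_
    linarith [norm_sub_le ((cfc F W - cfc G W) * x) (x * (cfc F W - cfc G W)), k E W x hW hx h]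

end Commutator

/-! ### Truncated logarithms of rotated unitaries -/

section ApproximateLogarithm

lemma Complex.norm_exp_I_sub_exp_I_le (a b : ℝ) :
    ‖Complex.exp (Complex.I * a) - Complex.exp (Complex.I * b)‖ ≤ |a - b| := by
  have : Complex.exp (Complex.I * a) - Complex.exp (Complex.I * b) =
      Complex.exp (Complex.I * b) * (Complex.exp (Complex.I * ((a - b : ℝ) : ℂ)) - 1) := by
    rw [mul_sub, mul_one, ← Complex.exp_add]; congr 2; push_cast; ring
  rw [this, norm_mul, mul_comm Complex.I (b : ℂ), Complex.norm_exp_ofReal_mul_I, one_mul]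
  exact Real.norm_exp_I_mul_ofReal_sub_one_le

lemma exp_I_mul_arg_of_mem_sphere {w : ℂ} (hw : w ∈ Metric.sphere (0 : ℂ) 1) :
    Complex.exp (Complex.I * (Complex.arg w : ℂ)) = w := by
  have := Complex.norm_mul_exp_arg_mul_I w
  rw [mem_sphere_zero_iff_norm.1 hw, Complex.ofReal_one, one_mul] at this
  rwa [mul_comm]

/-- Chord against arc: `π - |arg w|` is the arc length from `w` to `-1`. Consequently a point at
distance at least `t` from `-1` has `|arg w| ≤ π - t`. -/
lemma norm_add_one_le_of_mem_sphere {w : ℂ} (hw : w ∈ Metric.sphere (0 : ℂ) 1) :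
    ‖w + 1‖ ≤ Real.pi - |Complex.arg w| := by
  have h1 : Complex.exp (Complex.I * (Real.pi : ℂ)) = -1 := by
    rw [mul_comm]; exact Complex.exp_pi_mul_I
  have h2 : Complex.exp (Complex.I * ((-Real.pi : ℝ) : ℂ)) = -1 := by
    push_cast; rw [mul_neg, Complex.exp_neg, h1]; norm_num
  have e := exp_I_mul_arg_of_mem_sphere hw
  have k1 := Complex.norm_exp_I_sub_exp_I_le (Complex.arg w) Real.pi
  have k2 := Complex.norm_exp_I_sub_exp_I_le (Complex.arg w) (-Real.pi)
  rw [e, h1, sub_neg_eq_add] at k1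
  rw [e, h2, sub_neg_eq_add] at k2
  have l1 := Complex.arg_le_pi w
  have l2 := (Complex.neg_pi_lt_arg w).le
  rw [abs_of_nonpos (by linarith)] at k1
  rw [abs_of_nonneg (by linarith)] at k2
  rcases abs_cases (Complex.arg w) with ⟨h, _⟩ | ⟨h, _⟩ <;> rw [h] <;> linarith

/-- A continuous real function on the circle that agrees with the argument away from `-1`. -/
noncomputable def truncArg (c s : ℝ) (z : ℂ) : ℝ :=
  max (-(Real.pi - c)) (min (Real.pi - c) (Complex.arg z)) * min 1 (‖z + 1‖ / s)

lemma abs_clamp_le {M t : ℝ} (hM : 0 ≤ M) : |max (-M) (min M t)| ≤ M :=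
  abs_le.2 ⟨le_max_left _ _, max_le (by linarith) (min_le_left _ _)⟩

lemma abs_clamp_sub_le {M t c : ℝ} (hM : 0 ≤ M) (hc : 0 ≤ c) (ht : |t| ≤ M + c) :
    |max (-M) (min M t) - t| ≤ c := by
  rw [abs_le] at ht ⊢
  constructor
  · rcases le_total M t with h | h
    · rw [min_eq_left h, max_eq_right (by linarith)]; linarith
    · rw [min_eq_right h]; linarith [le_max_right (-M) t]
  · rcases le_total (-M) (min M t) with h | h
    · rw [max_eq_right h]; linarith [min_le_right M t]
    · rw [max_eq_left h]; linarith

lemma clamp_eq {M t : ℝ} (ht : |t| ≤ M) : max (-M) (min M t) = t := by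
  rw [abs_le] at ht
  rw [min_eq_right ht.2, max_eq_right ht.1]

lemma abs_truncArg_le {c s : ℝ} (hc : c ≤ 1) (hs : 0 < s) (z : ℂ) :
    |truncArg c s z| ≤ Real.pi - c := by
  have hM : 0 ≤ Real.pi - c := by linarith [Real.pi_gt_three]
  have h0 : (0 : ℝ) ≤ min 1 (‖z + 1‖ / s) := by positivity
  rw [truncArg, abs_mul, abs_of_nonneg h0]
  exact (mul_le_of_le_one_right (abs_nonneg _) (min_le_left _ _)).trans (abs_clamp_le hM)

/-- On the circle `arg` jumps only at `-1`, and there the factor `min 1 (‖z + 1‖ / s)` brings the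
bounded clamped argument down to `0`. -/
lemma continuousOn_truncArg {c s : ℝ} (hc : c ≤ 1) (hs : 0 < s) :
    ContinuousOn (truncArg c s) (Metric.sphere (0 : ℂ) 1) := by
  have hM : 0 ≤ Real.pi - c := by linarith [Real.pi_gt_three]
  intro z hz
  by_cases h : z = -1
  · subst h
    have h0 : truncArg c s (-1) = 0 := by simp [truncArg]
    rw [ContinuousWithinAt, h0]
    refine Filter.Tendsto.mono_left ?_ nhdsWithin_le_nhds
    refine squeeze_zero_norm (a := fun z => (Real.pi - c) * (‖z + 1‖ / s)) (fun w => ?_) ?_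
    · rw [truncArg, norm_mul, Real.norm_eq_abs, Real.norm_eq_abs,
        abs_of_nonneg (show (0 : ℝ) ≤ min 1 (‖w + 1‖ / s) by positivity)]
      exact mul_le_mul (abs_clamp_le hM) (min_le_right _ _) (by positivity) hM
    · have : Continuous (fun z : ℂ => (Real.pi - c) * (‖z + 1‖ / s)) := by fun_prop
      simpa using this.tendsto (-1)
  · have hsl : z ∈ Complex.slitPlane := by
      rw [Complex.mem_slitPlane_iff]
      by_contra! hcon
      have h1 : z = (z.re : ℂ) := by apply Complex.ext <;> simp [hcon.2]
      have h2 := mem_sphere_zero_iff_norm.1 hz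
      rw [h1, Complex.norm_real, Real.norm_eq_abs, abs_of_nonpos hcon.1] at h2
      apply h
      rw [h1, show z.re = -1 by linarith]; simp
    have ha := (Complex.continuousAt_arg hsl).continuousWithinAt (s := Metric.sphere (0 : ℂ) 1)
    refine ContinuousWithinAt.mul ?_ (by fun_prop)
    exact continuousWithinAt_const.max (continuousWithinAt_const.min ha)

/-- The error of `truncArg` as a logarithm. -/
noncomputable def logError (c s : ℝ) (z : ℂ) : ℝ :=
  ‖Complex.exp (Complex.I * truncArg c s z) - z‖ ^ 2

/-- Two scales of error. Within `s` of `-1` the damping destroys all information, and only the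
trivial bound `2² = 4` remains. Outside that arc only the clamp acts; it shifts the argument by at
most `c`, and not at all beyond distance `t ≥ c`. -/
lemma logError_le {c s t : ℝ} (hc0 : 0 < c) (hc : c ≤ 1) (hs : 0 < s) (ht : c ≤ t) {w : ℂ}
    (hw : w ∈ Metric.sphere (0 : ℂ) 1) :
    logError c s w ≤ (if ‖w + 1‖ < s then 4 else 0) + (if ‖w + 1‖ < t then c ^ 2 else 0) := by
  have hM : 0 ≤ Real.pi - c := by linarith [Real.pi_gt_three]
  have hE : 0 ≤ (if ‖w + 1‖ < t then c ^ 2 else 0) := by split_ifs <;> positivity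
  unfold logError
  by_cases h1 : ‖w + 1‖ < s
  · rw [if_pos h1]
    have : ‖Complex.exp (Complex.I * truncArg c s w) - w‖ ≤ 2 := by
      refine (norm_sub_le _ _).trans ?_
      rw [mem_sphere_zero_iff_norm.1 hw, mul_comm, Complex.norm_exp_ofReal_mul_I]; norm_num
    nlinarith [norm_nonneg (Complex.exp (Complex.I * truncArg c s w) - w)]
  · rw [if_neg h1, zero_add]
    have hf : truncArg c s w = max (-(Real.pi - c)) (min (Real.pi - c) (Complex.arg w)) := by
      have h2 : min 1 (‖w + 1‖ / s) = 1 := min_eq_left (by rw [le_div_iff₀ hs]; linarith)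
      rw [truncArg, h2, mul_one]
    have hb : ‖Complex.exp (Complex.I * truncArg c s w) - w‖ ≤ |truncArg c s w - Complex.arg w| := by
      have := Complex.norm_exp_I_sub_exp_I_le (truncArg c s w) (Complex.arg w)
      rwa [exp_I_mul_arg_of_mem_sphere hw] at this
    by_cases h2 : ‖w + 1‖ < t
    · rw [if_pos h2]
      have : |truncArg c s w - Complex.arg w| ≤ c := by
        rw [hf]
        exact abs_clamp_sub_le hM hc0.le (by linarith [Complex.abs_arg_le_pi w])
      exact pow_le_pow_left₀ (norm_nonneg _) (hb.trans this) 2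
    · rw [if_neg h2]
      have : truncArg c s w = Complex.arg w := by
        rw [hf]
        exact clamp_eq (by linarith [norm_add_one_le_of_mem_sphere hw])
      have h3 : |truncArg c s w - Complex.arg w| = 0 := by rw [this]; simp
      rw [h3] at hb
      rw [le_antisymm hb (norm_nonneg _)]; simp

/-- If the distinct points `l` are at least `2t` apart, then `l z` can be within `t` of `-1` for at
most one of them. Rotation thus keeps a fixed `z` out of the bad arc in all but one case. -/
lemma exists_separated_circle (N : ℕ) : ∃ (S : Finset ℂ) (t : ℝ), S.card = N ∧ 0 < t ∧
    (∀ l ∈ S, l ∈ Metric.sphere (0 : ℂ) 1) ∧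
    ∀ z ∈ Metric.sphere (0 : ℂ) 1, ∀ l ∈ S, ∀ l' ∈ S, ‖l * z + 1‖ < t → ‖l' * z + 1‖ < t →
      l = l' := by
  classical
  have hinf : (Metric.sphere (0 : ℂ) 1).Infinite := by
    refine (isPreconnected_sphere (by rw [Complex.rank_real_complex]; norm_num) 0 1).infinite_of_nontrivial ?_
    exact ⟨1, by simp, -1, by simp, by norm_num [Complex.ext_iff]⟩
  obtain ⟨S, hS, hN⟩ := hinf.exists_subset_card_eq N
  have hsep : ∃ t : ℝ, 0 < t ∧ ∀ p ∈ S.offDiag, 2 * t ≤ ‖p.1 - p.2‖ := by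
    rcases S.offDiag.eq_empty_or_nonempty with h | h
    · exact ⟨1, one_pos, by simp [h]⟩
    · obtain ⟨p, hp, hmin⟩ := S.offDiag.exists_min_image (fun p => ‖p.1 - p.2‖) h
      refine ⟨‖p.1 - p.2‖ / 2, half_pos (norm_pos_iff.2 (sub_ne_zero.2 (Finset.mem_offDiag.1 hp).2.2)),
        fun q hq => ?_⟩
      linarith [hmin q hq]
  obtain ⟨t, ht, hsep⟩ := hsep
  refine ⟨S, t, hN, ht, fun l hl => hS hl, fun z hz l hl l' hl' h1 h2 => ?_⟩
  by_contra hne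
  have h3 := hsep (l, l') (Finset.mem_offDiag.2 ⟨hl, hl', hne⟩)
  have h4 : ‖l - l'‖ = ‖(l * z + 1) - (l' * z + 1)‖ := by
    rw [show (l * z + 1) - (l' * z + 1) = (l - l') * z by ring, norm_mul,
      mem_sphere_zero_iff_norm.1 hz, mul_one]
  have h5 := norm_sub_le (l * z + 1) (l' * z + 1)
  simp only at h3
  linarith

lemma sum_indicator_le {S : Finset ℂ} {t b : ℝ} (hb : 0 ≤ b) {z : ℂ}
    (h : ∀ l ∈ S, ∀ l' ∈ S, ‖l * z + 1‖ < t → ‖l' * z + 1‖ < t → l = l') :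
    ∑ l ∈ S, (if ‖l * z + 1‖ < t then b else 0) ≤ b := by
  classical
  rw [← Finset.sum_filter, Finset.sum_const, nsmul_eq_mul]
  have : (S.filter fun l => ‖l * z + 1‖ < t).card ≤ 1 := Finset.card_le_one.2 fun l hl l' hl' => by
    rw [Finset.mem_filter] at hl hl'
    exact h l hl.1 l' hl'.1 hl.2 hl'.2
  have h2 : ((S.filter fun l => ‖l * z + 1‖ < t).card : ℝ) ≤ 1 := by exact_mod_cast this
  exact mul_le_of_le_one_left hb h2

/-- There are finitely many rotations for which the mean square error of the truncated logarithm is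
small compared with the gap that is left in its range. -/
lemma exists_rotations {κ c₁ : ℝ} (hκ : 0 < κ) (hc₁ : 0 < c₁) :
    ∃ c s : ℝ, 0 < c ∧ c ≤ c₁ ∧ c ≤ 1 ∧ 0 < s ∧ ∃ T : Finset (ℂ × ℂ), T.Nonempty ∧
      (∀ p ∈ T, p.1 * p.2 ∈ Metric.sphere (0 : ℂ) 1) ∧
      ∀ z ∈ Metric.sphere (0 : ℂ) 1,
        ∑ p ∈ T, (logError c s (p.1 * p.2 * z) + logError c s (-(p.1 * p.2) * z)) ≤
          (κ * c) ^ 2 * T.card := by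
  -- The order of the choices avoids a circle. The clamp error `c²` and the target `(κ c)²` scale
  -- alike, so the number `N₀` of rotations that dilutes it does not depend on `c`. The set `S₀`
  -- fixes `t`, then `c ≤ t` is chosen, then `N₁` large enough to dilute the error `4` below `(κ
  -- c)²`, and `S₁` finally fixes `s`.
  obtain ⟨N₀, hN₀⟩ := exists_nat_gt (4 / κ ^ 2)
  obtain ⟨S₀, t, hcard₀, ht, hS₀, hsep₀⟩ := exists_separated_circle N₀
  have hN₀' : (0 : ℝ) < N₀ := lt_of_le_of_lt (by positivity) hN₀
  set c := min c₁ (min t 1) with hcdef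
  have hc0 : 0 < c := lt_min hc₁ (lt_min ht one_pos)
  have hct : c ≤ t := (min_le_right _ _).trans (min_le_left _ _)
  have hc1 : c ≤ 1 := (min_le_right _ _).trans (min_le_right _ _)
  obtain ⟨N₁, hN₁⟩ := exists_nat_gt (16 / (κ * c) ^ 2)
  have hN₁' : (0 : ℝ) < N₁ := lt_of_le_of_lt (by positivity) hN₁
  obtain ⟨S₁, s, hcard₁, hs, hS₁, hsep₁⟩ := exists_separated_circle N₁
  have hmul : ∀ {a b : ℂ}, a ∈ Metric.sphere (0 : ℂ) 1 → b ∈ Metric.sphere (0 : ℂ) 1 →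
      a * b ∈ Metric.sphere (0 : ℂ) 1 := fun {a b} ha hb => by
    rw [mem_sphere_zero_iff_norm] at *; rw [norm_mul, ha, hb, one_mul]
  -- For each of the `N₀` first factors at most one second factor gives the error `4`; for each of
  -- the `N₁` second factors at most one first factor gives the error `c²`.
  have key : ∀ z ∈ Metric.sphere (0 : ℂ) 1,
      ∑ p ∈ S₀ ×ˢ S₁, logError c s (p.1 * p.2 * z) ≤ 4 * N₀ + c ^ 2 * N₁ := by
    intro z hz
    have hle : ∀ p ∈ S₀ ×ˢ S₁, logError c s (p.1 * p.2 * z) ≤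
        (if ‖p.2 * (p.1 * z) + 1‖ < s then 4 else 0) +
          (if ‖p.1 * (p.2 * z) + 1‖ < t then c ^ 2 else 0) := fun p hp => by
      rw [Finset.mem_product] at hp
      have := logError_le hc0 hc1 hs hct (hmul (hmul (hS₀ _ hp.1) (hS₁ _ hp.2)) hz)
      rwa [show p.2 * (p.1 * z) = p.1 * p.2 * z by ring, ← mul_assoc p.1]
    refine (Finset.sum_le_sum hle).trans ?_
    rw [Finset.sum_add_distrib]
    refine add_le_add ?_ ?_
    · rw [Finset.sum_product]
      refine (Finset.sum_le_card_nsmul S₀ _ 4 fun l hl =>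
        sum_indicator_le (by norm_num) (hsep₁ _ (hmul (hS₀ _ hl) hz))).trans ?_
      rw [hcard₀, nsmul_eq_mul, mul_comm]
    · rw [Finset.sum_product_right]
      refine (Finset.sum_le_card_nsmul S₁ _ (c ^ 2) fun l hl =>
        sum_indicator_le (by positivity) (hsep₀ _ (hmul (hS₁ _ hl) hz))).trans ?_
      rw [hcard₁, nsmul_eq_mul, mul_comm]
  refine ⟨c, s, hc0, min_le_left _ _, hc1, hs, S₀ ×ˢ S₁, ?_, fun p hp => ?_, fun z hz => ?_⟩
  · refine Finset.Nonempty.product (Finset.card_pos.1 ?_) (Finset.card_pos.1 ?_)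
    · rw [hcard₀]; exact_mod_cast hN₀'
    · rw [hcard₁]; exact_mod_cast hN₁'
  · rw [Finset.mem_product] at hp
    exact hmul (hS₀ _ hp.1) (hS₁ _ hp.2)
  · rw [Finset.sum_add_distrib]
    have k1 := key z hz
    -- Negating the rotation amounts to negating the point.
    have k2 := key (-z) (by simpa using hz)
    have e : ∀ p : ℂ × ℂ, -(p.1 * p.2) * z = p.1 * p.2 * -z := fun p => by ring
    simp only [e]
    rw [Finset.card_product, hcard₀, hcard₁]
    push_cast
    have b1 : 4 ≤ κ ^ 2 * N₀ := by
      rw [div_lt_iff₀ (by positivity)] at hN₀; linarith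
    have b2 : 16 ≤ (κ * c) ^ 2 * N₁ := by
      rw [div_lt_iff₀ (by positivity)] at hN₁; linarith
    have b3 : 16 * (N₀ : ℝ) ≤ (κ * c) ^ 2 * N₁ * N₀ := by gcongr
    have b4 : 4 * (c ^ 2 * N₁) ≤ κ ^ 2 * N₀ * (c ^ 2 * N₁) := by gcongr
    nlinarith

variable {K : Type*} [NormedAddCommGroup K] [InnerProductSpace ℂ K] [CompleteSpace K]

lemma isStarNormal_of_mem_unitary {E : Type*} [CStarAlgebra E] {W : E} (hW : W ∈ unitary E) :
    IsStarNormal W := ⟨by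
  rw [Unitary.mem_iff] at hW
  rw [Commute, SemiconjBy, hW.1, hW.2]⟩

/-- The truncated logarithm of a rotated unitary. -/
noncomputable def truncLog {E : Type*} [CStarAlgebra E] (c s : ℝ) (l : ℂ) (W : E) : E :=
  cfc (fun z => (truncArg c s (l * z) : ℂ)) W

lemma continuousOn_truncArg_mul {c s : ℝ} (hc : c ≤ 1) (hs : 0 < s) {l : ℂ}
    (hl : l ∈ Metric.sphere (0 : ℂ) 1) :
    ContinuousOn (fun z => truncArg c s (l * z)) (Metric.sphere (0 : ℂ) 1) :=
  (continuousOn_truncArg hc hs).comp (by fun_prop) fun z hz => by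
    rw [mem_sphere_zero_iff_norm] at *; rw [norm_mul, hl, hz, one_mul]

lemma isSelfAdjoint_truncLog {E : Type*} [CStarAlgebra E] (c s : ℝ) (l : ℂ) (W : E) :
    IsSelfAdjoint (truncLog c s l W) := by
  rw [truncLog, isSelfAdjoint_iff, ← cfc_star]
  simp

lemma norm_truncLog_le {E : Type*} [CStarAlgebra E] {c s : ℝ} (hc : c ≤ 1) (hs : 0 < s) (l : ℂ)
    (W : E) : ‖truncLog c s l W‖ ≤ Real.pi - c := by
  refine norm_cfc_le (by linarith [Real.pi_gt_three]) fun z _ => ?_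
  rw [Complex.norm_real, Real.norm_eq_abs]
  exact abs_truncArg_le hc hs _

lemma norm_cfc_apply_sq {W : K →L[ℂ] K} [IsStarNormal W] {g : ℂ → ℂ}
    (hg : ContinuousOn g (spectrum ℂ W)) (v : K) :
    ‖cfc g W v‖ ^ 2 = RCLike.re ⟪v, cfc (fun z => ((‖g z‖ ^ 2 : ℝ) : ℂ)) W v⟫_ℂ := by
  have h1 : cfc (fun z => ((‖g z‖ ^ 2 : ℝ) : ℂ)) W = star (cfc g W) * cfc g W := by
    rw [← cfc_star, ← cfc_mul (fun z => star (g z)) g W hg.star hg]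
    refine cfc_congr fun z _ => ?_
    rw [Complex.star_def, mul_comm, Complex.mul_conj, Complex.normSq_eq_norm_sq]
  rw [h1, ContinuousLinearMap.star_eq_adjoint]
  change _ = RCLike.re ⟪v, (cfc g W).adjoint (cfc g W v)⟫_ℂ
  rw [ContinuousLinearMap.adjoint_inner_right, inner_self_eq_norm_sq]

/-- This is integration against the spectral measure of `v`: a sum of terms `‖f(W) v‖²` equals `⟪v,
(∑ |f|²)(W) v⟫`, so a pointwise bound on the spectrum suffices. -/
lemma sum_norm_cfc_apply_sq_le {ι : Type*} {W : K →L[ℂ] K} [IsStarNormal W] (T : Finset ι)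
    (f g : ι → ℂ → ℂ) (hf : ∀ i ∈ T, ContinuousOn (f i) (spectrum ℂ W))
    (hg : ∀ i ∈ T, ContinuousOn (g i) (spectrum ℂ W)) {B : ℝ} (hB0 : 0 ≤ B)
    (hB : ∀ z ∈ spectrum ℂ W, ∑ i ∈ T, (‖f i z‖ ^ 2 + ‖g i z‖ ^ 2) ≤ B) (v : K) :
    ∑ i ∈ T, (‖cfc (f i) W v‖ ^ 2 + ‖cfc (g i) W v‖ ^ 2) ≤ B * ‖v‖ ^ 2 := by
  have hc : ∀ {h : ℂ → ℂ}, ContinuousOn h (spectrum ℂ W) →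
      ContinuousOn (fun z => ((‖h z‖ ^ 2 : ℝ) : ℂ)) (spectrum ℂ W) := fun hh =>
    Complex.continuous_ofReal.comp_continuousOn (hh.norm.pow 2)
  have hM : ‖cfc (fun z => ((∑ i ∈ T, (‖f i z‖ ^ 2 + ‖g i z‖ ^ 2) : ℝ) : ℂ)) W‖ ≤ B := by
    refine norm_cfc_le hB0 fun z hz => ?_
    rw [Complex.norm_real, Real.norm_eq_abs, abs_of_nonneg]
    · exact hB z hz
    · positivity
  have e1 : (fun z => ((∑ i ∈ T, (‖f i z‖ ^ 2 + ‖g i z‖ ^ 2) : ℝ) : ℂ)) =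
      ∑ i ∈ T, fun z => (((‖f i z‖ ^ 2 : ℝ) : ℂ) + ((‖g i z‖ ^ 2 : ℝ) : ℂ)) := by
    ext z; simp
  have e2 : cfc (fun z => ((∑ i ∈ T, (‖f i z‖ ^ 2 + ‖g i z‖ ^ 2) : ℝ) : ℂ)) W =
      ∑ i ∈ T, (cfc (fun z => ((‖f i z‖ ^ 2 : ℝ) : ℂ)) W +
        cfc (fun z => ((‖g i z‖ ^ 2 : ℝ) : ℂ)) W) := by
    rw [e1, cfc_sum (fun i z => ((‖f i z‖ ^ 2 : ℝ) : ℂ) + ((‖g i z‖ ^ 2 : ℝ) : ℂ)) W T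
      fun i hi => (hc (hf i hi)).add (hc (hg i hi))]
    exact Finset.sum_congr rfl fun i hi => cfc_add W _ _ (hc (hf i hi)) (hc (hg i hi))
  calc ∑ i ∈ T, (‖cfc (f i) W v‖ ^ 2 + ‖cfc (g i) W v‖ ^ 2)
      = ∑ i ∈ T, RCLike.re ⟪v, (cfc (fun z => ((‖f i z‖ ^ 2 : ℝ) : ℂ)) W +
        cfc (fun z => ((‖g i z‖ ^ 2 : ℝ) : ℂ)) W) v⟫_ℂ := by
        refine Finset.sum_congr rfl fun i hi => ?_
        rw [norm_cfc_apply_sq (hf i hi), norm_cfc_apply_sq (hg i hi), add_apply, inner_add_right,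
          map_add]
    _ = RCLike.re ⟪v, (∑ i ∈ T, (cfc (fun z => ((‖f i z‖ ^ 2 : ℝ) : ℂ)) W +
        cfc (fun z => ((‖g i z‖ ^ 2 : ℝ) : ℂ)) W)) v⟫_ℂ := by
        rw [_root_.sum_apply, inner_sum, map_sum]
    _ ≤ ‖v‖ * (B * ‖v‖) := by
        rw [← e2]
        refine (RCLike.re_le_norm _).trans ((norm_inner_le_norm _ _).trans ?_)
        refine mul_le_mul_of_nonneg_left ?_ (norm_nonneg _)
        exact (ContinuousLinearMap.le_opNorm _ _).trans
          (mul_le_mul_of_nonneg_right hM (norm_nonneg _))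
    _ = _ := by ring

lemma continuousOn_exp_truncArg_sub {c s : ℝ} (hc : c ≤ 1) (hs : 0 < s) {l : ℂ}
    (hl : l ∈ Metric.sphere (0 : ℂ) 1) :
    ContinuousOn (fun z => Complex.exp (Complex.I * truncArg c s (l * z)) - l * z)
      (Metric.sphere (0 : ℂ) 1) :=
  (Complex.continuous_exp.comp_continuousOn (continuousOn_const.mul
    (Complex.continuous_ofReal.comp_continuousOn (continuousOn_truncArg_mul hc hs hl)))).sub
      (by fun_prop)

lemma uexp_truncLog_sub {E : Type*} [CStarAlgebra E] {c s : ℝ} (hc : c ≤ 1) (hs : 0 < s) {l : ℂ}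
    (hl : l ∈ Metric.sphere (0 : ℂ) 1) {W : E} (hW : W ∈ unitary E) :
    uexp (truncLog c s l W) - l • W =
      cfc (fun z => Complex.exp (Complex.I * truncArg c s (l * z)) - l * z) W := by
  have hn := isStarNormal_of_mem_unitary hW
  have hsp := spectrum.subset_circle_of_unitary (𝕜 := ℂ) hW
  have h1 := (continuousOn_truncArg_mul hc hs hl).mono hsp
  have h2 := Complex.continuous_ofReal.comp_continuousOn h1
  rw [truncLog, uexp_cfc h1,
    cfc_sub (fun z => Complex.exp (Complex.I * truncArg c s (l * z))) (fun z => l * z) W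
    (Complex.continuous_exp.comp_continuousOn (continuousOn_const.mul h2)) (by fun_prop),
    cfc_const_mul l (fun z => z) W, cfc_id' ℂ W]

lemma sum_norm_uexp_truncLog_sub_sq_le {c s B : ℝ} (hc : c ≤ 1) (hs : 0 < s) (T : Finset (ℂ × ℂ))
    (hT : ∀ p ∈ T, p.1 * p.2 ∈ Metric.sphere (0 : ℂ) 1) (hB0 : 0 ≤ B)
    (hB : ∀ z ∈ Metric.sphere (0 : ℂ) 1,
      ∑ p ∈ T, (logError c s (p.1 * p.2 * z) + logError c s (-(p.1 * p.2) * z)) ≤ B)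
    {W : K →L[ℂ] K} (hW : W ∈ unitary (K →L[ℂ] K)) (v : K) :
    ∑ p ∈ T, (‖uexp (truncLog c s (p.1 * p.2) W) v - (p.1 * p.2) • W v‖ ^ 2 +
      ‖uexp (truncLog c s (-(p.1 * p.2)) W) v - (-(p.1 * p.2)) • W v‖ ^ 2) ≤ B * ‖v‖ ^ 2 := by
  have hn := isStarNormal_of_mem_unitary hW
  have hsp := spectrum.subset_circle_of_unitary (𝕜 := ℂ) hW
  have hneg : ∀ p ∈ T, -(p.1 * p.2) ∈ Metric.sphere (0 : ℂ) 1 := fun p hp => by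
    simpa using hT p hp
  have h := sum_norm_cfc_apply_sq_le (W := W) T
    (fun p z => Complex.exp (Complex.I * truncArg c s (p.1 * p.2 * z)) - p.1 * p.2 * z)
    (fun p z => Complex.exp (Complex.I * truncArg c s (-(p.1 * p.2) * z)) - -(p.1 * p.2) * z)
    (fun p hp => (continuousOn_exp_truncArg_sub hc hs (hT p hp)).mono hsp)
    (fun p hp => (continuousOn_exp_truncArg_sub hc hs (hneg p hp)).mono hsp) hB0
    (fun z hz => hB z (hsp hz)) v
  refine le_trans (le_of_eq (Finset.sum_congr rfl fun p hp => ?_)) h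
  rw [← uexp_truncLog_sub hc hs (hT p hp) hW, ← uexp_truncLog_sub hc hs (hneg p hp) hW]
  rfl

/-- For a unitary `W` and a vector `v`, some rotation of `W` has both of its truncated logarithms
(for the rotation and for its negative) accurate at `v`. -/
lemma exists_rotation_truncLog {c s r : ℝ} (hc : c ≤ 1) (hs : 0 < s) {T : Finset (ℂ × ℂ)}
    (hT0 : T.Nonempty) (hT : ∀ p ∈ T, p.1 * p.2 ∈ Metric.sphere (0 : ℂ) 1) (hr : 0 ≤ r)
    (hB : ∀ z ∈ Metric.sphere (0 : ℂ) 1,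
      ∑ p ∈ T, (logError c s (p.1 * p.2 * z) + logError c s (-(p.1 * p.2) * z)) ≤ r ^ 2 * T.card)
    {W : K →L[ℂ] K} (hW : W ∈ unitary (K →L[ℂ] K)) {v : K} (hv : ‖v‖ = 1) :
    ∃ p ∈ T, ‖uexp (truncLog c s (p.1 * p.2) W) v - (p.1 * p.2) • W v‖ ≤ r ∧
      ‖uexp (truncLog c s (-(p.1 * p.2)) W) v - (-(p.1 * p.2)) • W v‖ ≤ r := by
  have h := sum_norm_uexp_truncLog_sub_sq_le hc hs T hT (by positivity) hB hW v
  rw [hv, one_pow, mul_one, mul_comm, ← nsmul_eq_mul, ← Finset.sum_const] at h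
  -- Some rotation does at least as well as the mean `r²`. As the two errors occur in one sum of
  -- squares, both are at most `r`.
  obtain ⟨p, hp, hle⟩ := Finset.exists_le_of_sum_le hT0 h
  refine ⟨p, hp, ?_, ?_⟩
  · exact pow_le_pow_iff_left₀ (norm_nonneg _) hr two_ne_zero |>.1
      (le_trans (le_add_of_nonneg_right (by positivity)) hle)
  · exact pow_le_pow_iff_left₀ (norm_nonneg _) hr two_ne_zero |>.1
      (le_trans (le_add_of_nonneg_left (by positivity)) hle)

end ApproximateLogarithm

/-! ### Positive functionals, pure states and cyclic vectors -/

open Filter Topology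

lemma re_apply_nonneg {B : Type*} [NonUnitalCStarAlgebra B] [PartialOrder B]
    (ω : B →ₚ[ℂ] ℂ) {b : B} (hb : 0 ≤ b) : 0 ≤ (ω b).re :=
  (Complex.nonneg_iff.1 (ω.map_nonneg hb)).1

section PositiveFunctionals
variable {B : Type*} [NonUnitalCStarAlgebra B] [PartialOrder B] [StarOrderedRing B]

@[simp] lemma toDual_apply (ω : B →ₚ[ℂ] ℂ) (b : B) : toDual ω b = ω b := rfl

lemma norm_apply_star_mul_le (ω : B →ₚ[ℂ] ℂ) (a b : B) :
    ‖ω (star a * b)‖ ^ 2 ≤ (ω (star a * a)).re * (ω (star b * b)).re := by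
  have h := norm_inner_le_norm (𝕜 := ℂ) (ω.toPreGNS a) (ω.toPreGNS b)
  have hn : ∀ c : B, ‖ω.toPreGNS c‖ ^ 2 = (ω (star c * c)).re := fun c => by
    have := ω.preGNS_norm_sq (ω.toPreGNS c)
    rw [PositiveLinearMap.ofPreGNS_toPreGNS] at this
    rw [← this, ← Complex.ofReal_pow, Complex.ofReal_re]
  rw [PositiveLinearMap.preGNS_inner_def] at h
  simp only [PositiveLinearMap.ofPreGNS_toPreGNS] at h
  calc _ ≤ (‖ω.toPreGNS a‖ * ‖ω.toPreGNS b‖) ^ 2 := by gcongr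
    _ = _ := by rw [mul_pow, hn, hn]

lemma star_mul_self_le_of_nonneg {e : B} (he : 0 ≤ e) (he1 : ‖e‖ ≤ 1) : star e * e ≤ e := by
  have hsa := (IsSelfAdjoint.of_nonneg he)
  rw [hsa.star_eq, ← sub_nonneg]
  have h1 : e - e * e = cfcₙ (fun t : ℝ => t - t * t) e := by
    rw [cfcₙ_sub _ _, cfcₙ_mul _ _]
    simp [cfcₙ_id' ℝ e]
  rw [h1]
  refine cfcₙ_nonneg fun t ht => ?_
  have h0 : 0 ≤ t := quasispectrum_nonneg_of_nonneg e he t ht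
  have h2 : ‖t‖ ≤ ‖e‖ := NonUnitalIsometricContinuousFunctionalCalculus.norm_quasispectrum_le e ht
  rw [Real.norm_eq_abs, abs_of_nonneg h0] at h2
  nlinarith

/-- Cauchy–Schwarz against the missing unit: it is applied to `ω(e b)` with `e` in the approximate
unit, and `ω(e* e) ≤ ‖ω‖`. -/
lemma norm_apply_sq_le (ω : B →ₚ[ℂ] ℂ) (b : B) :
    ‖ω b‖ ^ 2 ≤ ‖toDual ω‖ * (ω (star b * b)).re := by
  have hu := CStarAlgebra.increasingApproximateUnit B
  have ht : Tendsto (fun e => ‖ω (e * b)‖ ^ 2) (CStarAlgebra.approximateUnit B) (𝓝 (‖ω b‖ ^ 2)) :=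
    (((map_continuous ω).tendsto b).comp (hu.tendsto_mul_right b)).norm.pow 2
  refine le_of_tendsto ht ?_
  filter_upwards [hu.eventually_nonneg, hu.eventually_norm] with e he he1
  have h := norm_apply_star_mul_le ω e b
  have hs := (IsSelfAdjoint.of_nonneg he).star_eq
  have h2 : (ω (star e * e)).re ≤ ‖toDual ω‖ := by
    calc _ ≤ ‖ω (star e * e)‖ := Complex.re_le_norm _
      _ ≤ ‖toDual ω‖ * ‖star e * e‖ := (toDual ω).le_opNorm _
      _ ≤ ‖toDual ω‖ * 1 := by
        gcongr
        rw [CStarRing.norm_star_mul_self]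
        nlinarith [norm_nonneg e]
      _ = _ := mul_one _
  rw [hs] at h h2
  exact h.trans (mul_le_mul_of_nonneg_right h2 (re_apply_nonneg ω (star_mul_self_nonneg b)))

/-- A positive functional attains its norm along the approximate unit: for `b` in the unit ball
`|ω(e b)|² ≤ ω(e) ω(b* b) ≤ ω(e) ‖ω‖`, and the left side comes close to `‖ω‖²`. -/
lemma eventually_norm_toDual_sub_le (ω : B →ₚ[ℂ] ℂ) {ε : ℝ} (hε : 0 < ε) :
    ∀ᶠ e in CStarAlgebra.approximateUnit B, ‖toDual ω‖ - ε ≤ (ω e).re := by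
  have hu := CStarAlgebra.increasingApproximateUnit B
  rcases (norm_nonneg (toDual ω)).eq_or_lt with h0 | h0
  · filter_upwards [hu.eventually_nonneg] with e he
    have := re_apply_nonneg ω he
    linarith
  set N := ‖toDual ω‖
  obtain ⟨b, hb1, hb⟩ : ∃ b : B, ‖b‖ < 1 ∧ N - ε / 2 < ‖ω b‖ :=
    (toDual ω).exists_lt_apply_of_lt_opNorm (by linarith : N - ε / 2 < N)
  have ht : Tendsto (fun e => ‖ω (e * b)‖) (CStarAlgebra.approximateUnit B) (𝓝 ‖ω b‖) :=
    (((map_continuous ω).tendsto b).comp (hu.tendsto_mul_right b)).norm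
  filter_upwards [hu.eventually_nonneg, hu.eventually_norm, ht.eventually (lt_mem_nhds hb)]
    with e he he1 heb
  have h := norm_apply_star_mul_le ω e b
  rw [(IsSelfAdjoint.of_nonneg he).star_eq] at h
  have h1 : (ω (e * e)).re ≤ (ω e).re := by
    have := star_mul_self_le_of_nonneg he he1
    rw [(IsSelfAdjoint.of_nonneg he).star_eq] at this
    exact (Complex.le_def.1 (OrderHomClass.mono ω this)).1
  have h2 : (ω (star b * b)).re ≤ N := by
    calc _ ≤ ‖ω (star b * b)‖ := Complex.re_le_norm _
      _ ≤ N * ‖star b * b‖ := (toDual ω).le_opNorm _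
      _ ≤ N * 1 := by
        gcongr
        rw [CStarRing.norm_star_mul_self]
        nlinarith [norm_nonneg b]
      _ = _ := mul_one _
  have h3 : 0 ≤ (ω e).re := re_apply_nonneg ω he
  have h4 : ‖ω (e * b)‖ ^ 2 ≤ (ω e).re * N :=
    h.trans (mul_le_mul h1 h2 (re_apply_nonneg ω (star_mul_self_nonneg b)) h3)
  -- Otherwise `|ω(e b)|² ≤ (N - ε) N`, which is less than `(N - ε / 2)²`.
  by_contra! hlt
  have h5 : (ω e).re * N ≤ (N - ε) * N := by gcongr
  have h6 : 0 < N - ε := by linarith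
  nlinarith

/-- One element of the approximate unit nearly attains both norms at once. This makes the weights in
the convex decomposition of a pure state add up to one. -/
lemma norm_toDual_add (φ ψ : B →ₚ[ℂ] ℂ) : ‖toDual (φ + ψ)‖ = ‖toDual φ‖ + ‖toDual ψ‖ := by
  refine le_antisymm ?_ (le_of_forall_pos_le_add fun ε hε => ?_)
  · exact norm_add_le (toDual φ) (toDual ψ)
  have hu := CStarAlgebra.increasingApproximateUnit B
  obtain ⟨e, he1, h1, h2⟩ := (hu.eventually_norm.and
    ((eventually_norm_toDual_sub_le φ (half_pos hε)).and
      (eventually_norm_toDual_sub_le ψ (half_pos hε)))).exists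
  have h3 : (φ e + ψ e).re ≤ ‖toDual (φ + ψ)‖ := by
    calc _ ≤ ‖toDual (φ + ψ) e‖ := Complex.re_le_norm _
      _ ≤ _ := ContinuousLinearMap.unit_le_opNorm _ _ he1
  rw [Complex.add_re] at h3
  linarith

/-- A positive functional dominated by a pure state is a multiple of it. -/
lemma IsPureState.eq_smul_of_add {ω φ ψ : B →ₚ[ℂ] ℂ} (hω : IsPureState ω)
    (h : ∀ b, φ b + ψ b = ω b) : ∀ b, φ b = (‖toDual φ‖ : ℂ) * ω b := by
  have hsum : φ + ψ = ω := PositiveLinearMap.ext h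
  have hnorm := norm_toDual_add φ ψ
  have h1 : ‖toDual ω‖ = 1 := hω.1.2
  rw [hsum, h1] at hnorm
  rcases (norm_nonneg (toDual φ)).eq_or_lt with h0 | h0
  · intro b
    have : toDual φ = 0 := norm_eq_zero.1 h0.symm
    rw [← h0, ← toDual_apply, this]
    simp
  rcases (norm_nonneg (toDual ψ)).eq_or_lt with h0' | h0'
  · intro b
    have : toDual ψ = 0 := norm_eq_zero.1 h0'.symm
    have h2 : ψ b = 0 := by rw [← toDual_apply, this]; simp
    rw [← h b, h2, show ‖toDual φ‖ = 1 by linarith]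
    simp
  set s := ‖toDual φ‖
  set t := ‖toDual ψ‖
  have key : ∀ (χ : B →ₚ[ℂ] ℂ), 0 < ‖toDual χ‖ →
      (‖toDual χ‖⁻¹ : ℝ) • toDual χ ∈ stateSpace B := fun χ hχ => by
    refine ⟨fun b hb => ?_, ?_⟩
    · have := χ.map_nonneg hb
      change 0 ≤ (‖toDual χ‖⁻¹ : ℝ) • χ b
      rw [Complex.real_smul]
      exact mul_nonneg (by exact_mod_cast (inv_nonneg.2 hχ.le)) this
    · rw [norm_smul, norm_inv, norm_norm, inv_mul_cancel₀ hχ.ne']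
  have hseg : toDual ω ∈ openSegment ℝ (s⁻¹ • toDual φ) (t⁻¹ • toDual ψ) := by
    refine ⟨s, t, h0, h0', hnorm.symm, ?_⟩
    rw [smul_smul, smul_smul, mul_inv_cancel₀ h0.ne', mul_inv_cancel₀ h0'.ne', one_smul, one_smul,
      ← hsum]
    rfl
  have := hω.2 (key φ h0) (key ψ h0') hseg
  intro b
  rw [← toDual_apply ω, ← this]
  change φ b = (s : ℂ) * (s⁻¹ • φ b)
  rw [Complex.real_smul, ← mul_assoc, ← Complex.ofReal_mul, mul_inv_cancel₀ h0.ne']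
  simp

lemma exists_riesz_vector {E : Type*} [SeminormedAddCommGroup E] [InnerProductSpace ℂ E]
    (f : E →L[ℂ] ℂ) : ∃ ξ : UniformSpace.Completion E,
      (∀ x : E, ⟪ξ, (x : UniformSpace.Completion E)⟫_ℂ = f x) ∧ ‖ξ‖ ≤ ‖f‖ := by
  let e : E →L[ℂ] UniformSpace.Completion E := UniformSpace.Completion.toComplL
  let g := f.extend e
  have hg : ∀ x : E, g (x : UniformSpace.Completion E) = f x := fun x =>
    ContinuousLinearMap.extend_eq (e := e) f UniformSpace.Completion.denseRange_coe
      (UniformSpace.Completion.isUniformInducing_coe E) x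
  refine ⟨(InnerProductSpace.toDual ℂ _).symm g, fun x => ?_, ?_⟩
  · rw [InnerProductSpace.toDual_symm_apply, hg]
  · rw [LinearIsometryEquiv.norm_map]
    refine ContinuousLinearMap.opNorm_le_bound _ (norm_nonneg _) fun x => ?_
    induction x using UniformSpace.Completion.induction_on with
    | hp => apply isClosed_le <;> fun_prop
    | ih x => rw [hg, UniformSpace.Completion.norm_coe]; exact f.le_opNorm x

/-- The cyclic vector of the GNS representation. -/
lemma exists_gns_cyclic (ω : B →ₚ[ℂ] ℂ) : ∃ ξ : ω.GNS,
    (∀ a : B, ω.gnsNonUnitalStarAlgHom a ξ = (ω.toPreGNS a : ω.GNS)) ∧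
    (∀ b : B, ω b = ⟪ξ, ω.gnsNonUnitalStarAlgHom b ξ⟫_ℂ) ∧ ‖ξ‖ ^ 2 = ‖toDual ω‖ := by
  set M := ‖toDual ω‖ with hM
  -- Without a unit there is no class of `1`. The functional `b ↦ ω(b)` is bounded by `√‖ω‖` for the
  -- GNS seminorm, and its Riesz vector is the cyclic vector.
  let f₀ : ω.PreGNS →L[ℂ] ℂ := (ω.toLinearMap ∘ₗ ω.ofPreGNS.toLinearMap).mkContinuous (√M)
    fun x => by
      rw [← sq_le_sq₀ (by positivity) (by positivity), mul_pow, Real.sq_sqrt (norm_nonneg _)]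
      have h := norm_apply_sq_le ω (ω.ofPreGNS x)
      have h2 := ω.preGNS_norm_sq x
      rw [← h2, ← Complex.ofReal_pow, Complex.ofReal_re] at h
      exact h
  have hf₀ : ∀ x, f₀ x = ω (ω.ofPreGNS x) := fun x => rfl
  have hf₀n : ‖f₀‖ ≤ √M := LinearMap.mkContinuous_norm_le _ (by positivity) _
  obtain ⟨ξ, hξ, hξn⟩ := exists_riesz_vector f₀
  have h1 : ∀ a : B, ω.gnsNonUnitalStarAlgHom a ξ = (ω.toPreGNS a : ω.GNS) := fun a => by
    refine ext_inner_right ℂ fun v => ?_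
    induction v using UniformSpace.Completion.induction_on with
    | hp => apply isClosed_eq <;> fun_prop
    | ih x =>
      rw [← ContinuousLinearMap.adjoint_inner_right, ← ContinuousLinearMap.star_eq_adjoint,
        ← map_star, PositiveLinearMap.gnsNonUnitalStarAlgHom_apply_coe, hξ, hf₀,
        UniformSpace.Completion.inner_coe, PositiveLinearMap.preGNS_inner_def]
      simp
  have h2 : ∀ b : B, ω b = ⟪ξ, ω.gnsNonUnitalStarAlgHom b ξ⟫_ℂ := fun b => by
    rw [h1, hξ, hf₀]; simp
  refine ⟨ξ, h1, h2, le_antisymm ?_ ?_⟩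
  · have : ‖ξ‖ ≤ √M := hξn.trans hf₀n
    calc ‖ξ‖ ^ 2 ≤ (√M) ^ 2 := by gcongr
      _ = M := Real.sq_sqrt (norm_nonneg _)
  · refine ContinuousLinearMap.opNorm_le_bound _ (by positivity) fun b => ?_
    rw [toDual_apply, h2]
    calc _ ≤ ‖ξ‖ * ‖ω.gnsNonUnitalStarAlgHom b ξ‖ := norm_inner_le_norm _ _
      _ ≤ ‖ξ‖ * (‖b‖ * ‖ξ‖) := by
        gcongr
        exact (ContinuousLinearMap.le_opNorm _ _).trans (mul_le_mul_of_nonneg_right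
          (NonUnitalStarAlgHom.norm_apply_le _ b) (norm_nonneg _))
      _ = _ := by ring

end PositiveFunctionals

/-! ### Irreducible representations and approximate transitivity -/

section Irreducible
variable {B H : Type*} [NonUnitalCStarAlgebra B] [NormedAddCommGroup H] [InnerProductSpace ℂ H]
  [CompleteSpace H]

/-- A representation is irreducible if it is nondegenerate with trivial commutant. -/
def IsIrreducible (π : B →⋆ₙₐ[ℂ] (H →L[ℂ] H)) : Prop :=
  (∀ v, (∀ b, π b v = 0) → v = 0) ∧
    ∀ S : H →L[ℂ] H, (∀ b v, S (π b v) = π b (S v)) → ∃ t : ℂ, ∀ v, S v = t • v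

lemma inner_rep_left (π : B →⋆ₙₐ[ℂ] (H →L[ℂ] H)) (b : B) (v w : H) :
    ⟪π b v, w⟫_ℂ = ⟪v, π (star b) w⟫_ℂ := by
  rw [map_star, ContinuousLinearMap.star_eq_adjoint, ContinuousLinearMap.adjoint_inner_right]

lemma rep_mul_apply (π : B →⋆ₙₐ[ℂ] (H →L[ℂ] H)) (a b : B) (v : H) :
    π (a * b) v = π a (π b v) := by
  rw [map_mul]; rfl

lemma norm_rep_apply_le (π : B →⋆ₙₐ[ℂ] (H →L[ℂ] H)) (b : B) (v : H) :
    ‖π b v‖ ≤ ‖b‖ * ‖v‖ :=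
  (ContinuousLinearMap.le_opNorm _ _).trans (mul_le_mul_of_nonneg_right
    (NonUnitalStarAlgHom.norm_apply_le π b) (norm_nonneg _))

/-- A self-adjoint `S` in the commutant becomes a positive contraction as `(S + r) / (2r + 1)` with
`r = ‖S‖`; the extra `1` covers `S = 0`. A general element is split into real and imaginary parts.
-/
lemma isIrreducible_of_forall_pos {π : B →⋆ₙₐ[ℂ] (H →L[ℂ] H)}
    (hnd : ∀ v, (∀ b, π b v = 0) → v = 0)
    (hpos : ∀ P : H →L[ℂ] H, 0 ≤ P → P ≤ 1 → (∀ b v, P (π b v) = π b (P v)) →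
      ∃ t : ℂ, ∀ v, P v = t • v) : IsIrreducible π := by
  refine ⟨hnd, ?_⟩
  have hsa : ∀ S : H →L[ℂ] H, IsSelfAdjoint S → (∀ b v, S (π b v) = π b (S v)) →
      ∃ t : ℂ, ∀ v, S v = t • v := fun S hS hcomm => by
    set r : ℝ := ‖S‖
    have hr : 0 ≤ r := norm_nonneg _
    have hk : (0 : ℝ) < (2 * r + 1)⁻¹ := by positivity
    have h1 : -(r • (1 : H →L[ℂ] H)) ≤ S := by
      rw [← Algebra.algebraMap_eq_smul_one]; exact hS.neg_algebraMap_norm_le_self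
    have h2 : S ≤ r • (1 : H →L[ℂ] H) := by
      rw [← Algebra.algebraMap_eq_smul_one]; exact hS.le_algebraMap_norm_self
    have h3 : 0 ≤ S + r • (1 : H →L[ℂ] H) := by
      rw [← neg_le_iff_add_nonneg]; exact h1
    obtain ⟨t, ht⟩ := hpos ((2 * r + 1)⁻¹ • (S + r • (1 : H →L[ℂ] H)))
      (smul_nonneg hk.le h3) (by
        calc _ ≤ (2 * r + 1)⁻¹ • ((2 * r + 1) • (1 : H →L[ℂ] H)) := by
              refine smul_le_smul_of_nonneg_left ?_ hk.le
              calc _ ≤ r • (1 : H →L[ℂ] H) + r • (1 : H →L[ℂ] H) := by gcongr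
                _ = (2 * r) • (1 : H →L[ℂ] H) := by rw [← add_smul, two_mul]
                _ ≤ _ := smul_le_smul_of_nonneg_right (by linarith) zero_le_one
          _ = 1 := by rw [smul_smul, inv_mul_cancel₀ (by positivity), one_smul])
      fun b v => by
        change (2 * r + 1)⁻¹ • (S (π b v) + r • π b v) = π b ((2 * r + 1)⁻¹ • (S v + r • v))
        rw [hcomm, ← Complex.coe_smul, ← Complex.coe_smul, ← Complex.coe_smul, ← Complex.coe_smul,
          map_smul, map_add, map_smul]
    refine ⟨((2 * r + 1 : ℝ) : ℂ) * t - r, fun v => ?_⟩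
    have h4 := ht v
    change (2 * r + 1)⁻¹ • (S v + r • v) = t • v at h4
    have h5 : S v + r • v = (2 * r + 1) • t • v := by
      rw [← h4, smul_smul, mul_inv_cancel₀ (by positivity), one_smul]
    rw [eq_sub_of_add_eq h5, sub_smul, mul_smul, Complex.coe_smul, Complex.coe_smul]
  intro S hS
  have hS' : ∀ b v, (star S) (π b v) = π b (star S v) := fun b v => by
    refine ext_inner_left ℂ fun u => ?_
    rw [ContinuousLinearMap.star_eq_adjoint, ContinuousLinearMap.adjoint_inner_right,
      ← star_star b, ← inner_rep_left, ← inner_rep_left, ContinuousLinearMap.adjoint_inner_right,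
      hS]
  obtain ⟨t, ht⟩ := hsa (S + star S) (IsSelfAdjoint.add_star_self S) fun b v => by
    change S (π b v) + star S (π b v) = π b (S v + star S v)
    rw [hS, hS', map_add]
  obtain ⟨t', ht'⟩ := hsa (Complex.I • (S - star S)) (by
      rw [isSelfAdjoint_iff, star_smul, star_sub, star_star]
      simp [smul_sub, neg_add_eq_sub]) fun b v => by
    change Complex.I • (S (π b v) - star S (π b v)) = π b (Complex.I • (S v - star S v))
    rw [hS, hS', map_smul, map_sub]
  refine ⟨(t - Complex.I * t') / 2, fun v => ?_⟩
  have e1 : S v + star S v = t • v := ht v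
  have e2 : Complex.I • (S v - star S v) = t' • v := ht' v
  have e3 : S v - star S v = -(Complex.I * t') • v := by
    rw [neg_smul, mul_smul, ← e2, smul_smul, Complex.I_mul_I]; simp
  have e4 : (2 : ℂ) • S v = (t - Complex.I * t') • v := by
    rw [sub_smul, sub_eq_add_neg, ← neg_smul, ← e3, ← e1, two_smul]; abel
  rw [div_eq_inv_mul, mul_smul, ← e4, smul_smul]; simp

lemma exists_posLinearMap_of_comm [PartialOrder B] [StarOrderedRing B]
    {π : B →⋆ₙₐ[ℂ] (H →L[ℂ] H)} (ξ : H) {Q : H →L[ℂ] H} (hQ0 : 0 ≤ Q)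
    (hQ : ∀ b v, Q (π b v) = π b (Q v)) : ∃ φ : B →ₚ[ℂ] ℂ, ∀ b, φ b = ⟪ξ, Q (π b ξ)⟫_ℂ := by
  refine ⟨PositiveLinearMap.mk₀ ((innerSL ℂ ξ ∘L Q).toLinearMap ∘ₗ
    ((ContinuousLinearMap.apply ℂ H ξ).toLinearMap ∘ₗ
      (π : B →ₗ[ℂ] (H →L[ℂ] H)))) fun b hb => ?_, fun b => rfl⟩
  obtain ⟨c, rfl⟩ := CStarAlgebra.nonneg_iff_eq_star_mul_self.1 hb
  change 0 ≤ ⟪ξ, Q (π (star c * c) ξ)⟫_ℂ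
  rw [rep_mul_apply, hQ, ← inner_rep_left]
  exact ((ContinuousLinearMap.nonneg_iff_isPositive Q).1 hQ0).inner_nonneg_right _

lemma ext_of_denseRange {H : Type*} [NormedAddCommGroup H] [InnerProductSpace ℂ H]
    {f g : H →L[ℂ] H} {X : Type*} {e : X → H} (he : DenseRange e)
    (h : ∀ x, f (e x) = g (e x)) : f = g :=
  DFunLike.coe_injective (he.equalizer f.continuous g.continuous (funext h))

/-- A positive contraction `P` in the commutant splits `ω` into the functionals given by `P` and `1
- P`. Purity makes the first a multiple of `ω`, and density of the orbit of `ξ` then makes `P`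
scalar. -/
lemma IsPureState.isIrreducible_of_cyclic [PartialOrder B] [StarOrderedRing B] {ω : B →ₚ[ℂ] ℂ}
    (hω : IsPureState ω) {π : B →⋆ₙₐ[ℂ] (H →L[ℂ] H)} {ξ : H} (hξ : DenseRange fun b => π b ξ)
    (hωξ : ∀ b, ω b = ⟪ξ, π b ξ⟫_ℂ) : IsIrreducible π := by
  refine isIrreducible_of_forall_pos (fun v hv => ?_) fun P h0 h1 hP => ?_
  · refine hξ.eq_zero_of_inner_left ℂ fun b => ?_
    rw [← star_star b, ← inner_rep_left, hv, inner_zero_left]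
  · obtain ⟨φ, hφ⟩ := exists_posLinearMap_of_comm ξ h0 hP
    obtain ⟨ψ, hψ⟩ := exists_posLinearMap_of_comm (π := π) ξ (sub_nonneg.2 h1) fun b v => by
      change π b v - P (π b v) = π b (v - P v)
      rw [hP, map_sub]
    have h := hω.eq_smul_of_add (φ := φ) (ψ := ψ) fun b => by
      rw [hφ, hψ, hωξ]
      change ⟪ξ, P (π b ξ)⟫_ℂ + ⟪ξ, π b ξ - P (π b ξ)⟫_ℂ = _
      rw [inner_sub_right]; ring
    have : P = (‖toDual φ‖ : ℂ) • 1 := ext_of_denseRange hξ fun b => by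
      refine hξ.eq_of_inner_right ℂ fun a => ?_
      change ⟪π a ξ, P (π b ξ)⟫_ℂ = ⟪π a ξ, (‖toDual φ‖ : ℂ) • π b ξ⟫_ℂ
      rw [inner_smul_right, inner_rep_left, inner_rep_left, ← hP, ← rep_mul_apply, ← hφ, h, hωξ]
    exact ⟨_, fun v => by rw [this]; rfl⟩

lemma denseRange_gns {B : Type*} [NonUnitalCStarAlgebra B] [PartialOrder B] [StarOrderedRing B]
    (ω : B →ₚ[ℂ] ℂ) {ξ : ω.GNS}
    (h : ∀ a : B, ω.gnsNonUnitalStarAlgHom a ξ = (ω.toPreGNS a : ω.GNS)) :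
    DenseRange fun b => ω.gnsNonUnitalStarAlgHom b ξ := by
  simp_rw [h]
  exact UniformSpace.Completion.denseRange_coe.comp ω.toPreGNS.surjective.denseRange
    (UniformSpace.Completion.continuous_coe _)

/-- Approximate transitivity: elements of an irreducible representation approximate any operator
on finitely many vectors. -/
lemma IsIrreducible.exists_tendsto {π : B →⋆ₙₐ[ℂ] (H →L[ℂ] H)} (hπ : IsIrreducible π)
    {ι : Type*} [Fintype ι] (T : H →L[ℂ] H) (v : ι → H) :
    ∃ b : ℕ → B, ∀ i, Tendsto (fun k => π (b k) (v i)) atTop (𝓝 (T (v i))) := by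
  classical
  let E := PiLp 2 (fun _ : ι => H)
  let diag : (H →L[ℂ] H) → E →L[ℂ] E := fun S =>
    (PiLp.continuousLinearEquiv 2 ℂ (fun _ : ι => H)).symm.toContinuousLinearMap ∘L
      ContinuousLinearMap.pi fun i => S ∘L PiLp.proj 2 (fun _ : ι => H) i
  have hdiag : ∀ S (x : E) i, diag S x i = S (x i) := fun S x i => rfl
  let sgl : ι → H →L[ℂ] E := fun j =>
    (PiLp.continuousLinearEquiv 2 ℂ (fun _ : ι => H)).symm.toContinuousLinearMap ∘L
      ContinuousLinearMap.single ℂ (fun _ : ι => H) j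
  have hsum : ∀ x : E, ∑ j, sgl j (x j) = x := fun x => by
    have h0 : ∀ j, sgl j (x j) = WithLp.toLp 2 (Pi.single j (x j)) := fun j => rfl
    simp_rw [h0]
    rw [← WithLp.toLp_sum, Finset.univ_sum_single]
  let x₀ : E := WithLp.toLp 2 v
  let L : B →ₗ[ℂ] E := ((ContinuousLinearMap.apply ℂ E x₀).toLinearMap ∘ₗ
    { toFun := diag, map_add' := fun S T => rfl, map_smul' := fun c S => rfl }) ∘ₗ
    (π : B →ₗ[ℂ] (H →L[ℂ] H))
  have hL : ∀ b, L b = diag (π b) x₀ := fun b => rfl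
  -- Von Neumann's bicommutant argument: `W` is the closed orbit of `x₀ = (v i)` in the direct sum
  -- of copies of `H`. The projection onto it commutes with the amplified representation, so its
  -- matrix entries are scalars and it commutes with the amplification of every `T`.
  let W : Submodule ℂ E := (LinearMap.range L).topologicalClosure
  have hWc : IsClosed (W : Set E) := Submodule.isClosed_topologicalClosure _
  have : CompleteSpace W := hWc.completeSpace_coe
  have hLW : ∀ b, L b ∈ W := fun b => Submodule.le_topologicalClosure _ ⟨b, rfl⟩
  have hinv : ∀ b, ∀ x ∈ W, diag (π b) x ∈ W := fun b x hx => by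
    have : Set.MapsTo (diag (π b)) (LinearMap.range L : Set E) (LinearMap.range L : Set E) := by
      rintro _ ⟨c, rfl⟩
      refine ⟨b * c, ?_⟩
      rw [hL, hL]
      ext i
      rw [hdiag, hdiag, hdiag, rep_mul_apply]
    exact this.closure (diag (π b)).continuous hx
  let P : E →L[ℂ] E := W.starProjection
  have hPmem : ∀ x, P x ∈ W := fun x => W.starProjection_apply_mem x
  have hcommP : ∀ b x, P (diag (π b) x) = diag (π b) (P x) := fun b x => by
    change W.starProjection _ = _
    refine Submodule.eq_starProjection_of_mem_of_inner_eq_zero (hinv b _ (hPmem x))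
      fun w hw => ?_
    have hadj : ∀ y z : E, ⟪diag (π b) y, z⟫_ℂ = ⟪y, diag (π (star b)) z⟫_ℂ := fun y z => by
      rw [PiLp.inner_apply, PiLp.inner_apply]
      exact Finset.sum_congr rfl fun i _ => by rw [hdiag, hdiag, inner_rep_left]
    rw [← map_sub, hadj]
    exact W.starProjection_inner_eq_zero x _ (hinv _ w hw)
  have hent : ∀ i j, ∃ t : ℂ, ∀ u, (P (sgl j u)) i = t • u := fun i j => by
    refine hπ.2 (PiLp.proj 2 (fun _ : ι => H) i ∘L P ∘L sgl j) fun b u => ?_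
    change (P (sgl j (π b u))) i = π b ((P (sgl j u)) i)
    rw [← hdiag, ← hcommP]
    suffices h : sgl j (π b u) = diag (π b) (sgl j u) by rw [h]
    refine PiLp.ext fun k => ?_
    rw [hdiag]
    change Pi.single (M := fun _ => H) j (π b u) k = π b (Pi.single (M := fun _ => H) j u k)
    by_cases h : k = j
    · subst h; simp
    · simp [Pi.single_eq_of_ne h]
  choose t ht using hent
  have hPi : ∀ x i, (P x) i = ∑ j, t i j • x j := fun x i => by
    conv_lhs => rw [← hsum x, map_sum]
    rw [WithLp.ofLp_sum, Finset.sum_apply]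
    exact Finset.sum_congr rfl fun j _ => ht i j _
  have hPT : ∀ S x, P (diag S x) = diag S (P x) := fun S x => by
    ext i
    rw [hdiag, hPi, hPi, map_sum]
    exact Finset.sum_congr rfl fun j _ => by rw [hdiag, map_smul]
  -- As `B` may lack a unit, `x₀ ∈ W` comes from nondegeneracy: the amplified representation
  -- annihilates `P x₀ - x₀`.
  have hx₀ : P x₀ = x₀ := by
    rw [← sub_eq_zero]
    ext i
    refine hπ.1 _ fun b => ?_
    rw [← hdiag, map_sub, ← hcommP, ← hL,
      Submodule.starProjection_eq_self_iff.2 (hLW b), sub_self]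
    rfl
  have hmem : diag T x₀ ∈ W := by
    rw [← hx₀, ← hPT]; exact hPmem _
  obtain ⟨y, hy, hyt⟩ := mem_closure_iff_seq_limit.1 hmem
  choose b hb using hy
  refine ⟨b, fun i => ?_⟩
  have := ((PiLp.proj 2 (𝕜 := ℂ) (fun _ : ι => H) i).continuous.tendsto _).comp hyt
  refine this.congr fun k => ?_
  change (y k) i = _
  rw [← hb, hL, hdiag]

end Irreducible

/-! ### Kadison transitivity with self-adjoint elements and norm bounds -/

section Transitivity
variable {B H : Type*} [NonUnitalCStarAlgebra B] [NormedAddCommGroup H] [InnerProductSpace ℂ H]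
  [CompleteSpace H] {π : B →⋆ₙₐ[ℂ] (H →L[ℂ] H)}

lemma inner_rep_of_isSelfAdjoint {b : B} (hb : IsSelfAdjoint b) (v w : H) :
    ⟪π b v, w⟫_ℂ = ⟪v, π b w⟫_ℂ := by
  rw [inner_rep_left, hb.star_eq]

lemma inner_op_of_isSelfAdjoint {T : H →L[ℂ] H} (hT : IsSelfAdjoint T) (v w : H) :
    ⟪T v, w⟫_ℂ = ⟪v, T w⟫_ℂ := by
  rw [← ContinuousLinearMap.adjoint_inner_right, ← ContinuousLinearMap.star_eq_adjoint, hT.star_eq]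

/-- Taking real parts of arbitrary approximants is not enough, since adjoints converge only weakly
on the tested vectors. Hahn–Banach turns this weak information into norm approximation: a functional
`∑ ⟪w i, ·⟫` whose real part vanishes on the vectors `(b (v i))` with `b` self-adjoint also has zero
real part at `(R (v i))`. -/
lemma IsIrreducible.exists_selfAdjoint_tendsto (hπ : IsIrreducible π)
    {ι : Type*} [Fintype ι] {R : H →L[ℂ] H} (hR : IsSelfAdjoint R) (v : ι → H) :
    ∃ b : ℕ → B, (∀ k, IsSelfAdjoint (b k)) ∧
      ∀ i, Tendsto (fun k => π (b k) (v i)) atTop (𝓝 (R (v i))) := by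
  classical
  let E := ι → H
  let L : B →ₗ[ℂ] E := LinearMap.pi fun i =>
    (ContinuousLinearMap.apply ℂ H (v i)).toLinearMap ∘ₗ (π : B →ₗ[ℂ] (H →L[ℂ] H))
  have hL : ∀ b i, L b i = π b (v i) := fun b i => rfl
  let W : Submodule ℝ E :=
    ((selfAdjoint.submodule ℝ B).map (L.restrictScalars ℝ)).topologicalClosure
  have hWc : IsClosed (W : Set E) := Submodule.isClosed_topologicalClosure _
  have hLW : ∀ b, IsSelfAdjoint b → L b ∈ W := fun b hb =>
    Submodule.le_topologicalClosure _ ⟨b, hb, rfl⟩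
  suffices hmem : (fun i => R (v i)) ∈ W by
    obtain ⟨y, hy, hyt⟩ := mem_closure_iff_seq_limit.1 hmem
    choose b hb hbL using hy
    refine ⟨b, hb, fun i => ?_⟩
    refine (((continuous_apply i).tendsto _).comp hyt).congr fun k => ?_
    change y k i = _
    rw [← hbL]; rfl
  by_contra hx
  obtain ⟨f, u, hfW, hfx⟩ := RCLike.geometric_hahn_banach_closed_point (𝕜 := ℂ) W.convex hWc hx
  have hu : 0 < u := by simpa using hfW 0 W.zero_mem
  have hf0 : ∀ y ∈ W, RCLike.re (f y) = 0 := fun y hy => by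
    by_contra hne
    have h := hfW ((u / RCLike.re (f y)) • y) (W.smul_mem _ hy)
    rw [← Complex.coe_smul, map_smul, smul_eq_mul, RCLike.re_to_complex,
      Complex.re_ofReal_mul, ← RCLike.re_to_complex, div_mul_cancel₀ _ hne] at h
    exact lt_irrefl _ h
  let w : ι → H := fun i => (InnerProductSpace.toDual ℂ H).symm
    (f ∘L ContinuousLinearMap.single ℂ (fun _ : ι => H) i)
  have hw : ∀ x : E, f x = ∑ i, ⟪w i, x i⟫_ℂ := fun x => by
    have h0 : ∀ i, ⟪w i, x i⟫_ℂ = f (Pi.single i (x i)) := fun i =>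
      InnerProductSpace.toDual_symm_apply
    simp_rw [h0]
    rw [← map_sum, Finset.univ_sum_single]
  -- `R` is approximated on the `v i` and on the `w i` together, so that `⟪w, b* v⟫ = ⟪b w, v⟫` can
  -- be passed to the limit.
  obtain ⟨b, hb⟩ := hπ.exists_tendsto R (Sum.elim v w)
  have hb1 : ∀ i, Tendsto (fun k => π (b k) (v i)) atTop (𝓝 (R (v i))) := fun i => hb (Sum.inl i)
  have hb2 : ∀ i, Tendsto (fun k => π (b k) (w i)) atTop (𝓝 (R (w i))) := fun i => hb (Sum.inr i)
  have hz : ∀ k, RCLike.re (∑ i, (⟪w i, π (b k) (v i)⟫_ℂ + ⟪π (b k) (w i), v i⟫_ℂ)) = 0 :=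
    fun k => by
    rw [← hf0 _ (hLW _ (IsSelfAdjoint.add_star_self (b k))), hw]
    congr 1
    refine Finset.sum_congr rfl fun i _ => ?_
    rw [hL, map_add, inner_rep_left, ← inner_add_right]; rfl
  have hlim : Tendsto (fun k => RCLike.re (∑ i, (⟪w i, π (b k) (v i)⟫_ℂ + ⟪π (b k) (w i), v i⟫_ℂ)))
      atTop (𝓝 (RCLike.re (∑ i, (⟪w i, R (v i)⟫_ℂ + ⟪R (w i), v i⟫_ℂ)))) :=
    (RCLike.continuous_re.tendsto _).comp (tendsto_finsetSum _ fun i _ =>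
      (tendsto_const_nhds.inner (hb1 i)).add ((hb2 i).inner tendsto_const_nhds))
  simp_rw [hz] at hlim
  have h0 := tendsto_nhds_unique tendsto_const_nhds hlim
  simp_rw [inner_op_of_isSelfAdjoint hR, ← two_mul, ← Finset.mul_sum] at h0
  rw [← hw fun i => R (v i)] at h0
  have h1 : RCLike.re ((2 : ℂ) * f fun i => R (v i)) = 2 * RCLike.re (f fun i => R (v i)) := by
    rw [show (2 : ℂ) = ((2 : ℝ) : ℂ) by norm_num, RCLike.re_to_complex, Complex.re_ofReal_mul]; rfl
  rw [h1] at h0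
  linarith

/-- The map `t ↦ 2t/(1+t²)` turns approximations by a self-adjoint element into approximations by
a self-adjoint contraction. -/
noncomputable def contract (b : B) : B := cfcₙ (fun t : ℝ => 2 * t / (1 + t ^ 2)) b

lemma continuous_contract_fun : Continuous fun t : ℝ => 2 * t / (1 + t ^ 2) := by
  refine Continuous.div (by fun_prop) (by fun_prop) fun t => by positivity

lemma isSelfAdjoint_contract (b : B) : IsSelfAdjoint (contract b) := cfcₙ_predicate _ b

lemma norm_contract_le (b : B) : ‖contract b‖ ≤ 1 := by
  refine norm_cfcₙ_le fun t _ => ?_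
  rw [Real.norm_eq_abs, abs_div, abs_of_pos (show 0 < 1 + t ^ 2 by positivity),
    div_le_one (by positivity), abs_le]
  constructor <;> nlinarith [sq_nonneg (t - 1), sq_nonneg (t + 1)]

lemma contract_add {b : B} (hb : IsSelfAdjoint b) :
    contract b + b * (b * contract b) = (2 : ℂ) • b := by
  have hc := continuous_contract_fun
  have hc' : Continuous fun t : ℝ => t * (2 * t / (1 + t ^ 2)) := continuous_id.mul hc
  have hc'' : Continuous fun t : ℝ => t * (t * (2 * t / (1 + t ^ 2))) := continuous_id.mul hc'
  have h1 : b * (b * contract b) =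
      cfcₙ (fun t : ℝ => t * (t * (2 * t / (1 + t ^ 2)))) b := by
    rw [cfcₙ_mul (fun t : ℝ => t) (fun t : ℝ => t * (2 * t / (1 + t ^ 2))) b (by fun_prop) rfl
      hc'.continuousOn (by simp), cfcₙ_mul (fun t : ℝ => t) (fun t : ℝ => 2 * t / (1 + t ^ 2)) b
      (by fun_prop) rfl hc.continuousOn (by simp), cfcₙ_id' ℝ b]
    rfl
  rw [h1, contract, ← cfcₙ_add (a := b) (f := fun t : ℝ => 2 * t / (1 + t ^ 2))
    (g := fun t : ℝ => t * (t * (2 * t / (1 + t ^ 2)))) hc.continuousOn (by simp) hc''.continuousOn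
    (by simp)]
  have h2 : (fun t : ℝ => 2 * t / (1 + t ^ 2) + t * (t * (2 * t / (1 + t ^ 2)))) =
      fun t : ℝ => (2 : ℝ) • t := by
    funext t
    have : (1 + t ^ 2) ≠ 0 := by positivity
    rw [smul_eq_mul]
    field_simp
  rw [h2, cfcₙ_smul (2 : ℝ) (fun t : ℝ => t) b, cfcₙ_id' ℝ b, ← Complex.coe_smul]
  norm_num

/-- The error `u` satisfies `(1 + b²) u = (b v - w) + b (v - b w)`. Pairing with `u` gives `‖u‖² +
‖b u‖² ≤ ‖u‖ p + ‖b u‖ q`, where `p` and `q` are the two norms on the right of the claim. -/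
lemma norm_rep_contract_sub_le (π : B →⋆ₙₐ[ℂ] (H →L[ℂ] H)) {b : B} (hb : IsSelfAdjoint b)
    (v w : H) : ‖π (contract b) v - w‖ ≤ ‖π b v - w‖ + ‖π b w - v‖ := by
  set u := π (contract b) v - w with hu
  have h1 : u + π b (π b u) = (π b v - w) + π b (v - π b w) := by
    have h := congr_arg (fun x => π x v) (contract_add hb)
    simp only [map_add, map_smul] at h
    change π (contract b) v + π (b * (b * contract b)) v = (2 : ℂ) • π b v at h
    rw [rep_mul_apply, rep_mul_apply] at h
    rw [two_smul] at h
    rw [hu, map_sub, map_sub, map_sub]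
    calc _ = (π (contract b) v + π b (π b (π (contract b) v))) - w - π b (π b w) := by abel
      _ = _ := by rw [h]; abel
  set a := ‖u‖ with ha
  set c := ‖π b u‖ with hc
  set p := ‖π b v - w‖ with hp
  set q := ‖π b w - v‖ with hq
  have h2 : a ^ 2 + c ^ 2 ≤ a * p + c * q := by
    have h3 : ⟪u, u + π b (π b u)⟫_ℂ = ((a ^ 2 + c ^ 2 : ℝ) : ℂ) := by
      rw [inner_add_right, ← inner_rep_of_isSelfAdjoint hb, inner_self_eq_norm_sq_to_K,
        inner_self_eq_norm_sq_to_K]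
      push_cast; rfl
    have h4 : (a ^ 2 + c ^ 2 : ℝ) = ‖⟪u, u + π b (π b u)⟫_ℂ‖ := by
      rw [h3, Complex.norm_real, Real.norm_of_nonneg (by positivity)]
    rw [h4, h1, inner_add_right, ← inner_rep_of_isSelfAdjoint hb]
    refine (norm_add_le _ _).trans (add_le_add (norm_inner_le_norm _ _) ?_)
    refine (norm_inner_le_norm _ _).trans ?_
    rw [norm_sub_rev v]
  have ha0 : 0 ≤ a := norm_nonneg _
  have hp0 : 0 ≤ p := norm_nonneg _
  have hq0 : 0 ≤ q := norm_nonneg _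
  by_contra! hlt
  nlinarith [sq_nonneg (c - q / 2), mul_nonneg ha0 hq0]

/-- Bounded approximants in the manner of Kaplansky. Because `R` squares to the identity on the `v
i`, the function `2t / (1 + t²)`, which fixes `1` and `-1`, keeps the limit. -/
lemma IsIrreducible.exists_contraction_tendsto (hπ : IsIrreducible π)
    {ι : Type*} [Fintype ι] {R : H →L[ℂ] H} (hR : IsSelfAdjoint R) (v : ι → H)
    (hv : ∀ i, R (R (v i)) = v i) :
    ∃ b : ℕ → B, (∀ k, IsSelfAdjoint (b k)) ∧ (∀ k, ‖b k‖ ≤ 1) ∧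
      ∀ i, Tendsto (fun k => π (b k) (v i)) atTop (𝓝 (R (v i))) := by
  obtain ⟨b, hb, hbt⟩ := hπ.exists_selfAdjoint_tendsto hR (Sum.elim v fun i => R (v i))
  refine ⟨fun k => contract (b k), fun k => isSelfAdjoint_contract _,
    fun k => norm_contract_le _, fun i => ?_⟩
  have h1 : Tendsto (fun k => π (b k) (v i)) atTop (𝓝 (R (v i))) := hbt (Sum.inl i)
  have h2 : Tendsto (fun k => π (b k) (R (v i))) atTop (𝓝 (v i)) := by
    simpa [hv] using hbt (Sum.inr i)
  rw [tendsto_iff_norm_sub_tendsto_zero] at h1 h2 ⊢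
  refine squeeze_zero (fun _ => norm_nonneg _)
    (fun k => norm_rep_contract_sub_le π (hb k) (v i) (R (v i))) ?_
  simpa using h1.add h2

lemma exists_rankOne {H : Type*} [NormedAddCommGroup H] [InnerProductSpace ℂ H] (x y : H) :
    ∃ T : H →L[ℂ] H, (∀ z, T z = ⟪y, z⟫_ℂ • x) :=
  ⟨(innerSL ℂ y).smulRight x, fun _ => rfl⟩

lemma isSelfAdjoint_of_inner {T : H →L[ℂ] H} (h : ∀ x y, ⟪T x, y⟫_ℂ = ⟪x, T y⟫_ℂ) :
    IsSelfAdjoint T :=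
  ContinuousLinearMap.isSelfAdjoint_iff_isSymmetric.2 h

/-- Two vectors giving nearly the same vector functional are nearly proportional. -/
lemma IsIrreducible.exists_phase (hπ : IsIrreducible π) {x y : H} (hx : ‖x‖ = 1) (hy : ‖y‖ = 1)
    {r : ℝ} (h : ∀ b : B, IsSelfAdjoint b → ‖b‖ ≤ 1 → ‖⟪x, π b x⟫_ℂ - ⟪y, π b y⟫_ℂ‖ ≤ r) :
    ∃ l : ℂ, ‖l‖ = 1 ∧ ‖l • x - y‖ ≤ r := by
  obtain ⟨l, hl, a, ha0, hla⟩ : ∃ l : ℂ, ‖l‖ = 1 ∧ ∃ a : ℝ, 0 ≤ a ∧ ⟪l • x, y⟫_ℂ = a := by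
    by_cases h0 : ⟪x, y⟫_ℂ = 0
    · exact ⟨1, by simp, 0, le_rfl, by simp [h0]⟩
    · have hn : (‖⟪x, y⟫_ℂ‖ : ℂ) ≠ 0 := by simpa using h0
      refine ⟨⟪x, y⟫_ℂ / ‖⟪x, y⟫_ℂ‖, ?_, ‖⟪x, y⟫_ℂ‖, norm_nonneg _, ?_⟩
      · rw [norm_div, Complex.norm_real, norm_norm, div_self (by simpa using h0)]
      · rw [inner_smul_left, map_div₀, Complex.conj_ofReal, div_mul_eq_mul_div, mul_comm,
          Complex.mul_conj, Complex.normSq_eq_norm_sq]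
        field_simp
        push_cast; ring
  refine ⟨l, hl, ?_⟩
  obtain ⟨x', hx'⟩ : ∃ z, z = l • x := ⟨_, rfl⟩
  rw [← hx'] at hla ⊢
  have hx1 : ‖x'‖ = 1 := by rw [hx', norm_smul, hl, hx, one_mul]
  have hstate : ∀ T : H →L[ℂ] H, ⟪x', T x'⟫_ℂ = ⟪x, T x⟫_ℂ := fun T => by
    rw [hx', map_smul, inner_smul_left, inner_smul_right, ← mul_assoc, mul_comm _ l,
      Complex.mul_conj, Complex.normSq_eq_norm_sq, hl]
    simp
  have hr : 0 ≤ r := (norm_nonneg _).trans (h 0 (IsSelfAdjoint.zero _) (by simp))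
  have hxx : ⟪x', x'⟫_ℂ = 1 := by rw [inner_self_eq_norm_sq_to_K, hx1]; simp
  have hyy : ⟪y, y⟫_ℂ = 1 := by rw [inner_self_eq_norm_sq_to_K, hy]; simp
  have hyx : ⟪y, x'⟫_ℂ = a := by rw [← inner_conj_symm, hla, Complex.conj_ofReal]
  have hnorm : ‖x' - y‖ ^ 2 = 2 - 2 * a := by
    rw [@norm_sub_sq ℂ, hx1, hy, hla]
    simp; ring
  have ha1 : a ≤ 1 := by nlinarith [sq_nonneg ‖x' - y‖]
  rcases ha1.eq_or_lt with rfl | ha1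
  · have : ‖x' - y‖ = 0 := by
      rw [← sq_eq_zero_iff, hnorm]; ring
    rw [this]; exact hr
  -- On the plane of `x'` and `y` the difference of the two rank one projections has square `1 - a²
  -- = β²`. Hence `R`, its quotient by `β`, is a symmetry there and separates the two vector
  -- functionals by `2β`. Finally `‖x' - y‖² = 2 - 2a ≤ (2β)²`.
  set β := √(1 - a ^ 2) with hβ
  have hβ0 : 0 < β := Real.sqrt_pos.2 (by nlinarith)
  have hβ2 : β ^ 2 = 1 - a ^ 2 := Real.sq_sqrt (by nlinarith)
  have hβC : (β : ℂ) ^ 2 = 1 - (a : ℂ) ^ 2 := by rw [← Complex.ofReal_pow, hβ2]; simp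
  have hβne : (β : ℂ) ≠ 0 := by exact_mod_cast hβ0.ne'
  obtain ⟨Px, hPx⟩ := exists_rankOne x' x'
  obtain ⟨Py, hPy⟩ := exists_rankOne y y
  have hR : ∀ z, ((β : ℂ)⁻¹ • (Px - Py)) z = (β : ℂ)⁻¹ • (⟪x', z⟫_ℂ • x' - ⟪y, z⟫_ℂ • y) :=
    fun z => by rw [← hPx, ← hPy]; rfl
  set R := (β : ℂ)⁻¹ • (Px - Py)
  have hRsa : IsSelfAdjoint R := isSelfAdjoint_of_inner fun z z' => by
    rw [hR, hR]
    simp only [inner_smul_left, inner_smul_right, inner_sub_left, inner_sub_right, map_inv₀,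
      Complex.conj_ofReal, inner_conj_symm]
    ring
  have hRx : R x' = (β : ℂ)⁻¹ • (x' - (a : ℂ) • y) := by rw [hR, hxx, hyx, one_smul]
  have hRy : R y = (β : ℂ)⁻¹ • ((a : ℂ) • x' - y) := by rw [hR, hla, hyy, one_smul]
  have hβi : (β : ℂ)⁻¹ * (β : ℂ)⁻¹ * (1 - (a : ℂ) ^ 2) = 1 := by
    rw [← hβC, pow_two]
    field_simp
  have hRRx : R (R x') = x' := by
    rw [hRx, map_smul, map_sub, map_smul, hRx, hRy]
    match_scalars
    · linear_combination hβi
    · ring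
  have hRRy : R (R y) = y := by
    rw [hRy, map_smul, map_sub, map_smul, hRx, hRy]
    match_scalars
    · ring
    · linear_combination hβi
  obtain ⟨b, hb, hb1, hbt⟩ := hπ.exists_contraction_tendsto hRsa ![x', y] (by
    intro i; fin_cases i
    · exact hRRx
    · exact hRRy)
  have hl1 : Tendsto (fun k => ‖⟪x', π (b k) x'⟫_ℂ - ⟪y, π (b k) y⟫_ℂ‖) atTop
      (𝓝 ‖⟪x', R x'⟫_ℂ - ⟪y, R y⟫_ℂ‖) :=
    ((tendsto_const_nhds.inner (hbt 0)).sub (tendsto_const_nhds.inner (hbt 1))).norm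
  have h2 : ‖⟪x', R x'⟫_ℂ - ⟪y, R y⟫_ℂ‖ ≤ r := le_of_tendsto hl1 (Eventually.of_forall fun k => by
    rw [hstate]; exact h (b k) (hb k) (hb1 k))
  have h3 : ⟪x', R x'⟫_ℂ - ⟪y, R y⟫_ℂ = ((2 * β : ℝ) : ℂ) := by
    rw [hRx, hRy, inner_smul_right, inner_smul_right, inner_sub_right, inner_sub_right,
      inner_smul_right, inner_smul_right, hxx, hyy, hla, hyx]
    have : (β : ℂ)⁻¹ * (1 - a * a) - (β : ℂ)⁻¹ * (a * a - 1) = (β : ℂ)⁻¹ * (2 * (1 - a ^ 2)) := by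
      ring
    rw [this, ← hβC]
    push_cast
    field_simp
  rw [h3, Complex.norm_real, Real.norm_of_nonneg (by positivity)] at h2
  refine le_of_sq_le_sq ?_ hr
  rw [hnorm]
  nlinarith

lemma IsIrreducible.exists_approx_fix (hπ : IsIrreducible π) {m : H} (hm : m ≠ 0) :
    ∃ b : B, IsSelfAdjoint b ∧ ‖b‖ ≤ 1 ∧ ‖π b m - m‖ ≤ ‖m‖ / 4 := by
  have hm0 : 0 < ‖m‖ := norm_pos_iff.2 hm
  have hmC : (‖m‖ : ℂ) ≠ 0 := by exact_mod_cast hm0.ne'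
  have hmm : ⟪m, m⟫_ℂ = (‖m‖ : ℂ) ^ 2 := by rw [inner_self_eq_norm_sq_to_K]; rfl
  obtain ⟨P, hP⟩ := exists_rankOne m m
  have hR : ∀ z, (((‖m‖ : ℂ) ^ 2)⁻¹ • P) z = ((‖m‖ : ℂ) ^ 2)⁻¹ • ⟪m, z⟫_ℂ • m :=
    fun z => by rw [← hP]; rfl
  have hRm : (((‖m‖ : ℂ) ^ 2)⁻¹ • P) m = m := by
    rw [hR, hmm, smul_smul, inv_mul_cancel₀ (pow_ne_zero _ hmC), one_smul]
  obtain ⟨b, hb, hb1, hbt⟩ := hπ.exists_contraction_tendsto (R := ((‖m‖ : ℂ) ^ 2)⁻¹ • P)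
    (isSelfAdjoint_of_inner fun z z' => by
      rw [hR, hR]
      simp only [inner_smul_left, inner_smul_right, map_inv₀, map_pow, Complex.conj_ofReal,
        inner_conj_symm]
      ring) (fun _ : Unit => m) fun _ => by rw [hRm, hRm]
  have ht := hbt ()
  rw [hRm, tendsto_iff_norm_sub_tendsto_zero] at ht
  obtain ⟨k, hk⟩ := (ht.eventually (ge_mem_nhds (show 0 < ‖m‖ / 4 by positivity))).exists
  exact ⟨b k, hb k, hb1 k, hk⟩

/-- The operator exchanging the directions of the orthogonal vectors `m` and `q` is self-adjoint and
squares to one on `m`, so contractions in `B` approximate it. -/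
lemma IsIrreducible.exists_approx_swap (hπ : IsIrreducible π) {m : H} (hm : m ≠ 0) {q : H}
    (hqm : ⟪q, m⟫_ℂ = 0) : ∃ b : B, IsSelfAdjoint b ∧ ‖b‖ ≤ 1 ∧
      ‖((‖q‖ / ‖m‖ : ℝ) : ℂ) • π b m - q‖ ≤ ‖q‖ / 4 := by
  have hm0 : 0 < ‖m‖ := norm_pos_iff.2 hm
  have hmC : (‖m‖ : ℂ) ≠ 0 := by exact_mod_cast hm0.ne'
  have hmm : ⟪m, m⟫_ℂ = (‖m‖ : ℂ) ^ 2 := by rw [inner_self_eq_norm_sq_to_K]; rfl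
  have hmq : ⟪m, q⟫_ℂ = 0 := by rw [← inner_conj_symm, hqm, map_zero]
  by_cases hq0 : q = 0
  · exact ⟨0, IsSelfAdjoint.zero _, by simp, by simp [hq0]⟩
  have hqn : 0 < ‖q‖ := norm_pos_iff.2 hq0
  have hqC : (‖q‖ : ℂ) ≠ 0 := by exact_mod_cast hqn.ne'
  have hqq : ⟪q, q⟫_ℂ = (‖q‖ : ℂ) ^ 2 := by rw [inner_self_eq_norm_sq_to_K]; rfl
  obtain ⟨P, hP⟩ := exists_rankOne q m
  obtain ⟨Q, hQ⟩ := exists_rankOne m q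
  set κ : ℂ := ((‖m‖ : ℂ) * (‖q‖ : ℂ))⁻¹ with hκ
  have hR : ∀ z, (κ • (P + Q)) z = κ • (⟪m, z⟫_ℂ • q + ⟪q, z⟫_ℂ • m) :=
    fun z => by rw [← hP, ← hQ]; rfl
  have hκc : (starRingEnd ℂ) κ = κ := by simp [hκ]
  have hRm : (κ • (P + Q)) m = ((‖m‖ : ℂ) / ‖q‖) • q := by
    rw [hR, hmm, hqm, zero_smul, add_zero, smul_smul, hκ]
    congr 1; field_simp
  have hRq : (κ • (P + Q)) q = ((‖q‖ : ℂ) / ‖m‖) • m := by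
    rw [hR, hqq, hmq, zero_smul, zero_add, smul_smul, hκ]
    congr 1; field_simp
  obtain ⟨b, hb, hb1, hbt⟩ := hπ.exists_contraction_tendsto (R := κ • (P + Q))
    (isSelfAdjoint_of_inner fun z z' => by
      rw [hR, hR]
      simp only [inner_smul_left, inner_smul_right, inner_add_left, inner_add_right, hκc,
        inner_conj_symm]
      ring) (fun _ : Unit => m) fun _ => by
        rw [hRm, map_smul, hRq, smul_smul]
        have : (‖m‖ : ℂ) / ‖q‖ * (‖q‖ / ‖m‖) = 1 := by field_simp
        rw [this, one_smul]
  have ht := ((hbt ()).const_smul ((‖q‖ / ‖m‖ : ℝ) : ℂ))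
  rw [hRm, smul_smul] at ht
  have h1 : ((‖q‖ / ‖m‖ : ℝ) : ℂ) * (‖m‖ / ‖q‖) = 1 := by push_cast; field_simp
  rw [h1, one_smul, tendsto_iff_norm_sub_tendsto_zero] at ht
  obtain ⟨k, hk⟩ := (ht.eventually (ge_mem_nhds (show 0 < ‖q‖ / 4 by positivity))).exists
  exact ⟨b k, hb k, hb1 k, hk⟩

/-- Decompose `p = a m + q` with `q` orthogonal to `m`. The hypothesis makes `a` real, as it must be
for self-adjoint `b`. An approximate identity at `m` treats the first part, an approximate swap the
second, each with relative error one quarter. -/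
lemma IsIrreducible.exists_approx_preimage (hπ : IsIrreducible π) {m : H} (hm : m ≠ 0) {p : H}
    (hp : (⟪m, p⟫_ℂ).im = 0) : ∃ b : B, IsSelfAdjoint b ∧ ‖b‖ ≤ 2 * (‖p‖ / ‖m‖) ∧
      ‖p - π b m‖ ≤ 2⁻¹ * ‖p‖ := by
  have hm0 : 0 < ‖m‖ := norm_pos_iff.2 hm
  have hmC : (‖m‖ : ℂ) ≠ 0 := by exact_mod_cast hm0.ne'
  have hmm : ⟪m, m⟫_ℂ = (‖m‖ : ℂ) ^ 2 := by rw [inner_self_eq_norm_sq_to_K]; rfl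
  obtain ⟨a, ha⟩ : ∃ a : ℝ, a = (⟪m, p⟫_ℂ).re / ‖m‖ ^ 2 := ⟨_, rfl⟩
  have hmp : ⟪m, p⟫_ℂ = (a : ℂ) * (‖m‖ : ℂ) ^ 2 := by
    rw [ha]; push_cast
    rw [div_mul_cancel₀ _ (pow_ne_zero _ hmC)]
    exact Complex.ext (by simp) (by simpa using hp)
  obtain ⟨q, hq⟩ : ∃ q, q = p - (a : ℂ) • m := ⟨_, rfl⟩
  have hmq : ⟪m, q⟫_ℂ = 0 := by
    rw [hq, inner_sub_right, inner_smul_right, hmm, hmp, sub_self]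
  have hqm : ⟪q, m⟫_ℂ = 0 := by rw [← inner_conj_symm, hmq, map_zero]
  have hpq : p = (a : ℂ) • m + q := by rw [hq]; abel
  have hnorm : ‖p‖ ^ 2 = (|a| * ‖m‖) ^ 2 + ‖q‖ ^ 2 := by
    conv_lhs => rw [hpq]
    rw [@norm_add_sq ℂ, inner_smul_left, hmq, norm_smul, Complex.norm_real, Real.norm_eq_abs]
    simp
  have hap : |a| * ‖m‖ ≤ ‖p‖ :=
    le_of_sq_le_sq (by rw [hnorm]; exact le_add_of_nonneg_right (sq_nonneg _)) (norm_nonneg _)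
  have hqp : ‖q‖ ≤ ‖p‖ :=
    le_of_sq_le_sq (by rw [hnorm]; exact le_add_of_nonneg_left (sq_nonneg _)) (norm_nonneg _)
  obtain ⟨b₁, hb₁, hn₁, he₁⟩ := hπ.exists_approx_fix hm
  obtain ⟨b₂, hb₂, hn₂, he₂⟩ := hπ.exists_approx_swap hm hqm
  refine ⟨a • b₁ + (‖q‖ / ‖m‖) • b₂, ((IsSelfAdjoint.all a).smul hb₁).add ((IsSelfAdjoint.all _).smul hb₂), ?_, ?_⟩
  · refine (norm_add_le _ _).trans ?_
    rw [norm_smul, norm_smul, Real.norm_eq_abs, Real.norm_of_nonneg (by positivity)]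
    have h1 : |a| ≤ ‖p‖ / ‖m‖ := by rwa [le_div_iff₀ hm0]
    have h2 : ‖q‖ / ‖m‖ ≤ ‖p‖ / ‖m‖ := by gcongr
    have h3 : |a| * ‖b₁‖ ≤ |a| * 1 := by gcongr
    have h4 : ‖q‖ / ‖m‖ * ‖b₂‖ ≤ ‖q‖ / ‖m‖ * 1 := by gcongr
    linarith
  · rw [← Complex.coe_smul, ← Complex.coe_smul, map_add, map_smul, map_smul]
    change ‖p - ((a : ℂ) • π b₁ m + ((‖q‖ / ‖m‖ : ℝ) : ℂ) • π b₂ m)‖ ≤ _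
    have : p - ((a : ℂ) • π b₁ m + ((‖q‖ / ‖m‖ : ℝ) : ℂ) • π b₂ m) =
        -((a : ℂ) • (π b₁ m - m) + (((‖q‖ / ‖m‖ : ℝ) : ℂ) • π b₂ m - q)) := by
      conv_lhs => rw [hpq]
      rw [smul_sub]; abel
    rw [this, norm_neg]
    refine (norm_add_le _ _).trans ?_
    rw [norm_smul, Complex.norm_real, Real.norm_eq_abs]
    have h3 : |a| * ‖π b₁ m - m‖ ≤ |a| * (‖m‖ / 4) := by gcongr
    linarith

/-- Kadison transitivity for one vector, with a norm bound and a self-adjoint element. -/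
lemma IsIrreducible.exists_preimage (hπ : IsIrreducible π) {m : H} (hm : m ≠ 0) {p : H}
    (hp : (⟪m, p⟫_ℂ).im = 0) : ∃ b : B, IsSelfAdjoint b ∧ ‖b‖ ≤ 4 * (‖p‖ / ‖m‖) ∧ π b m = p := by
  have step := fun p : {p : H // (⟪m, p⟫_ℂ).im = 0} => hπ.exists_approx_preimage hm p.2
  choose g hg hgn hge using step
  have hnext : ∀ p : {p : H // (⟪m, p⟫_ℂ).im = 0}, (⟪m, p.1 - π (g p) m⟫_ℂ).im = 0 := fun p => by
    -- The remainder again has a real inner product with `m`, so the halving step can be iterated;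
    -- the geometric series gives the constant `4`.
    have : (⟪m, π (g p) m⟫_ℂ).im = 0 := by
      rw [← Complex.conj_eq_iff_im, inner_conj_symm, inner_rep_of_isSelfAdjoint (hg p)]
    rw [inner_sub_right, Complex.sub_im, p.2, this, sub_zero]
  let s : ℕ → {p : H // (⟪m, p⟫_ℂ).im = 0} :=
    fun n => Nat.rec ⟨p, hp⟩ (fun _ p => ⟨p.1 - π (g p) m, hnext p⟩) n
  have hs0 : (s 0).1 = p := rfl
  have hs : ∀ n, (s (n + 1)).1 = (s n).1 - π (g (s n)) m := fun n => rfl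
  have hsn : ∀ n, ‖(s n).1‖ ≤ 2⁻¹ ^ n * ‖p‖ := fun n => by
    induction n with
    | zero => simp [hs0]
    | succ n ih =>
      rw [hs, pow_succ', mul_assoc]
      exact (hge _).trans (by gcongr)
  have hgs : ∀ n, ‖g (s n)‖ ≤ 2 * (‖p‖ / ‖m‖) * 2⁻¹ ^ n := fun n => by
    refine (hgn _).trans ?_
    rw [mul_assoc, div_mul_eq_mul_div, mul_comm ‖p‖]
    gcongr
    exact hsn n
  have hgeo : HasSum (fun n : ℕ => 2 * (‖p‖ / ‖m‖) * (2⁻¹ : ℝ) ^ n) (4 * (‖p‖ / ‖m‖)) := by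
    have := (hasSum_geometric_of_lt_one (r := (2⁻¹ : ℝ)) (by norm_num) (by norm_num)).mul_left
      (2 * (‖p‖ / ‖m‖))
    rwa [show (1 - (2⁻¹ : ℝ))⁻¹ = 2 by norm_num,
      show 2 * (‖p‖ / ‖m‖) * 2 = 4 * (‖p‖ / ‖m‖) by ring] at this
  have hsum : Summable fun n => g (s n) := Summable.of_norm_bounded hgeo.summable hgs
  refine ⟨∑' n, g (s n), ?_, tsum_of_norm_bounded hgeo hgs, ?_⟩
  · rw [isSelfAdjoint_iff, tsum_star]
    exact tsum_congr fun n => hg _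
  have htel : ∀ n, π (∑ k ∈ Finset.range n, g (s k)) m = p - (s n).1 := fun n => by
    induction n with
    | zero => simp [hs0]
    | succ n ih =>
      rw [Finset.sum_range_succ, map_add, hs]
      change π _ m + π _ m = _
      rw [ih]; abel
  have h1 : Tendsto (fun n => π (∑ k ∈ Finset.range n, g (s k)) m) atTop
      (𝓝 (π (∑' n, g (s n)) m)) := by
    have := hsum.hasSum.tendsto_sum_nat
    rw [tendsto_iff_norm_sub_tendsto_zero] at this ⊢
    refine squeeze_zero (fun _ => norm_nonneg _) (fun n => ?_) (by simpa using this.mul_const ‖m‖)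
    calc _ = ‖π ((∑ k ∈ Finset.range n, g (s k)) - ∑' n, g (s n)) m‖ := by rw [map_sub]; rfl
      _ ≤ _ := norm_rep_apply_le _ _ _
  have h2 : Tendsto (fun n => p - (s n).1) atTop (𝓝 (p - 0)) := by
    refine tendsto_const_nhds.sub (squeeze_zero_norm hsn ?_)
    simpa using (tendsto_pow_atTop_nhds_zero_of_lt_one (r := (2⁻¹ : ℝ)) (by norm_num)
      (by norm_num)).mul_const ‖p‖
  simp_rw [htel] at h1
  rw [tendsto_nhds_unique h1 h2, sub_zero]

end Transitivity

/-! ### Direct sums of representations -/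

section DirectSum
variable {B : Type*} [NonUnitalCStarAlgebra B] {ι : Type*} {H : ι → Type*}
  [∀ i, NormedAddCommGroup (H i)] [∀ i, InnerProductSpace ℂ (H i)] [∀ i, CompleteSpace (H i)]
  (π : ∀ i, B →⋆ₙₐ[ℂ] (H i →L[ℂ] H i))

lemma sum_norm_rep_rpow_le (b : B) (f : lp H 2) (s : Finset ι) :
    ∑ i ∈ s, ‖π i b (f i)‖ ^ (2 : ENNReal).toReal ≤ (‖b‖ * ‖f‖) ^ (2 : ENNReal).toReal := by
  calc _ ≤ ∑ i ∈ s, ‖b‖ ^ (2 : ENNReal).toReal * ‖f i‖ ^ (2 : ENNReal).toReal := by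
        refine Finset.sum_le_sum fun i _ => ?_
        rw [← Real.mul_rpow (norm_nonneg _) (norm_nonneg _)]
        exact Real.rpow_le_rpow (norm_nonneg _) (norm_rep_apply_le (π i) b (f i)) (by norm_num)
    _ = ‖b‖ ^ (2 : ENNReal).toReal * ∑ i ∈ s, ‖f i‖ ^ (2 : ENNReal).toReal := by
        rw [Finset.mul_sum]
    _ ≤ ‖b‖ ^ (2 : ENNReal).toReal * ‖f‖ ^ (2 : ENNReal).toReal := by
        gcongr
        exact lp.sum_rpow_le_norm_rpow (by norm_num) f s
    _ = _ := (Real.mul_rpow (norm_nonneg _) (norm_nonneg _)).symm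

/-- The action of an element on a direct sum of representations. -/
noncomputable def directSumOp (b : B) : lp H 2 →L[ℂ] lp H 2 :=
  LinearMap.mkContinuous
    { toFun := fun f => ⟨fun i => π i b (f i), memℓp_gen' (sum_norm_rep_rpow_le π b f)⟩
      map_add' := fun f g => lp.ext (funext fun i => by simp; rfl)
      map_smul' := fun c f => lp.ext (funext fun i => by simp) } ‖b‖
    fun f => lp.norm_le_of_forall_sum_le (by norm_num) (by positivity) (sum_norm_rep_rpow_le π b f)

lemma directSumOp_apply (b : B) (f : lp H 2) (i : ι) : directSumOp π b f i = π i b (f i) := rfl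

/-- The direct sum of a family of representations. -/
noncomputable def directSumRep : B →⋆ₙₐ[ℂ] (lp H 2 →L[ℂ] lp H 2) where
  toFun := directSumOp π
  map_smul' c b := by
    ext f i; rw [directSumOp_apply, map_smul]; rfl
  map_zero' := by
    ext f i; rw [directSumOp_apply, map_zero]; rfl
  map_add' a b := by
    ext f i; rw [directSumOp_apply, map_add]; rfl
  map_mul' a b := by
    ext f i; rw [directSumOp_apply, map_mul]; rfl
  map_star' b := by
    rw [ContinuousLinearMap.star_eq_adjoint, ContinuousLinearMap.eq_adjoint_iff]
    intro f g
    rw [lp.inner_eq_tsum, lp.inner_eq_tsum]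
    refine tsum_congr fun i => ?_
    rw [directSumOp_apply, directSumOp_apply, inner_rep_left, star_star]

lemma directSumRep_apply (b : B) (f : lp H 2) (i : ι) : directSumRep π b f i = π i b (f i) := rfl

lemma directSumRep_single [DecidableEq ι] (b : B) (i : ι) (v : H i) :
    directSumRep π b (lp.single 2 i v) = lp.single 2 i (π i b v) := by
  ext j
  rw [directSumRep_apply, lp.coeFn_single, lp.coeFn_single]
  by_cases h : j = i
  · subst h; simp
  · simp [Pi.single_eq_of_ne h]

lemma exists_incl (i : ι) : ∃ J : H i →ₗᵢ[ℂ] lp H 2, (∀ v, J v i = v) ∧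
    ∀ b v, directSumRep π b (J v) = J (π i b v) := by
  classical
  refine ⟨⟨lp.lsingle 2 i, fun v => lp.norm_single (by norm_num) i v⟩,
    fun v => lp.single_apply_self 2 i v, fun b v => ?_⟩
  exact directSumRep_single π b i v

end DirectSum

/-! ### The universal representation is faithful -/

section Faithful
variable {B : Type*} [NonUnitalCStarAlgebra B] [PartialOrder B] [StarOrderedRing B]

/-- Hahn–Banach separates `-b* b` from the closed cone of positive elements. Taking the hermitian
part and reversing the sign makes the separating functional positive. -/
lemma exists_posLinearMap_apply_ne_zero {b : B} (hb : b ≠ 0) :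
    ∃ φ : B →ₚ[ℂ] ℂ, φ (star b * b) ≠ 0 := by
  have hconv : Convex ℝ {a : B | 0 ≤ a} := fun x hx y hy s t hs ht _ =>
    add_nonneg (smul_nonneg hs hx) (smul_nonneg ht hy)
  have hnot : -(star b * b) ∉ {a : B | 0 ≤ a} := fun h => by
    have h1 : star b * b ≤ 0 := by simpa using h
    have h2 : star b * b = 0 := le_antisymm h1 (star_mul_self_nonneg b)
    exact hb (CStarRing.star_mul_self_eq_zero_iff b |>.1 h2)
  obtain ⟨f, u, hf, hfu⟩ := RCLike.geometric_hahn_banach_closed_point (𝕜 := ℂ) hconv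
    CStarAlgebra.isClosed_nonneg hnot
  have hu : 0 < u := by simpa using hf 0 (by simp)
  have hneg : ∀ a : B, 0 ≤ a → (f a).re ≤ 0 := fun a ha => by
    by_contra! h
    have h1 := hf ((u / (f a).re) • a) (smul_nonneg (by positivity) ha)
    rw [← Complex.coe_smul, map_smul, smul_eq_mul, RCLike.re_to_complex, Complex.re_ofReal_mul,
      div_mul_cancel₀ _ h.ne'] at h1
    exact lt_irrefl _ h1
  have hre : ∀ a : B, IsSelfAdjoint a →
      -(f a + star (f (star a))) / 2 = ((-(f a).re : ℝ) : ℂ) := fun a ha => by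
    rw [ha.star_eq, Complex.star_def, Complex.add_conj]
    push_cast; ring
  let φ₀ : B →ₗ[ℂ] ℂ :=
    { toFun := fun a => -(f a + star (f (star a))) / 2
      map_add' := fun a c => by simp only [map_add, star_add]; ring
      map_smul' := fun c a => by
        simp only [map_smul, star_smul, smul_eq_mul, star_mul', star_star, RingHom.id_apply]
        ring }
  refine ⟨PositiveLinearMap.mk₀ φ₀ fun a ha => ?_, ?_⟩
  · change 0 ≤ -(f a + star (f (star a))) / 2
    rw [hre a (IsSelfAdjoint.of_nonneg ha)]
    have := hneg a ha
    exact_mod_cast (by linarith : 0 ≤ -(f a).re)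
  · change -(f (star b * b) + star (f (star (star b * b)))) / 2 ≠ 0
    rw [hre _ (IsSelfAdjoint.star_mul_self b)]
    rw [map_neg, RCLike.re_to_complex, Complex.neg_re] at hfu
    exact_mod_cast (by linarith : -(f (star b * b)).re ≠ 0)

variable (B) in
/-- The space of the universal representation. -/
noncomputable abbrev UnivSpace := lp (fun φ : B →ₚ[ℂ] ℂ => φ.GNS) 2

variable (B) in
/-- The universal representation. -/
noncomputable def univRep : B →⋆ₙₐ[ℂ] (UnivSpace B →L[ℂ] UnivSpace B) :=
  directSumRep fun φ : B →ₚ[ℂ] ℂ => φ.gnsNonUnitalStarAlgHom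

lemma univRep_injective : Function.Injective (univRep B) := by
  refine (injective_iff_map_eq_zero _).2 fun b hb => ?_
  by_contra hne
  obtain ⟨φ, hφ⟩ := exists_posLinearMap_apply_ne_zero hne
  obtain ⟨ξ, -, h2, -⟩ := exists_gns_cyclic φ
  refine hφ ?_
  have h3 : φ.gnsNonUnitalStarAlgHom b ξ = 0 := by
    obtain ⟨J, hJ1, hJ2⟩ := exists_incl (fun φ : B →ₚ[ℂ] ℂ => φ.gnsNonUnitalStarAlgHom) φ
    rw [← hJ1 (φ.gnsNonUnitalStarAlgHom b ξ), ← hJ2 b ξ]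
    change (univRep B b (J ξ)) φ = 0
    rw [hb]; rfl
  rw [h2, rep_mul_apply, h3, map_zero, inner_zero_right]

/-- The inclusion of a GNS space in the universal representation. -/
lemma exists_gns_incl (φ : B →ₚ[ℂ] ℂ) : ∃ J : φ.GNS →ₗᵢ[ℂ] UnivSpace B,
    ∀ b v, univRep B b (J v) = J (φ.gnsNonUnitalStarAlgHom b v) := by
  obtain ⟨J, -, hJ⟩ := exists_incl (fun φ : B →ₚ[ℂ] ℂ => φ.gnsNonUnitalStarAlgHom) φ
  exact ⟨J, hJ⟩

end Faithful

/-! ### Positivity descends along injective homomorphisms -/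

section Positivity

/-- An injective homomorphism carries the negative part of `a` to the negative part of `φ a`, which
is zero. -/
lemma nonneg_of_map_nonneg {C D : Type*} [NonUnitalCStarAlgebra C] [PartialOrder C]
    [StarOrderedRing C] [NonUnitalCStarAlgebra D] [PartialOrder D] [StarOrderedRing D]
    (φ : C →⋆ₙₐ[ℂ] D) (hφ : Function.Injective φ) {a : C} (h : 0 ≤ φ a) : 0 ≤ a := by
  have hsa : IsSelfAdjoint a := by
    refine hφ ?_
    rw [map_star]; exact (IsSelfAdjoint.of_nonneg h).star_eq
  rw [← CFC.negPart_eq_zero_iff a]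
  refine hφ ?_
  have hcont : Continuous φ := (NonUnitalStarAlgHom.isometry φ hφ).continuous
  rw [map_zero, CFC.negPart_def,
    NonUnitalStarAlgHomClass.map_cfcₙ φ (fun t : ℝ => t⁻) a (by fun_prop) (by simp) hcont hsa
      (IsSelfAdjoint.of_nonneg h), ← CFC.negPart_def,
    (CFC.negPart_eq_zero_iff (φ a) (IsSelfAdjoint.of_nonneg h)).2 h]

lemma exists_eq_star_mul_self_of_map_nonneg {C D : Type*} [NonUnitalCStarAlgebra C]
    [NonUnitalCStarAlgebra D] [PartialOrder D] [StarOrderedRing D]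
    (φ : C →⋆ₙₐ[ℂ] D) (hφ : Function.Injective φ) {a : C} (h : 0 ≤ φ a) : ∃ y, a = star y * y := by
  let := CStarAlgebra.spectralOrder C
  have := CStarAlgebra.spectralOrderedRing C
  exact CStarAlgebra.nonneg_iff_eq_star_mul_self.1 (nonneg_of_map_nonneg φ hφ h)

/-- If the entries of a Gram matrix over a larger algebra lie in a smaller one, then it is a Gram
matrix of several vectors over the smaller algebra. -/
lemma exists_gram_factor {C D n : Type*} [NonUnitalCStarAlgebra C] [NonUnitalCStarAlgebra D]
    [Fintype n] (φ : C →⋆ₙₐ[ℂ] D) (hφ : Function.Injective φ) (Z : n → n → C) (R : n → D)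
    (h : ∀ i k, φ (Z i k) = star (R i) * R k) :
    ∃ Y : n → n → C, ∀ i k, Z i k = ∑ l, star (Y l i) * Y l k := by
  classical
  let := CStarAlgebra.spectralOrder C
  have := CStarAlgebra.spectralOrderedRing C
  let := CStarAlgebra.spectralOrder D
  have := CStarAlgebra.spectralOrderedRing D
  rcases isEmpty_or_nonempty n with hn | hn
  · exact ⟨fun _ _ => 0, fun i => hn.elim i⟩
  obtain ⟨l₀⟩ := hn
  let M : CStarMatrix n n C := CStarMatrix.ofMatrix (Matrix.of Z)
  -- Only the row `l₀` of `Q` is nonzero, so `Q* Q` has the entries `R(i)* R(k)`. Hence `M` is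
  -- positive over `D`, and by injectivity of the entrywise map already over `C`.
  let Q : CStarMatrix n n D := CStarMatrix.ofMatrix (Matrix.of fun l k => if l = l₀ then R k else 0)
  have hM : ∀ i k, M i k = Z i k := fun _ _ => rfl
  let ψ : CStarMatrix n n C →⋆ₙₐ[ℂ] CStarMatrix n n D := CStarMatrix.mapₙₐ φ
  have hψ : ∀ N i k, ψ N i k = φ (N i k) := fun _ _ _ => rfl
  have hψi : Function.Injective ψ := fun N N' hN => by
    ext i k
    exact hφ (by rw [← hψ, ← hψ, hN])
  have hQ : star Q * Q = ψ M := by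
    ext i k
    rw [CStarMatrix.mul_apply]
    change ∑ l, star (if l = l₀ then R i else 0) * (if l = l₀ then R k else 0) = φ (Z i k)
    rw [h, Finset.sum_eq_single l₀ (fun l _ hl => by simp [hl]) (by simp)]
    simp
  have hpos : 0 ≤ ψ M := by
    rw [← hQ]
    exact star_mul_self_nonneg Q
  obtain ⟨Y, hY⟩ := exists_eq_star_mul_self_of_map_nonneg ψ hψi hpos
  refine ⟨fun l k => Y l k, fun i k => ?_⟩
  rw [← hM, hY, CStarMatrix.mul_apply]
  rfl

lemma sum_inner_gram_nonneg {C H n : Type*} [NonUnitalCStarAlgebra C] [NormedAddCommGroup H]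
    [InnerProductSpace ℂ H] [CompleteSpace H] [Fintype n] (π : C →⋆ₙₐ[ℂ] (H →L[ℂ] H))
    (Z Y : n → n → C) (h : ∀ i k, Z i k = ∑ l, star (Y l i) * Y l k) (v : n → H) :
    0 ≤ (∑ k, ∑ i, ⟪π (Z i k) (v k), v i⟫_ℂ).re := by
  have h1 : ∀ k i, ⟪π (Z i k) (v k), v i⟫_ℂ = ∑ l, ⟪π (Y l k) (v k), π (Y l i) (v i)⟫_ℂ :=
    fun k i => by
    rw [h, map_sum, _root_.sum_apply, sum_inner]
    refine Finset.sum_congr rfl fun l _ => ?_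
    rw [rep_mul_apply, inner_rep_left, star_star]
  have h2 : ∑ k, ∑ i, ⟪π (Z i k) (v k), v i⟫_ℂ =
      ∑ l, ⟪∑ k, π (Y l k) (v k), ∑ i, π (Y l i) (v i)⟫_ℂ := by
    simp_rw [h1, sum_inner, inner_sum]
    rw [Finset.sum_comm]
    conv_rhs => rw [Finset.sum_comm]
    rw [Finset.sum_comm]
    exact Finset.sum_congr rfl fun k _ => Finset.sum_comm
  rw [h2, Complex.re_sum]
  exact Finset.sum_nonneg fun l _ => inner_self_nonneg (𝕜 := ℂ)

end Positivity

/-! ### Kolmogorov decomposition and Stinespring dilation -/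

section Dilation
universe uE uH uB
variable {E : Type uE} [CStarAlgebra E] {B : Type uB} [NonUnitalCStarAlgebra B] {H : Type uH}
  [NormedAddCommGroup H] [InnerProductSpace ℂ H] [CompleteSpace H]

/-- The Kolmogorov decomposition of a completely positive map. -/
lemma exists_kolmogorov (π : B →⋆ₙₐ[ℂ] (H →L[ℂ] H)) (γ : E →ₗ[ℂ] B)
    (hstar : ∀ a, γ (star a) = star (γ a))
    (hpos : ∀ (s : Finset E) (v : E → H),
      0 ≤ (∑ x ∈ s, ∑ y ∈ s, ⟪π (γ (star y * x)) (v x), v y⟫_ℂ).re) :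
    ∃ (K : Type (max uE uH)) (_ : NormedAddCommGroup K) (_ : InnerProductSpace ℂ K)
      (_ : CompleteSpace K) (V : E → H →L[ℂ] K),
      (∀ x y v w, ⟪V x v, V y w⟫_ℂ = ⟪v, π (γ (star x * y)) w⟫_ℂ) ∧
      (Submodule.span ℂ {z | ∃ x v, V x v = z}).topologicalClosure = ⊤ := by
  -- The dilation space is the reproducing kernel space of this operator-valued kernel, and `V x` is
  -- its kernel function at `x`.
  let M : Matrix E E (H →L[ℂ] H) := Matrix.of fun x y => π (γ (star x * y))
  have hM : M.PosSemidef := by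
    have htfae := (RKHS.posSemidef_tfae (K := M)).out 0 2
    refine htfae.2 ⟨?_, fun vv => ?_⟩
    · ext x y : 1
      change star (π (γ (star y * x))) = π (γ (star x * y))
      rw [← map_star, ← hstar, star_mul, star_star]
    · exact hpos vv.support vv
  have : Fact M.PosSemidef := ⟨hM⟩
  refine ⟨RKHS.OfKernel M, inferInstance, inferInstance, inferInstance,
    RKHS.kerFun (RKHS.OfKernel M), fun x y v w => ?_, RKHS.kerFun_dense _⟩
  rw [RKHS.kerFun_inner, RKHS.kerFun_apply, RKHS.OfKernel.kernel_ofKernel]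
  rfl

variable {K : Type*} [NormedAddCommGroup K] [InnerProductSpace ℂ K] [CompleteSpace K]

lemma ext_of_span_dense {E H K L : Type*} [NormedAddCommGroup H] [InnerProductSpace ℂ H]
    [NormedAddCommGroup K] [InnerProductSpace ℂ K] [NormedAddCommGroup L] [InnerProductSpace ℂ L]
    {V : E → H →L[ℂ] K}
    (hV : (Submodule.span ℂ {z | ∃ x v, V x v = z}).topologicalClosure = ⊤) {S T : K →L[ℂ] L}
    (h : ∀ x v, S (V x v) = T (V x v)) : S = T := by
  refine ContinuousLinearMap.ext_on (s := {z | ∃ x v, V x v = z}) ?_ ?_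
  · rw [Submodule.dense_iff_topologicalClosure_eq_top]; exact hV
  · rintro _ ⟨x, v, rfl⟩; exact h x v

/-- The Stinespring dilation of a completely positive map. -/
lemma exists_stinespring (π : B →⋆ₙₐ[ℂ] (H →L[ℂ] H)) (γ : E →ₗ[ℂ] B) {V : E → H →L[ℂ] K}
    (hV : ∀ x y v w, ⟪V x v, V y w⟫_ℂ = ⟪v, π (γ (star x * y)) w⟫_ℂ)
    (hd : (Submodule.span ℂ {z | ∃ x v, V x v = z}).topologicalClosure = ⊤) :
    ∃ ρ : E →⋆ₐ[ℂ] (K →L[ℂ] K), ∀ a x v, ρ a (V x v) = V (a * x) v := by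
  have hV0 : ∀ z : K, (∀ x v, ⟪V x v, z⟫_ℂ = 0) → z = 0 := fun z hz => by
    have : innerSL ℂ z = 0 := ext_of_span_dense (V := V) hd fun x v => by
      rw [innerSL_apply_apply, ← inner_conj_symm, hz]; simp
    have h2 := congr_arg (fun f => f z) this
    simpa using h2
  have hVext : ∀ z z' : K, (∀ x v, ⟪V x v, z⟫_ℂ = ⟪V x v, z'⟫_ℂ) → z = z' := fun z z' h => by
    rw [← sub_eq_zero]
    exact hV0 _ fun x v => by rw [inner_sub_right, h, sub_self]
  have hadd : ∀ x y v, V (x + y) v = V x v + V y v := fun x y v => hVext _ _ fun z w => by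
    rw [inner_add_right, hV, hV, hV, mul_add, map_add, map_add]
    exact inner_add_right _ _ _
  have hsmul : ∀ (c : ℂ) x v, V (c • x) v = c • V x v := fun c x v => hVext _ _ fun z w => by
    rw [inner_smul_right, hV, hV, mul_smul_comm, map_smul, map_smul]
    exact inner_smul_right _ _ _
  let e : (E →₀ H) →ₗ[ℂ] K := Finsupp.lsum ℂ fun x => (V x).toLinearMap
  let f : E → (E →₀ H) →ₗ[ℂ] K := fun a => Finsupp.lsum ℂ fun x => (V (a * x)).toLinearMap
  have he : ∀ vv, e vv = vv.sum fun x v => V x v := fun vv => rfl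
  have hf : ∀ a vv, f a vv = vv.sum fun x v => V (a * x) v := fun a vv => rfl
  have hed : DenseRange e := by
    have h1 : (LinearMap.range e : Submodule ℂ K).topologicalClosure = ⊤ := by
      rw [eq_top_iff, ← hd]
      refine Submodule.topologicalClosure_mono (Submodule.span_le.2 ?_)
      rintro _ ⟨x, v, rfl⟩
      exact ⟨Finsupp.single x v, by rw [he, Finsupp.sum_single_index (by simp)]⟩
    exact (Submodule.dense_iff_topologicalClosure_eq_top.2 h1 :)
  have hinner : ∀ a vv, ⟪f a vv, f a vv⟫_ℂ =
      ∑ x ∈ vv.support, ∑ y ∈ vv.support, ⟪vv y, π (γ (star y * (star a * a) * x)) (vv x)⟫_ℂ :=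
    fun a vv => by
    rw [hf, Finsupp.sum, inner_sum]
    refine Finset.sum_congr rfl fun x _ => ?_
    rw [sum_inner]
    refine Finset.sum_congr rfl fun y _ => ?_
    rw [hV, star_mul]
    simp only [mul_assoc]
  have hbound : ∀ a vv, ‖f a vv‖ ≤ ‖a‖ * ‖e vv‖ := fun a vv => by
    let := CStarAlgebra.spectralOrder E
    have := CStarAlgebra.spectralOrderedRing E
    -- Writing `‖a‖² - a* a = d* d` gives `‖f a‖² + ‖f d‖² = ‖a‖² ‖f 1‖²` on finite sums, so
    -- multiplication by `a` is bounded by `‖a‖`.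
    have h0 : 0 ≤ algebraMap ℝ E (‖a‖ ^ 2) - star a * a := by
      rw [sub_nonneg, pow_two, ← CStarRing.norm_star_mul_self]
      exact (IsSelfAdjoint.star_mul_self a).le_algebraMap_norm_self
    obtain ⟨d, hd⟩ := CStarAlgebra.nonneg_iff_eq_star_mul_self.1 h0
    have h1 : f 1 vv = e vv := by rw [hf, he]; simp only [one_mul]
    have h2 : ⟪f a vv, f a vv⟫_ℂ + ⟪f d vv, f d vv⟫_ℂ = ((‖a‖ ^ 2 : ℝ) : ℂ) * ⟪e vv, e vv⟫_ℂ := by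
      rw [← h1, hinner, hinner, hinner, ← Finset.sum_add_distrib, Finset.mul_sum]
      refine Finset.sum_congr rfl fun x _ => ?_
      rw [← Finset.sum_add_distrib, Finset.mul_sum]
      refine Finset.sum_congr rfl fun y _ => ?_
      have h3 : star y * (star a * a) * x + star y * (star d * d) * x =
          ((‖a‖ ^ 2 : ℝ) : ℂ) • (star y * (star 1 * 1) * x) := by
        rw [← hd, ← add_mul, ← mul_add, add_sub_cancel, Algebra.algebraMap_eq_smul_one,
          ← Complex.coe_smul, star_one, one_mul, mul_smul_comm, smul_mul_assoc]
      rw [← inner_add_right, ← _root_.add_apply, ← map_add, ← map_add, h3, map_smul, map_smul]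
      exact inner_smul_right _ _ _
    have h4 := congr_arg Complex.re h2
    rw [inner_self_eq_norm_sq_to_K, inner_self_eq_norm_sq_to_K, inner_self_eq_norm_sq_to_K] at h4
    have h5 : ‖f a vv‖ ^ 2 + ‖f d vv‖ ^ 2 = ‖a‖ ^ 2 * ‖e vv‖ ^ 2 := by
      simpa [← Complex.ofReal_pow] using h4
    refine le_of_sq_le_sq ?_ (by positivity)
    rw [mul_pow, ← h5]
    exact le_add_of_nonneg_right (sq_nonneg _)
  let ρ : E → K →L[ℂ] K := fun a => (f a).extendOfNorm e
  have hρ : ∀ a x v, ρ a (V x v) = V (a * x) v := fun a x v => by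
    have h1 : e (Finsupp.single x v) = V x v := by
      rw [he, Finsupp.sum_single_index (by simp)]
    have h2 : f a (Finsupp.single x v) = V (a * x) v := by
      rw [hf, Finsupp.sum_single_index (by simp)]
    rw [← h1, ← h2]
    exact LinearMap.extendOfNorm_eq hed ⟨‖a‖, hbound a⟩ _
  refine ⟨⟨⟨⟨⟨⟨ρ, ?_⟩, ?_⟩, ?_, ?_⟩, ?_⟩, ?_⟩, hρ⟩
  · exact ext_of_span_dense hd fun x v => by rw [hρ, one_mul]; rfl
  · refine fun a b => ext_of_span_dense hd fun x v => ?_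
    change _ = ρ a (ρ b (V x v))
    rw [hρ, hρ, hρ, mul_assoc]
  · refine ext_of_span_dense hd fun x v => ?_
    rw [hρ, zero_mul, ← zero_smul ℂ (0 : E), hsmul]; simp
  · refine fun a b => ext_of_span_dense hd fun x v => ?_
    change _ = ρ a (V x v) + ρ b (V x v)
    rw [hρ, hρ, hρ, add_mul, hadd]
  · refine fun c => ext_of_span_dense hd fun x v => ?_
    rw [hρ, Algebra.algebraMap_eq_smul_one, smul_mul_assoc, one_mul, hsmul,
      Algebra.algebraMap_eq_smul_one]
    rfl
  · intro a
    rw [ContinuousLinearMap.star_eq_adjoint]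
    refine ext_of_span_dense hd fun x v => hVext _ _ fun y w => ?_
    rw [ContinuousLinearMap.adjoint_inner_right, hρ, hρ, hV, hV, star_mul, mul_assoc]

end Dilation

/-! ### Dilation of the compression to a corner -/

section Corner
universe u₁ u₂ u₃ u₄
variable {A₁ : Type u₁} {E : Type u₂} {B : Type u₃} {H : Type u₄} [NonUnitalCStarAlgebra A₁]
  [CStarAlgebra E] [NonUnitalCStarAlgebra B] [NormedAddCommGroup H] [InnerProductSpace ℂ H]
  [CompleteSpace H]

/-- A minimal Stinespring dilation of the completely positive map `a ↦ ι (c a c)`. -/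
structure CornerDilation (π : B →⋆ₙₐ[ℂ] (H →L[ℂ] H)) (ι : A₁ →⋆ₙₐ[ℂ] B) (j : A₁ →⋆ₙₐ[ℂ] E)
    (c : A₁) (K : Type*) [NormedAddCommGroup K] [InnerProductSpace ℂ K] [CompleteSpace K] where
  /-- Compression by `c`. -/
  γ : E →ₗ[ℂ] A₁
  /-- The operators `v ↦ x ⊗ v`. -/
  V : E → H →L[ℂ] K
  /-- The dilation. -/
  ρ : E →⋆ₐ[ℂ] (K →L[ℂ] K)
  map_γ : ∀ a, j (γ a) = j c * a * j c
  inner_V : ∀ x y v w, ⟪V x v, V y w⟫_ℂ = ⟪v, π (ι (γ (star x * y))) w⟫_ℂ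
  dense_V : (Submodule.span ℂ {z | ∃ x v, V x v = z}).topologicalClosure = ⊤
  ρ_V : ∀ a x v, ρ a (V x v) = V (a * x) v

/-- The matrix `(c x* y c)` is the Gram matrix of the elements `x c` of `E`. Since `E` does not map
to `B`, this has to be refactored inside `A₁`, where the entries lie; `ι` and `π` then preserve
positivity. -/
lemma exists_cornerDilation (π : B →⋆ₙₐ[ℂ] (H →L[ℂ] H)) (ι : A₁ →⋆ₙₐ[ℂ] B) (j : A₁ →⋆ₙₐ[ℂ] E)
    (hj : Function.Injective j) {c : A₁} (hc : IsSelfAdjoint c)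
    (hcorner : ∀ a, ∃ y, j y = j c * a * j c) :
    ∃ (K : Type (max u₂ u₄)) (_ : NormedAddCommGroup K)
      (_ : InnerProductSpace ℂ K) (_ : CompleteSpace K), Nonempty (CornerDilation π ι j c K) := by
  choose g hg using hcorner
  have hjc : star (j c) = j c := by rw [← map_star, hc.star_eq]
  let γ : E →ₗ[ℂ] A₁ :=
    { toFun := g
      map_add' := fun a b => hj (by rw [map_add, hg, hg, hg, mul_add, add_mul])
      map_smul' := fun t a => hj (by
        rw [RingHom.id_apply, map_smul, hg, hg, mul_smul_comm, smul_mul_assoc]) }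
  have hγ : ∀ a, j (γ a) = j c * a * j c := hg
  have hstar : ∀ a, γ (star a) = star (γ a) := fun a => hj (by
    rw [map_star j, hγ, hγ, star_mul, star_mul, hjc, mul_assoc])
  let ιγ : E →ₗ[ℂ] B := (ι : A₁ →ₗ[ℂ] B) ∘ₗ γ
  have hιγ : ∀ a, ιγ a = ι (γ a) := fun a => rfl
  obtain ⟨K, i₁, i₂, i₃, V, hV, hd⟩ := exists_kolmogorov π ιγ
    (fun a => by rw [hιγ, hιγ, hstar, map_star]) fun s v => by
      obtain ⟨Y, hY⟩ := exists_gram_factor (n := s) j hj (fun x y => γ (star x.1 * y.1))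
        (fun x => x.1 * j c) fun x y => by
          rw [hγ, star_mul, hjc]; simp only [mul_assoc]
      have := sum_inner_gram_nonneg (π.comp ι) _ Y hY fun x : s => v x.1
      rw [Finset.sum_coe_sort s fun x => ∑ i : s, ⟪(π.comp ι) (γ (star i.1 * x)) (v x), v i.1⟫_ℂ]
        at this
      refine this.trans_eq (congr_arg Complex.re (Finset.sum_congr rfl fun x _ => ?_))
      exact Finset.sum_coe_sort s fun y => ⟪(π.comp ι) (γ (star y * x)) (v x), v y⟫_ℂ
  obtain ⟨ρ, hρ⟩ := exists_stinespring π ιγ hV hd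
  exact ⟨K, i₁, i₂, i₃, ⟨γ, V, ρ, hγ, hV, hd, hρ⟩⟩

end Corner

/-! ### The algebra of adjointable operators on the dilation space -/

section Adjointable
open ContinuousLinearMap
variable {E B H K : Type*} [NonUnitalCStarAlgebra B] [NormedAddCommGroup H]
  [InnerProductSpace ℂ H] [CompleteSpace H] [NormedAddCommGroup K] [InnerProductSpace ℂ K]
  [CompleteSpace K] (π : B →⋆ₙₐ[ℂ] (H →L[ℂ] H)) (V : E → H →L[ℂ] K)

/-- The operators whose compressions by the operators `V a` lie in the image of `π`. -/
def moduleOps : Set (H →L[ℂ] K) := {X | ∀ a, ∃ b, adjoint (V a) ∘L X = π b}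

/-- The operators that preserve `moduleOps` together with their adjoints. -/
def adjointableOps : StarSubalgebra ℂ (K →L[ℂ] K) where
  carrier := {T | ∀ X ∈ moduleOps π V, T ∘L X ∈ moduleOps π V ∧ adjoint T ∘L X ∈ moduleOps π V}
  mul_mem' {S T} hS hT X hX := by
    refine ⟨(hS _ (hT X hX).1).1, ?_⟩
    rw [← star_eq_adjoint, star_mul]
    exact (hT _ (hS X hX).2).2
  add_mem' {S T} hS hT X hX := by
    have hadd : ∀ X ∈ moduleOps π V, ∀ Y ∈ moduleOps π V, X + Y ∈ moduleOps π V :=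
      fun X hX Y hY a => by
        obtain ⟨b, hb⟩ := hX a
        obtain ⟨b', hb'⟩ := hY a
        exact ⟨b + b', by rw [comp_add, hb, hb', map_add]⟩
    refine ⟨by rw [add_comp]; exact hadd _ (hS X hX).1 _ (hT X hX).1, ?_⟩
    rw [map_add, add_comp]
    exact hadd _ (hS X hX).2 _ (hT X hX).2
  algebraMap_mem' r X hX := by
    have hsm : ∀ (r : ℂ), ∀ X ∈ moduleOps π V, r • X ∈ moduleOps π V := fun r X hX a => by
      obtain ⟨b, hb⟩ := hX a
      exact ⟨r • b, by rw [comp_smul, hb, map_smul]⟩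
    refine ⟨?_, ?_⟩
    · rw [Algebra.algebraMap_eq_smul_one, smul_comp]
      exact hsm r X hX
    · rw [← star_eq_adjoint, ← algebraMap_star_comm, Algebra.algebraMap_eq_smul_one, smul_comp]
      exact hsm _ X hX
  star_mem' {T} hT X hX := by
    refine ⟨(hT X hX).2, ?_⟩
    rw [star_eq_adjoint, adjoint_adjoint]
    exact (hT X hX).1

variable {π V}

lemma isClosed_moduleOps (hπ : Function.Injective π) : IsClosed (moduleOps π V) := by
  have hr : IsClosed (Set.range π) :=
    (NonUnitalStarAlgHom.isometry π hπ).isClosedEmbedding.isClosed_range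
  have : moduleOps π V = ⋂ a, (fun X => adjoint (V a) ∘L X) ⁻¹' Set.range π := by
    ext X
    simp only [moduleOps, Set.mem_ofPred_eq, Set.mem_iInter, Set.mem_preimage, Set.mem_range]
    exact forall_congr' fun a => exists_congr fun b => eq_comm
  rw [this]
  exact isClosed_iInter fun a => hr.preimage (by fun_prop)

lemma isClosed_adjointableOps (hπ : Function.Injective π) :
    IsClosed (adjointableOps π V : Set (K →L[ℂ] K)) := by
  have h := isClosed_moduleOps (V := V) hπ
  have : (adjointableOps π V : Set (K →L[ℂ] K)) = ⋂ X ∈ moduleOps π V,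
      ((fun T : K →L[ℂ] K => T ∘L X) ⁻¹' moduleOps π V ∩
        (fun T : K →L[ℂ] K => star T ∘L X) ⁻¹' moduleOps π V) := by
    ext T
    simp only [Set.mem_iInter, Set.mem_inter_iff, Set.mem_preimage]
    rfl
  rw [this]
  refine isClosed_iInter fun X => isClosed_iInter fun _ => ?_
  exact (h.preimage (by fun_prop)).inter (h.preimage (by fun_prop))

lemma comp_rep_mem_moduleOps {X : H →L[ℂ] K} (hX : X ∈ moduleOps π V) (b : B) :
    X ∘L π b ∈ moduleOps π V := fun a => by
  obtain ⟨b', hb'⟩ := hX a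
  exact ⟨b' * b, by rw [← comp_assoc, hb', map_mul]; rfl⟩

/-- These are the "rank one" operators of the Hilbert module. They carry `B` into the algebra of
adjointable operators. -/
lemma comp_rep_comp_adjoint_mem {x y : E} (hx : V x ∈ moduleOps π V) (hy : V y ∈ moduleOps π V)
    (b : B) : V x ∘L π b ∘L adjoint (V y) ∈ adjointableOps π V := fun X hX => by
  obtain ⟨b₁, hb₁⟩ := hX x
  obtain ⟨b₂, hb₂⟩ := hX y
  refine ⟨?_, ?_⟩
  · rw [comp_assoc, comp_assoc, hb₂]
    exact comp_rep_mem_moduleOps (comp_rep_mem_moduleOps hx b) b₂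
  · rw [adjoint_comp, adjoint_comp, adjoint_adjoint, comp_assoc, comp_assoc, hb₁,
      ← star_eq_adjoint (π b), ← map_star]
    exact comp_rep_mem_moduleOps (comp_rep_mem_moduleOps hy _) b₁

lemma exists_rep_eq_compression {x y : E} (hy : V y ∈ moduleOps π V) {T : K →L[ℂ] K}
    (hT : T ∈ adjointableOps π V) : ∃ b, adjoint (V x) ∘L T ∘L V y = π b :=
  (hT _ hy).1 x

end Adjointable

/-! ### Relations between the dilation and the corner -/

namespace CornerDilation
open ContinuousLinearMap
variable {A₁ E B H K : Type*} [NonUnitalCStarAlgebra A₁]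
  [CStarAlgebra E] [NonUnitalCStarAlgebra B] [NormedAddCommGroup H] [InnerProductSpace ℂ H]
  [CompleteSpace H] [NormedAddCommGroup K] [InnerProductSpace ℂ K] [CompleteSpace K]
  {π : B →⋆ₙₐ[ℂ] (H →L[ℂ] H)} {ι : A₁ →⋆ₙₐ[ℂ] B} {j : A₁ →⋆ₙₐ[ℂ] E} {c : A₁}
  (D : CornerDilation π ι j c K)
include D

lemma ext_inner {z z' : K} (h : ∀ x v, ⟪D.V x v, z⟫_ℂ = ⟪D.V x v, z'⟫_ℂ) : z = z' := by
  have : innerSL ℂ (z - z') = 0 := ext_of_span_dense D.dense_V fun x v => by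
    rw [innerSL_apply_apply, ← inner_conj_symm, inner_sub_right, h, sub_self]; simp
  rw [← sub_eq_zero, ← inner_self_eq_zero (𝕜 := ℂ)]
  exact congr_arg (fun f => f (z - z')) this

lemma adjoint_V_V (x y : E) (w : H) :
    adjoint (D.V x) (D.V y w) = π (ι (D.γ (star x * y))) w := by
  refine ext_inner_left ℂ fun v => ?_
  rw [adjoint_inner_right, D.inner_V]

lemma V_mem (y : E) : D.V y ∈ moduleOps π D.V := fun x =>
  ⟨_, ContinuousLinearMap.ext fun w => D.adjoint_V_V x y w⟩

lemma ρ_mem (a : E) : D.ρ a ∈ adjointableOps π D.V := by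
  have key : ∀ a : E, ∀ X ∈ moduleOps π D.V, D.ρ a ∘L X ∈ moduleOps π D.V := fun a X hX x => by
    obtain ⟨b, hb⟩ := hX (star a * x)
    refine ⟨b, ?_⟩
    rw [← hb, ← comp_assoc]
    congr 1
    rw [← adjoint_adjoint (D.ρ a), ← adjoint_comp, ← star_eq_adjoint, ← map_star]
    congr 1
    exact ContinuousLinearMap.ext fun v => D.ρ_V _ _ _
  refine fun X hX => ⟨key a X hX, ?_⟩
  rw [← star_eq_adjoint, ← map_star]
  exact key _ X hX

variable (hj : Function.Injective j)
include hj

lemma γ_one : D.γ 1 = c * c := hj (by rw [D.map_γ, mul_one, map_mul])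

lemma adjoint_V_V_one (v : H) : adjoint (D.V 1) (D.V 1 v) = π (ι (c * c)) v := by
  rw [D.adjoint_V_V, star_one, one_mul, D.γ_one hj]

/-- `V 1` is only a contraction with `V₁* V₁ = c²`, but it intertwines those `x` on which `c` acts
as a two-sided unit, because `c y* x c = (c y* c) x`. -/
lemma ρ_V_one {x : A₁} (h₁ : c * x = x) (h₂ : x * c = x) (v : H) :
    D.ρ (j x) (D.V 1 v) = D.V 1 (π (ι x) v) := by
  refine D.ext_inner fun y w => ?_
  rw [D.ρ_V, D.inner_V, D.inner_V, ← rep_mul_apply, ← map_mul]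
  congr 4
  refine hj ?_
  rw [map_mul j, D.map_γ, D.map_γ, mul_one, mul_one]
  simp only [mul_assoc, ← map_mul j, h₁, h₂]

lemma adjoint_V_one_ρ {x : A₁} (h₁ : c * x = x) (h₂ : x * c = x) (hc : IsSelfAdjoint c) (z : K) :
    adjoint (D.V 1) (D.ρ (j x) z) = π (ι x) (adjoint (D.V 1) z) := by
  refine ext_inner_left ℂ fun v => ?_
  have hs₁ : c * star x = star x := by
    rw [← hc.star_eq, ← star_mul, h₂]
  have hs₂ : star x * c = star x := by
    rw [← hc.star_eq, ← star_mul, h₁]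
  rw [adjoint_inner_right, ← adjoint_inner_left, ← star_eq_adjoint, ← map_star, ← map_star,
    D.ρ_V_one hj hs₁ hs₂, ← adjoint_inner_right, inner_rep_left,
    ← map_star ι, star_star]

/-- `V₁ V₁*` acts as the identity on the range of `ρ(d)`: in `c x* c · c d y c` the middle factors
`c` are absorbed by `d`. -/
lemma V_one_adjoint_ρ {d : A₁} (hc : IsSelfAdjoint c) (hd : IsSelfAdjoint d) (h : c * d = d)
    (z : K) : D.V 1 (adjoint (D.V 1) (D.ρ (j d) z)) = D.ρ (j d) z := by
  have h' : d * c = d := by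
    rw [← hc.star_eq, ← hd.star_eq, ← star_mul, h]
  have : D.V 1 ∘L adjoint (D.V 1) ∘L D.ρ (j d) = D.ρ (j d) := by
    refine ext_of_span_dense D.dense_V fun y v => ?_
    change D.V 1 (adjoint (D.V 1) (D.ρ (j d) (D.V y v))) = D.ρ (j d) (D.V y v)
    refine D.ext_inner fun x w => ?_
    rw [D.ρ_V, D.adjoint_V_V, D.inner_V, D.inner_V, ← rep_mul_apply, ← map_mul]
    congr 4
    refine hj ?_
    rw [map_mul j, D.map_γ, D.map_γ, D.map_γ, star_one, one_mul, mul_one]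
    have e1 : j c * (j d * y) = j d * y := by rw [← mul_assoc, ← map_mul, h]
    rw [e1]
    simp only [mul_assoc]
    rw [← mul_assoc (j c) (j d), ← map_mul, h]
  exact congr_arg (fun T => T z) this

end CornerDilation

/-! ### Transport of purity and equivalence to the dilation -/

section Transport

lemma IsIrreducible.exists_apply_eq {B H : Type*} [NonUnitalCStarAlgebra B] [NormedAddCommGroup H]
    [InnerProductSpace ℂ H] [CompleteSpace H] {π : B →⋆ₙₐ[ℂ] (H →L[ℂ] H)} (hπ : IsIrreducible π)
    {x : H} (hx : x ≠ 0) (y : H) : ∃ b, π b x = y := by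
  obtain ⟨l, hl, hl'⟩ : ∃ l : ℂ, l ≠ 0 ∧ (l * ⟪x, y⟫_ℂ).im = 0 := by
    rcases eq_or_ne (⟪x, y⟫_ℂ) 0 with h | h
    · exact ⟨1, one_ne_zero, by simp [h]⟩
    · exact ⟨(⟪x, y⟫_ℂ)⁻¹, inv_ne_zero h, by simp [h]⟩
  obtain ⟨b, -, -, hb⟩ := hπ.exists_preimage hx (p := l • y) (by rw [inner_smul_right]; exact hl')
  refine ⟨l⁻¹ • b, ?_⟩
  rw [map_smul, _root_.smul_apply, hb, smul_smul, inv_mul_cancel₀ hl, one_smul]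

lemma exists_gns_isometry {D K : Type*} [NonUnitalCStarAlgebra D] [PartialOrder D]
    [StarOrderedRing D] [NormedAddCommGroup K] [InnerProductSpace ℂ K] [CompleteSpace K]
    (κ : D →⋆ₙₐ[ℂ] (K →L[ℂ] K)) {ω : D →ₚ[ℂ] ℂ} {η : K} (hω : ∀ d, ω d = ⟪η, κ d η⟫_ℂ) :
    ∃ L : ω.GNS →ₗᵢ[ℂ] K, (∀ d, L (ω.toPreGNS d : ω.GNS) = κ d η) ∧
      ∀ d v, L (ω.gnsNonUnitalStarAlgHom d v) = κ d (L v) := by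
  let f : ω.PreGNS →ₗ[ℂ] K := ((ContinuousLinearMap.apply ℂ K η).toLinearMap ∘ₗ
    (κ : D →ₗ[ℂ] (K →L[ℂ] K))) ∘ₗ ω.ofPreGNS.toLinearMap
  have hf : ∀ x, f x = κ (ω.ofPreGNS x) η := fun x => rfl
  have hn : ∀ x, ‖f x‖ = ‖x‖ := fun x => by
    have h1 := ω.preGNS_norm_sq x
    rw [hω, rep_mul_apply, ← inner_rep_left, inner_self_eq_norm_sq_to_K] at h1
    have h2 : ‖x‖ ^ 2 = ‖f x‖ ^ 2 := Complex.ofReal_injective (by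
      rw [hf, Complex.ofReal_pow, Complex.ofReal_pow]; exact h1)
    exact ((sq_eq_sq₀ (norm_nonneg _) (norm_nonneg _)).1 h2).symm
  let F : ω.PreGNS →ₗᵢ[ℂ] K := ⟨f, hn⟩
  let e : ω.PreGNS →L[ℂ] ω.GNS := UniformSpace.Completion.toComplL
  let g : ω.GNS →L[ℂ] K := F.toContinuousLinearMap.extend e
  have hg : ∀ x : ω.PreGNS, g (x : ω.GNS) = f x := fun x =>
    ContinuousLinearMap.extend_eq (e := e) F.toContinuousLinearMap
      UniformSpace.Completion.denseRange_coe (UniformSpace.Completion.isUniformInducing_coe _) x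
  refine ⟨⟨g.toLinearMap, fun v => ?_⟩, fun d => hg _, fun d v => ?_⟩
  · change ‖g v‖ = ‖v‖
    induction v using UniformSpace.Completion.induction_on with
    | hp => apply isClosed_eq <;> fun_prop
    | ih x => rw [hg, hn, UniformSpace.Completion.norm_coe]
  · change g _ = κ d (g v)
    induction v using UniformSpace.Completion.induction_on with
    | hp => apply isClosed_eq <;> fun_prop
    | ih x =>
      rw [PositiveLinearMap.gnsNonUnitalStarAlgHom_apply_coe, hg, hg, hf, hf, ← rep_mul_apply]
      rfl

/-- Both GNS spaces embed isometrically in `K` as the closed orbits of `η₁` and `η₂`. Each vector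
lies in the orbit of the other, so the two ranges coincide. -/
lemma gnsEquivalent_of_vectors {D K : Type*} [NonUnitalCStarAlgebra D] [PartialOrder D]
    [StarOrderedRing D] [NormedAddCommGroup K] [InnerProductSpace ℂ K] [CompleteSpace K]
    (κ : D →⋆ₙₐ[ℂ] (K →L[ℂ] K)) {ω₁ ω₂ : D →ₚ[ℂ] ℂ} {η₁ η₂ : K}
    (h₁ : ∀ d, ω₁ d = ⟪η₁, κ d η₁⟫_ℂ) (h₂ : ∀ d, ω₂ d = ⟪η₂, κ d η₂⟫_ℂ)
    {q₁ q₂ : D} (hq₁ : κ q₁ η₁ = η₂) (hq₂ : κ q₂ η₂ = η₁) : GNSEquivalent ω₁ ω₂ := by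
  obtain ⟨L₁, hL₁, hL₁'⟩ := exists_gns_isometry κ h₁
  obtain ⟨L₂, hL₂, hL₂'⟩ := exists_gns_isometry κ h₂
  have key : ∀ {ω ω' : D →ₚ[ℂ] ℂ} {η η' : K} (L : ω.GNS →ₗᵢ[ℂ] K) (L' : ω'.GNS →ₗᵢ[ℂ] K)
      (_ : ∀ d, L (ω.toPreGNS d : ω.GNS) = κ d η) (_ : ∀ d, L' (ω'.toPreGNS d : ω'.GNS) = κ d η')
      (q : D) (_ : κ q η' = η), Set.range L ⊆ Set.range L' := by
    rintro ω ω' η η' L L' hL hL' q hq _ ⟨v, rfl⟩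
    have hc : IsClosed (Set.range L') := L'.isometry.isClosedEmbedding.isClosed_range
    induction v using UniformSpace.Completion.induction_on with
    | hp => exact hc.preimage L.continuous
    | ih x =>
      refine ⟨(ω'.toPreGNS (ω.ofPreGNS x * q) : ω'.GNS), ?_⟩
      rw [hL', rep_mul_apply, hq]
      exact (hL (ω.ofPreGNS x)).symm
  have hr : Set.range L₁ = Set.range L₂ :=
    (key L₁ L₂ hL₁ hL₂ q₂ hq₂).antisymm (key L₂ L₁ hL₂ hL₁ q₁ hq₁)
  have hr' : LinearMap.range L₁.toLinearMap = LinearMap.range L₂.toLinearMap :=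
    SetLike.coe_injective hr
  let W := (L₁.equivRange.trans (LinearIsometryEquiv.ofEq _ _ hr')).trans L₂.equivRange.symm
  have hW : ∀ v, L₂ (W v) = L₁ v := fun v =>
    congr_arg Subtype.val (L₂.equivRange.apply_symm_apply
      (LinearIsometryEquiv.ofEq _ _ hr' (L₁.equivRange v)))
  refine ⟨W, fun b v => L₂.injective ?_⟩
  rw [hW, hL₁', hL₂', hW]

lemma isPureState_of_forall_add {D : Type*} [NonUnitalCStarAlgebra D] [PartialOrder D]
    [StarOrderedRing D] {ω : D →ₚ[ℂ] ℂ} (h₁ : ‖toDual ω‖ = 1)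
    (h : ∀ φ ψ : D →ₚ[ℂ] ℂ, (∀ d, φ d + ψ d = ω d) →
      ∃ t : ℝ, 0 ≤ t ∧ ∀ d, φ d = (t : ℂ) * ω d) : IsPureState ω := by
  refine ⟨⟨fun b hb => ω.map_nonneg hb, h₁⟩, fun f₁ hf₁ f₂ hf₂ hseg => ?_⟩
  obtain ⟨a, b, ha, hb, -, hab⟩ := hseg
  have key : ∀ (r : ℝ), 0 ≤ r → ∀ f ∈ stateSpace D, ∃ φ : D →ₚ[ℂ] ℂ, ∀ d, φ d = (r : ℂ) * f d :=
    fun r hr f hf => ⟨PositiveLinearMap.mk₀ ((r : ℂ) • f.toLinearMap) fun d hd =>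
      mul_nonneg (by exact_mod_cast hr) (hf.1 d hd), fun d => rfl⟩
  obtain ⟨φ, hφ⟩ := key a ha.le f₁ hf₁
  obtain ⟨ψ, hψ⟩ := key b hb.le f₂ hf₂
  obtain ⟨t, ht, h'⟩ := h φ ψ fun d => by
    rw [hφ, hψ, ← toDual_apply ω, ← hab]
    simp
  have e : a • f₁ = t • toDual ω := ContinuousLinearMap.ext fun d => by
    change a • f₁ d = t • ω d
    rw [Complex.real_smul, Complex.real_smul, ← hφ, h']
  have e' := congr_arg norm e
  rw [norm_smul, norm_smul, hf₁.2, h₁, mul_one, mul_one, Real.norm_of_nonneg ha.le,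
    Real.norm_of_nonneg ht] at e'
  rw [← e'] at e
  exact smul_right_injective _ ha.ne' e

lemma exists_vectorState {D K : Type*} [CStarAlgebra D] [PartialOrder D]
    [StarOrderedRing D] [NormedAddCommGroup K] [InnerProductSpace ℂ K] [CompleteSpace K]
    (κ : D →⋆ₐ[ℂ] (K →L[ℂ] K)) {η : K} (hη : ‖η‖ = 1) :
    ∃ ω : D →ₚ[ℂ] ℂ, (∀ d, ω d = ⟪η, κ d η⟫_ℂ) ∧ ‖toDual ω‖ = 1 := by
  have h1 : ∀ d, ⟪η, (1 : K →L[ℂ] K) ((κ : D →⋆ₙₐ[ℂ] (K →L[ℂ] K)) d η)⟫_ℂ = ⟪η, κ d η⟫_ℂ :=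
    fun d => rfl
  obtain ⟨ω, hω⟩ := exists_posLinearMap_of_comm (π := (κ : D →⋆ₙₐ[ℂ] (K →L[ℂ] K))) η
    (Q := 1) zero_le_one fun b v => rfl
  simp_rw [h1] at hω
  have hω1 : ω 1 = 1 := by
    rw [hω, map_one]
    change ⟪η, η⟫_ℂ = 1
    rw [inner_self_eq_norm_sq_to_K, hη]; simp
  refine ⟨ω, hω, le_antisymm ?_ ?_⟩
  · refine ContinuousLinearMap.opNorm_le_bound _ zero_le_one fun d => ?_
    rw [toDual_apply, hω, one_mul]
    refine (norm_inner_le_norm _ _).trans ?_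
    have := norm_rep_apply_le (κ : D →⋆ₙₐ[ℂ] (K →L[ℂ] K)) d η
    rw [hη, mul_one] at this
    rw [hη, one_mul]; exact this
  · have h2 := (toDual ω).le_opNorm 1
    rw [toDual_apply, hω1, norm_one] at h2
    have h3 : ‖(1 : D)‖ ≤ 1 := by
      have : Nontrivial D := ⟨1, 0, fun h => by simp [h] at hω1⟩
      rw [CStarRing.norm_one]
    nlinarith [norm_nonneg (toDual ω)]

/-- Purity of a vector state at a vector that comes from an irreducible representation of an
algebra of compressions. -/
lemma isPureState_of_compression {B D H L K : Type*} [NonUnitalCStarAlgebra B] [PartialOrder B]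
    [StarOrderedRing B] [CStarAlgebra D] [PartialOrder D] [StarOrderedRing D]
    [NormedAddCommGroup H] [InnerProductSpace ℂ H] [CompleteSpace H]
    [NormedAddCommGroup L] [InnerProductSpace ℂ L] [CompleteSpace L]
    [NormedAddCommGroup K] [InnerProductSpace ℂ K] [CompleteSpace K]
    {ω : B →ₚ[ℂ] ℂ} (hω : IsPureState ω) {π : B →⋆ₙₐ[ℂ] (H →L[ℂ] H)} (hπ : IsIrreducible π)
    {ξ : H} (hξ : ξ ≠ 0) (hωξ : ∀ b, ω b = ⟪ξ, π b ξ⟫_ℂ) {σ : B →⋆ₙₐ[ℂ] (L →L[ℂ] L)}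
    {J : H →ₗᵢ[ℂ] L} (hJ : ∀ b v, σ b (J v) = J (π b v)) {κ : D →⋆ₐ[ℂ] (K →L[ℂ] K)}
    {V : L →L[ℂ] K} {S : B →ₗ[ℂ] D}
    (hS : ∀ b, κ (S b) = V ∘L σ b ∘L ContinuousLinearMap.adjoint V)
    (hSpos : ∀ b, 0 ≤ S (star b * b))
    (hSmul : ∀ d, ∃ g, ContinuousLinearMap.adjoint V ∘L κ d ∘L V = σ g ∧
      ∀ b, star (S b) * d * S b = S (star b * g * b))
    {y : H} (hy0 : y ≠ 0) (hy : ContinuousLinearMap.adjoint V (V (J y)) = J y)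
    {Ω : D →ₚ[ℂ] ℂ} (hΩ : ∀ d, Ω d = ⟪V (J y), κ d (V (J y))⟫_ℂ) (hΩ1 : ‖toDual Ω‖ = 1) :
    IsPureState Ω := by
  -- `β` moves `y` to the vector `ξ` of the known pure state and `β'` moves it back. A functional
  -- below `Ω`, pulled back by `b ↦ S(β* b β)`, lies below `ω` and is a multiple of it.
  obtain ⟨β, hβ⟩ := hπ.exists_apply_eq hy0 ξ
  obtain ⟨β', hβ'⟩ := hπ.exists_apply_eq hξ y
  have hκS : ∀ b, κ (S b) (V (J y)) = V (J (π b y)) := fun b => by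
    rw [hS]
    change V (σ b (ContinuousLinearMap.adjoint V (V (J y)))) = _
    rw [hy, hJ]
  have hin : ∀ v, ⟪V (J y), V (J v)⟫_ℂ = ⟪y, v⟫_ℂ := fun v => by
    rw [← ContinuousLinearMap.adjoint_inner_left, hy, J.inner_map_map]
  have hcomp : ∀ χ : D →ₚ[ℂ] ℂ, ∃ χ' : B →ₚ[ℂ] ℂ, ∀ b, χ' b = χ (S (star β * b * β)) := fun χ => by
    let m : B →ₗ[ℂ] B := (LinearMap.mulLeft ℂ (star β)) ∘ₗ (LinearMap.mulRight ℂ β)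
    have hm : ∀ b, m b = star β * b * β := fun b => (mul_assoc _ _ _).symm
    refine ⟨PositiveLinearMap.mk₀ (χ.toLinearMap ∘ₗ S ∘ₗ m) fun b hb => ?_, fun b => ?_⟩
    · obtain ⟨a, rfl⟩ := CStarAlgebra.nonneg_iff_eq_star_mul_self.1 hb
      change 0 ≤ χ (S (m _))
      have : m (star a * a) = star (a * β) * (a * β) := by
        rw [hm, star_mul]; simp only [mul_assoc]
      rw [this]
      exact χ.map_nonneg (hSpos _)
    · change χ (S (m b)) = _
      rw [hm]
  refine isPureState_of_forall_add hΩ1 fun φ ψ hφψ => ?_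
  obtain ⟨φ', hφ'⟩ := hcomp φ
  obtain ⟨ψ', hψ'⟩ := hcomp ψ
  have hs := hω.eq_smul_of_add (φ := φ') (ψ := ψ') fun b => by
    rw [hφ', hψ', hφψ, hΩ, hκS, hin, hωξ, rep_mul_apply, hβ, rep_mul_apply, ← inner_rep_left, hβ]
  refine ⟨_, norm_nonneg (toDual φ'), fun d => ?_⟩
  obtain ⟨p, hp⟩ : ∃ p, p = β' * β := ⟨_, rfl⟩
  obtain ⟨g, hg1, hg2⟩ := hSmul d
  have hpy : κ (S p) (V (J y)) = V (J y) := by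
    rw [hκS, hp, rep_mul_apply, hβ, hβ']
  -- `S p` fixes the vector of `Ω`, so `1 - S p` is null for `Ω` and for every `φ` below it. Then
  -- `φ(d) = φ(S(p)* d S(p))`, which depends only on the compression of `d` to `B`.
  have hzero : φ (star (1 - S p) * (1 - S p)) = 0 := by
    have h1 : Ω (star (1 - S p) * (1 - S p)) = 0 := by
      rw [hΩ, map_mul]
      change ⟪V (J y), κ (star (1 - S p)) (κ (1 - S p) (V (J y)))⟫_ℂ = 0
      rw [map_sub κ, map_one, _root_.sub_apply, hpy]
      simp
    have h2 := hφψ (star (1 - S p) * (1 - S p))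
    rw [h1] at h2
    have h3 := φ.map_nonneg (star_mul_self_nonneg (1 - S p))
    have h4 := ψ.map_nonneg (star_mul_self_nonneg (1 - S p))
    exact le_antisymm (h2 ▸ le_add_of_nonneg_right h4) h3
  have hright : ∀ d, φ (d * (1 - S p)) = 0 := fun d => by
    have := norm_apply_star_mul_le φ (star d) (1 - S p)
    rw [hzero, star_star, Complex.zero_re, mul_zero] at this
    exact norm_eq_zero.1 (pow_eq_zero_iff two_ne_zero |>.1 (le_antisymm this (by positivity)))
  have hleft : ∀ d, φ (star (1 - S p) * d) = 0 := fun d => by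
    have := norm_apply_star_mul_le φ (1 - S p) d
    rw [hzero, Complex.zero_re, zero_mul] at this
    exact norm_eq_zero.1 (pow_eq_zero_iff two_ne_zero |>.1 (le_antisymm this (by positivity)))
  have h1 : φ d = φ (star (S p) * d * S p) := by
    have e : d = star (S p) * d * S p + (star (1 - S p) * (d * S p) + d * (1 - S p)) := by
      rw [star_sub, star_one]; noncomm_ring
    conv_lhs => rw [e, map_add, map_add, hright, hleft, add_zero, add_zero]
  have h2 : star p * g * p = star β * (star β' * g * β') * β := by
    rw [hp, star_mul]; simp only [mul_assoc]
  rw [h1, hg2, h2, ← hφ', hs, hωξ, hΩ, rep_mul_apply, hβ', rep_mul_apply, ← inner_rep_left, hβ']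
  congr 1
  have h3 := congr_arg (fun T => T (J y)) hg1
  change ContinuousLinearMap.adjoint V (κ d (V (J y))) = σ g (J y) at h3
  rw [← ContinuousLinearMap.adjoint_inner_right, h3, hJ, J.inner_map_map]

end Transport

/-! ### Corners of hereditary subalgebras -/

section Hereditary
variable {A : Type*} [NonUnitalCStarAlgebra A]

/-- The inclusion of a subalgebra in the unitization of the algebra. -/
noncomputable def inclUnitization (A₁ : NonUnitalStarSubalgebra ℂ A) :
    A₁ →⋆ₙₐ[ℂ] Unitization ℂ A :=
  (Unitization.inrNonUnitalStarAlgHom ℂ A).comp (NonUnitalStarSubalgebraClass.subtype A₁)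

lemma inclUnitization_apply (A₁ : NonUnitalStarSubalgebra ℂ A) (x : A₁) :
    inclUnitization A₁ x = ((x : A) : Unitization ℂ A) := rfl

lemma inclUnitization_injective (A₁ : NonUnitalStarSubalgebra ℂ A) :
    Function.Injective (inclUnitization A₁) := fun _ _ h =>
  Subtype.ext (Unitization.inr_injective h)

/-- For positive `x` one has `0 ≤ c x c ≤ ‖x‖ c²`; a general element is a combination of four
positive ones. -/
lemma IsHereditary.conjugate_mem [PartialOrder A] [StarOrderedRing A]
    {A₁ : NonUnitalStarSubalgebra ℂ A} (hA₁ : IsHereditary A₁) {c : A} (hc : c ∈ A₁)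
    (hsa : IsSelfAdjoint c) (a : A) : c * a * c ∈ A₁ := by
  have key : ∀ x : A, 0 ≤ x → c * x * c ∈ A₁ := fun x hx => by
    refine hA₁ _ (‖x‖ • (c * c)) (hsa.conjugate_nonneg hx) ?_ ?_
    · have := CStarAlgebra.star_left_conjugate_le_norm_smul (a := c) (b := x)
        (hb := IsSelfAdjoint.of_nonneg hx)
      rw [hsa.star_eq] at this
      exact this
    · rw [← Complex.coe_smul]
      exact SMulMemClass.smul_mem _ (mul_mem hc hc)
  obtain ⟨x, hx, -, h⟩ := CStarAlgebra.exists_sum_four_nonneg a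
  rw [h, Finset.mul_sum, Finset.sum_mul]
  refine sum_mem fun i _ => ?_
  rw [mul_smul_comm, smul_mul_assoc]
  exact SMulMemClass.smul_mem _ (key _ (hx i))

lemma IsHereditary.exists_corner [PartialOrder A] [StarOrderedRing A]
    {A₁ : NonUnitalStarSubalgebra ℂ A} (hA₁ : IsHereditary A₁) {c : A₁}
    (hsa : IsSelfAdjoint c) (a : Unitization ℂ A) :
    ∃ y, inclUnitization A₁ y = inclUnitization A₁ c * a * inclUnitization A₁ c := by
  have hsa' : IsSelfAdjoint (c : A) := congr_arg Subtype.val hsa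
  refine ⟨a.fst • (c * c) + ⟨_, hA₁.conjugate_mem c.2 hsa' a.snd⟩, ?_⟩
  conv_rhs => rw [← Unitization.inl_fst_add_inr_snd_eq a]
  rw [mul_add, add_mul, map_add, map_smul, map_mul]
  congr 1
  · rw [← Unitization.algebraMap_eq_inl, Algebra.algebraMap_eq_smul_one, mul_smul_comm, mul_one,
      smul_mul_assoc]
  · simp only [inclUnitization_apply, Unitization.inr_mul]

/-- A unital `D` is a quotient of its unitization by a homomorphism that is the identity on `D`. It
sends `w` to a unitary of `D` with the same inner action. -/
lemma exists_unitary_of_unitization {D : Type*} [CStarAlgebra D] {w : Unitization ℂ D}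
    (hw : w ∈ unitary (Unitization ℂ D)) :
    ∃ U ∈ unitary D, ∀ x, Ad w x = U * x * star U := by
  let τ : Unitization ℂ D →⋆ₐ[ℂ] D := Unitization.starLift (NonUnitalStarAlgHom.id ℂ D)
  have hτ : ∀ x : D, τ x = x := fun x =>
    DFunLike.congr_fun (Unitization.starLift.symm_apply_apply (NonUnitalStarAlgHom.id ℂ D)) x
  refine ⟨τ w, ?_, fun x => ?_⟩
  · rw [Unitary.mem_iff] at hw ⊢
    rw [← map_star, ← map_mul, ← map_mul, hw.1, hw.2, map_one]
    exact ⟨rfl, rfl⟩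
  · have h : (((w * (x : Unitization ℂ D) * star w).snd : D) : Unitization ℂ D) =
        w * (x : Unitization ℂ D) * star w := by
      ext <;> simp
    rw [← hτ (Ad w x), Ad, h, map_mul, map_mul, hτ, map_star]

end Hereditary

/-! ### The property of `A` applied to the dilation -/

section Application
open ContinuousLinearMap
universe u
variable {A : Type u} [NonUnitalCStarAlgebra A]

/-- The positive map `b ↦ V σ(b) V*` into an algebra of operators that are compressed to `σ`. -/
lemma exists_compression_map {B L K E : Type*} [NonUnitalCStarAlgebra B]
    [NormedAddCommGroup L] [InnerProductSpace ℂ L] [CompleteSpace L]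
    [NormedAddCommGroup K] [InnerProductSpace ℂ K] [CompleteSpace K] [CStarAlgebra E]
    {σ : B →⋆ₙₐ[ℂ] (L →L[ℂ] L)} {V : L →L[ℂ] K} (R : StarSubalgebra ℂ (K →L[ℂ] K))
    [IsClosed (R : Set (K →L[ℂ] K))] (hmem : ∀ b, V ∘L σ b ∘L adjoint V ∈ R)
    (hcomp : ∀ T ∈ R, ∃ g, adjoint V ∘L T ∘L V = σ g) :
    ∃ S : B →ₗ[ℂ] R × E, (∀ b, ((S b).1 : K →L[ℂ] K) = V ∘L σ b ∘L adjoint V) ∧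
      (∀ b, ∃ x, S (star b * b) = star x * x) ∧
      ∀ d : R × E, ∃ g, adjoint V ∘L (d.1 : K →L[ℂ] K) ∘L V = σ g ∧
        ∀ b, star (S b) * d * S b = S (star b * g * b) := by
  let S₀ : B →ₗ[ℂ] R :=
    { toFun := fun b => ⟨_, hmem b⟩
      map_add' := fun a b => Subtype.ext (by
        change V ∘L σ (a + b) ∘L adjoint V = V ∘L σ a ∘L adjoint V + V ∘L σ b ∘L adjoint V
        rw [map_add, add_comp, comp_add])
      map_smul' := fun t a => Subtype.ext (by
        change V ∘L σ (t • a) ∘L adjoint V = t • (V ∘L σ a ∘L adjoint V)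
        rw [map_smul, smul_comp, comp_smul]) }
  have hS₀ : ∀ b, (S₀ b : K →L[ℂ] K) = V ∘L σ b ∘L adjoint V := fun b => rfl
  have hS₁ : ∀ b, LinearMap.prod S₀ (0 : B →ₗ[ℂ] E) b = (S₀ b, 0) := fun b => rfl
  refine ⟨S₀.prod 0, hS₀, fun b => ?_, fun d => ?_⟩
  · have hp : 0 ≤ R.subtype (S₀ (star b * b)) := by
      change 0 ≤ (S₀ (star b * b) : K →L[ℂ] K)
      have : V ∘L σ (star b * b) ∘L adjoint V =
          adjoint (σ b ∘L adjoint V) ∘L (σ b ∘L adjoint V) := by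
        rw [adjoint_comp, adjoint_adjoint, map_mul, map_star, star_eq_adjoint]
        rfl
      rw [hS₀, this, nonneg_iff_isPositive]
      exact isPositive_adjoint_comp_self _
    obtain ⟨y, hy⟩ := exists_eq_star_mul_self_of_map_nonneg
      (a := S₀ (star b * b)) (R.subtype : R →⋆ₙₐ[ℂ] (K →L[ℂ] K)) Subtype.val_injective hp
    exact ⟨(y, 0), by rw [hS₁]; exact Prod.ext hy (by simp)⟩
  · obtain ⟨g, hg⟩ := hcomp d.1 d.1.2
    refine ⟨g, hg, fun b => ?_⟩
    rw [hS₁, hS₁]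
    refine Prod.ext (Subtype.ext ?_) (by simp)
    change star (V ∘L σ b ∘L adjoint V) * (d.1 : K →L[ℂ] K) *
      (V ∘L σ b ∘L adjoint V) = V ∘L σ (star b * g * b) ∘L adjoint V
    rw [map_mul, map_mul, ← hg, map_star, star_eq_adjoint, star_eq_adjoint, adjoint_comp,
      adjoint_comp, adjoint_adjoint]
    rfl

/-- The property of an algebra for vector states at vectors that come from an irreducible
representation of an algebra of compressions. -/
lemma exists_unitary_of_compression {C : ℝ} (hA : HasPathProperty A C)
    (F : Finset A) {ε : ℝ} (hε : 0 < ε) : ∃ (G : Finset A) (δ : ℝ), 0 < δ ∧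
    ∀ (B : Type u) [NonUnitalCStarAlgebra B] [PartialOrder B] [StarOrderedRing B]
      (D : Type u) [CStarAlgebra D] (H L K : Type u) [NormedAddCommGroup H]
      [InnerProductSpace ℂ H] [CompleteSpace H] [NormedAddCommGroup L]
      [InnerProductSpace ℂ L] [CompleteSpace L] [NormedAddCommGroup K]
      [InnerProductSpace ℂ K] [CompleteSpace K] (ω : B →ₚ[ℂ] ℂ) (π : B →⋆ₙₐ[ℂ] (H →L[ℂ] H))
      (ξ : H) (σ : B →⋆ₙₐ[ℂ] (L →L[ℂ] L)) (J : H →ₗᵢ[ℂ] L) (κ : D →⋆ₐ[ℂ] (K →L[ℂ] K))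
      (V : L →L[ℂ] K) (S : B →ₗ[ℂ] D) (i : A →⋆ₙₐ[ℂ] D) (y₁ y₂ : H),
      IsPureState ω → IsIrreducible π → ξ ≠ 0 → (∀ b, ω b = ⟪ξ, π b ξ⟫_ℂ) →
      (∀ b v, σ b (J v) = J (π b v)) → (∀ b, κ (S b) = V ∘L σ b ∘L adjoint V) →
      (∀ b, ∃ x, S (star b * b) = star x * x) →
      (∀ d, ∃ g, adjoint V ∘L κ d ∘L V = σ g ∧ ∀ b, star (S b) * d * S b = S (star b * g * b)) →
      Function.Injective i → ‖y₁‖ = 1 → ‖y₂‖ = 1 → adjoint V (V (J y₁)) = J y₁ →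
      adjoint V (V (J y₂)) = J y₂ →
      (∀ g ∈ G, ‖⟪V (J y₁), κ (i g) (V (J y₁))⟫_ℂ - ⟪V (J y₂), κ (i g) (V (J y₂))⟫_ℂ‖ < δ) →
      ∃ W ∈ unitary (K →L[ℂ] K), W ∈ Set.range κ ∧
        (∀ x ∈ F, ‖W * κ (i x) - κ (i x) * W‖ ≤ ε) ∧ ∀ d,
        ⟪V (J y₁), κ d (V (J y₁))⟫_ℂ = ⟪W (V (J y₂)), κ d (W (V (J y₂)))⟫_ℂ := by
  obtain ⟨G, δ, hδ, h⟩ := hA F ε hε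
  refine ⟨G, δ, hδ, fun B _ _ _ D _ H L K _ _ _ _ _ _ _ _ _ ω π ξ σ J κ V S i y₁ y₂ hω hπ hξ
    hωξ hJ hS hSpos' hSmul hi hy₁ hy₂ hfix₁ hfix₂ hG => ?_⟩
  let := CStarAlgebra.spectralOrder D
  have := CStarAlgebra.spectralOrderedRing D
  have hSpos : ∀ b, 0 ≤ S (star b * b) := fun b =>
    CStarAlgebra.nonneg_iff_eq_star_mul_self.2 (hSpos' b)
  have hnorm : ∀ y, ‖y‖ = 1 → adjoint V (V (J y)) = J y → ‖V (J y)‖ = 1 := fun y hy hcy => by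
    have h1 : ⟪V (J y), V (J y)⟫_ℂ = 1 := by
      rw [← adjoint_inner_right, hcy, J.inner_map_map, inner_self_eq_norm_sq_to_K, hy]
      simp
    rw [@norm_eq_sqrt_re_inner ℂ, h1]
    simp
  obtain ⟨Ω₁, hΩ₁, hn₁⟩ := exists_vectorState κ (hnorm y₁ hy₁ hfix₁)
  obtain ⟨Ω₂, hΩ₂, hn₂⟩ := exists_vectorState κ (hnorm y₂ hy₂ hfix₂)
  have hy₁0 : y₁ ≠ 0 := by rw [← norm_ne_zero_iff, hy₁]; exact one_ne_zero
  have hy₂0 : y₂ ≠ 0 := by rw [← norm_ne_zero_iff, hy₂]; exact one_ne_zero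
  have hpure₁ : IsPureState Ω₁ := isPureState_of_compression hω hπ hξ hωξ hJ hS hSpos hSmul
    hy₁0 hfix₁ hΩ₁ hn₁
  have hpure₂ : IsPureState Ω₂ := isPureState_of_compression hω hπ hξ hωξ hJ hS hSpos hSmul
    hy₂0 hfix₂ hΩ₂ hn₂
  have hκS : ∀ y, adjoint V (V (J y)) = J y → ∀ b, κ (S b) (V (J y)) = V (J (π b y)) :=
    fun y hy b => by
    rw [hS]
    change V (σ b (adjoint V (V (J y)))) = _
    rw [hy, hJ]
  obtain ⟨b₁, hb₁⟩ := hπ.exists_apply_eq hy₁0 y₂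
  obtain ⟨b₂, hb₂⟩ := hπ.exists_apply_eq hy₂0 y₁
  have hequiv : GNSEquivalent Ω₁ Ω₂ :=
    gnsEquivalent_of_vectors (κ : D →⋆ₙₐ[ℂ] (K →L[ℂ] K)) (η₁ := V (J y₁)) (η₂ := V (J y₂))
      hΩ₁ hΩ₂ (q₁ := S b₁) (q₂ := S b₂) (by
        change κ (S b₁) (V (J y₁)) = _
        rw [hκS y₁ hfix₁, hb₁]) (by
        change κ (S b₂) (V (J y₂)) = _
        rw [hκS y₂ hfix₂, hb₂])
  -- Continuity and length of the path are discarded, so the tolerance `1` for the length is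
  -- arbitrary. The unitary sought is the adjoint of the endpoint.
  obtain ⟨w, -, hw, -, hwe, -, hwF⟩ := h D i hi Ω₁ Ω₂ hpure₁ hpure₂ hequiv (fun g hg => by
    rw [hΩ₁, hΩ₂]
    exact hG g hg) 1 one_pos
  obtain ⟨U, hU, hUw⟩ := exists_unitary_of_unitization (hw 1 (by simp)).1
  have hκU : κ U ∈ unitary (K →L[ℂ] K) := by
    rw [Unitary.mem_iff] at hU ⊢
    rw [← map_star, ← map_mul, ← map_mul, hU.1, hU.2, map_one]
    exact ⟨rfl, rfl⟩
  refine ⟨star (κ U), Unitary.star_mem hκU, ⟨star U, map_star κ U⟩, fun x hx => ?_, fun d => ?_⟩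
  · have h1 := (hwF x hx 1 (by simp)).le
    rw [hUw] at h1
    have h3 : star (κ U) * κ (i x) - κ (i x) * star (κ U) =
        star (κ U) * κ (i x - U * i x * star U) := by
      rw [map_sub, map_mul, map_mul, map_star, mul_sub, ← mul_assoc, ← mul_assoc,
        (Unitary.mem_iff.1 hκU).1, one_mul]
    rw [h3]
    refine (norm_mul_le_right (norm_le_one_of_mem_unitary (Unitary.star_mem hκU))).trans ?_
    refine (NonUnitalStarAlgHom.norm_apply_le (κ : D →⋆ₙₐ[ℂ] (K →L[ℂ] K)) _).trans ?_
    rwa [norm_sub_rev]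
  · have h1 := hwe d
    rw [hUw, hΩ₁, hΩ₂, map_mul, map_mul, map_star] at h1
    change _ = ⟪V (J y₂), κ U (κ d (star (κ U) (V (J y₂))))⟫_ℂ at h1
    rw [h1, star_eq_adjoint, adjoint_inner_left]

/-- The property of an algebra applied to the dilation of the corner of a hereditary subalgebra. -/
lemma exists_unitary_dilation [PartialOrder A] [StarOrderedRing A] {C : ℝ} (hA : HasPathProperty A C)
    {A₁ : NonUnitalStarSubalgebra ℂ A} [IsClosed (A₁ : Set A)] (hA₁ : IsHereditary A₁)
    (F : Finset A) {ε : ℝ} (hε : 0 < ε) : ∃ (G : Finset A) (δ : ℝ), 0 < δ ∧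
    ∀ (B : Type u) [NonUnitalCStarAlgebra B] [PartialOrder B] [StarOrderedRing B]
      (ι : A₁ →⋆ₙₐ[ℂ] B) (ω : B →ₚ[ℂ] ℂ) (H : Type u) [NormedAddCommGroup H]
      [InnerProductSpace ℂ H] [CompleteSpace H] (π : B →⋆ₙₐ[ℂ] (H →L[ℂ] H)) (ξ : H)
      (J : H →ₗᵢ[ℂ] UnivSpace B) (c : A₁) (y₁ y₂ : H),
      IsPureState ω → IsIrreducible π → ξ ≠ 0 → (∀ b, ω b = ⟪ξ, π b ξ⟫_ℂ) →
      (∀ b v, univRep B b (J v) = J (π b v)) → IsSelfAdjoint c →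
      ‖y₁‖ = 1 → ‖y₂‖ = 1 → π (ι c) y₁ = y₁ → π (ι c) y₂ = y₂ →
      (∀ g ∈ G, ∀ x : A₁, (x : A) = c * g * c →
        ‖⟪y₁, π (ι x) y₁⟫_ℂ - ⟪y₂, π (ι x) y₂⟫_ℂ‖ < δ) →
      ∃ (K : Type u) (_ : NormedAddCommGroup K) (_ : InnerProductSpace ℂ K)
        (_ : CompleteSpace K) (D : CornerDilation (univRep B) ι (inclUnitization A₁) c K)
        (W : K →L[ℂ] K), W ∈ adjointableOps (univRep B) D.V ∧ W ∈ unitary (K →L[ℂ] K) ∧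
        (∀ x ∈ F, ‖W * D.ρ (x : Unitization ℂ A) - D.ρ (x : Unitization ℂ A) * W‖ ≤ ε) ∧
        ∀ T ∈ adjointableOps (univRep B) D.V,
          ⟪D.V 1 (J y₁), T (D.V 1 (J y₁))⟫_ℂ = ⟪W (D.V 1 (J y₂)), T (W (D.V 1 (J y₂)))⟫_ℂ := by
  obtain ⟨G, δ, hδ, h⟩ := exists_unitary_of_compression hA F hε
  refine ⟨G, δ, hδ, fun B _ _ _ ι ω H _ _ _ π ξ J c y₁ y₂ hω hπ hωξ hξ hJ hc hy₁ hy₂ hcy₁ hcy₂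
    hG => ?_⟩
  have hj := inclUnitization_injective A₁
  obtain ⟨K, i₁, i₂, i₃, ⟨D⟩⟩ := exists_cornerDilation (univRep B) ι (inclUnitization A₁) hj hc
    (hA₁.exists_corner hc)
  have hcl : IsClosed (adjointableOps (univRep B) D.V : Set (K →L[ℂ] K)) :=
    isClosed_adjointableOps univRep_injective
  let R := adjointableOps (univRep B) D.V
  let ρ' : Unitization ℂ A →⋆ₐ[ℂ] R := D.ρ.codRestrict R D.ρ_mem
  let κ : R × Unitization ℂ A →⋆ₐ[ℂ] (K →L[ℂ] K) :=
    R.subtype.comp (StarAlgHom.fst ℂ R (Unitization ℂ A))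
  -- `ρ` need not be injective. The second factor makes the embedding of `A` faithful, and `κ`
  -- ignores it.
  let i : A →⋆ₙₐ[ℂ] R × Unitization ℂ A :=
    (NonUnitalStarAlgHom.prod (ρ' : Unitization ℂ A →⋆ₙₐ[ℂ] R)
      (NonUnitalStarAlgHom.id ℂ _)).comp (Unitization.inrNonUnitalStarAlgHom ℂ A)
  have hi_inj : Function.Injective i := fun a b hab =>
    Unitization.inr_injective (congr_arg Prod.snd hab)
  obtain ⟨S, hS, hSpos, hSmul⟩ := exists_compression_map (σ := univRep B) (V := D.V 1)
    (E := Unitization ℂ A) R (fun b => comp_rep_comp_adjoint_mem (D.V_mem 1) (D.V_mem 1) b)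
    fun T hT => exists_rep_eq_compression (x := 1) (D.V_mem 1) hT
  have hfix : ∀ y, π (ι c) y = y → adjoint (D.V 1) (D.V 1 (J y)) = J y := fun y hy => by
    rw [D.adjoint_V_V_one hj, hJ, map_mul, rep_mul_apply, hy, hy]
  have hval : ∀ (y : H) (a : A), π (ι c) y = y →
      ⟪D.V 1 (J y), κ (i a) (D.V 1 (J y))⟫_ℂ = ⟪y, π (ι (D.γ (a : Unitization ℂ A))) y⟫_ℂ :=
    fun y a hy => by
    change ⟪D.V 1 (J y), D.ρ (a : Unitization ℂ A) (D.V 1 (J y))⟫_ℂ = _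
    rw [D.ρ_V, D.inner_V, star_one, one_mul, mul_one, hJ, J.inner_map_map]
  obtain ⟨W, hW, ⟨d, hd⟩, hWF, hWe⟩ := h B (R × Unitization ℂ A) H (UnivSpace B) K ω π ξ
    (univRep B) J κ (D.V 1) S i y₁ y₂ hω hπ hωξ hξ hJ hS hSpos hSmul hi_inj hy₁ hy₂
    (hfix y₁ hcy₁) (hfix y₂ hcy₂) (fun g hg => by
      rw [hval _ _ hcy₁, hval _ _ hcy₂]
      refine hG g hg _ ?_
      have := D.map_γ (g : Unitization ℂ A)
      simp only [inclUnitization_apply, ← Unitization.inr_mul] at this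
      exact Unitization.inr_injective this)
  exact ⟨K, i₁, i₂, i₃, D, W, hd ▸ d.1.2, hW, hWF, fun T hT => hWe (⟨T, hT⟩, 0)⟩

end Application

/-! ### Compression of generators from the dilation to `B` -/

namespace CornerDilation
open ContinuousLinearMap
variable {A₁ E B H K : Type*} [NonUnitalCStarAlgebra A₁]
  [CStarAlgebra E] [NonUnitalCStarAlgebra B] [NormedAddCommGroup H] [InnerProductSpace ℂ H]
  [CompleteSpace H] [NormedAddCommGroup K] [InnerProductSpace ℂ K] [CompleteSpace K]
  {π : B →⋆ₙₐ[ℂ] (H →L[ℂ] H)} {ι : A₁ →⋆ₙₐ[ℂ] B} {j : A₁ →⋆ₙₐ[ℂ] E} {c : A₁}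
  (D : CornerDilation π ι j c K) (hj : Function.Injective j)
include D hj

lemma rep_adjoint_V_one {e : A₁} (he : e * c = c) (z : K) :
    π (ι e) (adjoint (D.V 1) z) = adjoint (D.V 1) z := by
  have : π (ι e) ∘L adjoint (D.V 1) = adjoint (D.V 1) := by
    refine ext_of_span_dense D.dense_V fun y v => ?_
    change π (ι e) (adjoint (D.V 1) (D.V y v)) = adjoint (D.V 1) (D.V y v)
    rw [D.adjoint_V_V, ← rep_mul_apply, ← map_mul]
    congr 4
    refine hj ?_
    rw [map_mul j, D.map_γ, ← mul_assoc, ← mul_assoc, ← map_mul, he]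
  exact congr_arg (fun T => T z) this

lemma norm_V_one_le (hc : ‖c‖ ≤ 1) (v : H) : ‖D.V 1 v‖ ≤ ‖v‖ := by
  have h1 : ‖D.V 1 v‖ ^ 2 = RCLike.re ⟪v, π (ι (c * c)) v⟫_ℂ := by
    rw [← D.adjoint_V_V_one hj, adjoint_inner_right, inner_self_eq_norm_sq]
  have h2 : ‖π (ι (c * c)) v‖ ≤ ‖v‖ := by
    refine (norm_rep_apply_le π _ v).trans (mul_le_of_le_one_left (norm_nonneg _) ?_)
    refine (NonUnitalStarAlgHom.norm_apply_le ι _).trans ((norm_mul_le _ _).trans ?_)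
    exact mul_le_one₀ hc (norm_nonneg _) hc
  refine (pow_le_pow_iff_left₀ (norm_nonneg _) (norm_nonneg _) two_ne_zero).1 ?_
  rw [h1, sq]
  exact (re_inner_le_norm _ _).trans (by gcongr)

lemma norm_adjoint_V_one_le (hc : ‖c‖ ≤ 1) (z : K) : ‖adjoint (D.V 1) z‖ ≤ ‖z‖ := by
  refine ((adjoint (D.V 1)).le_opNorm z).trans (mul_le_of_le_one_left (norm_nonneg _) ?_)
  rw [LinearIsometryEquiv.norm_map]
  exact opNorm_le_bound _ zero_le_one fun v => by rw [one_mul]; exact D.norm_V_one_le hj hc v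

/-- Compression of a self-adjoint operator of the dilation. -/
lemma exists_compression (hπ : Function.Injective π) (hc : IsSelfAdjoint c) (hc1 : ‖c‖ ≤ 1)
    {h : K →L[ℂ] K} (hh : h ∈ adjointableOps π D.V) (hsa : IsSelfAdjoint h) :
    ∃ k : B, IsSelfAdjoint k ∧ ‖k‖ ≤ ‖h‖ ∧ (∀ e : A₁, e * c = c → ι e * k = k) ∧
      (∀ x : A₁, c * x = x → x * c = x →
        ‖k * ι x - ι x * k‖ ≤ ‖h * D.ρ (j x) - D.ρ (j x) * h‖) ∧
      ∀ d : A₁, IsSelfAdjoint d → c * d = d → ∀ y, π (ι d) y = y →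
        ‖adjoint (D.V 1) (uexp h (D.V 1 y)) - uexp (π k) y‖ ≤
          2 * ‖h‖ * ‖h * D.ρ (j d) - D.ρ (j d) * h‖ * ‖y‖ := by
  obtain ⟨k, hk⟩ := exists_rep_eq_compression (x := 1) (D.V_mem 1) hh
  have hka : ∀ v, π k v = adjoint (D.V 1) (h (D.V 1 v)) := fun v => by rw [← hk]; rfl
  have hksa : IsSelfAdjoint k := by
    refine hπ ?_
    rw [map_star, ← hk, star_eq_adjoint, adjoint_comp, adjoint_comp, adjoint_adjoint,
      ← star_eq_adjoint, hsa.star_eq, comp_assoc]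
  refine ⟨k, hksa, ?_, fun e he => ?_, fun x h₁ h₂ => ?_, fun d hd hcd y hy => ?_⟩
  · rw [← NonUnitalStarAlgHom.norm_map π hπ]
    refine opNorm_le_bound _ (norm_nonneg _) fun v => ?_
    rw [hka]
    refine (D.norm_adjoint_V_one_le hj hc1 _).trans ((h.le_opNorm _).trans ?_)
    gcongr
    exact D.norm_V_one_le hj hc1 v
  · refine hπ (ContinuousLinearMap.ext fun v => ?_)
    rw [rep_mul_apply, hka, D.rep_adjoint_V_one hj he]
  · rw [← NonUnitalStarAlgHom.norm_map π hπ]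
    refine opNorm_le_bound _ (norm_nonneg _) fun v => ?_
    rw [map_sub, _root_.sub_apply, rep_mul_apply, rep_mul_apply, hka, hka,
      ← D.ρ_V_one hj h₁ h₂, ← D.adjoint_V_one_ρ hj h₁ h₂ hc, ← map_sub]
    refine (D.norm_adjoint_V_one_le hj hc1 _).trans ?_
    exact ((h * D.ρ (j x) - D.ρ (j x) * h).le_opNorm _).trans (by
      gcongr
      exact D.norm_V_one_le hj hc1 v)
  · have hdc : d * c = d := by rw [← hc.star_eq, ← hd.star_eq, ← star_mul, hcd]
    have hρ : D.ρ (j d) (D.V 1 y) = D.V 1 y := by rw [D.ρ_V_one hj hcd hdc, hy]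
    have hcc : adjoint (D.V 1) (D.V 1 y) = y := by
      have h1 : c * c * d = d := by rw [mul_assoc, hcd, hcd]
      rw [D.adjoint_V_V_one hj]
      conv_lhs => rw [← hy]
      rw [← rep_mul_apply, ← map_mul, h1, hy]
    have hπk : IsSelfAdjoint (π k) := by
      rw [isSelfAdjoint_iff, ← map_star, hksa.star_eq]
    -- With `X = V₁*` the defect is `X h - k X = X h (1 - V₁ V₁*)`. It is small along the orbit
    -- `exp(ish) V₁ y`, whose vectors are nearly fixed by `ρ(d)` because `h` almost commutes with
    -- `ρ(d)`.
    have key := norm_intertwine_uexp_sub_le (T := h) hπk (adjoint (D.V 1)) (D.V 1 y)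
      (2 * ‖h‖ * ‖h * D.ρ (j d) - D.ρ (j d) * h‖ * ‖y‖) fun s hs => ?_
    · rwa [hcc] at key
    obtain ⟨w, hw⟩ : ∃ w, w = uexp (s • h) (D.V 1 y) := ⟨_, rfl⟩
    obtain ⟨q, hq⟩ : ∃ q, q = uexp (s • h) (D.ρ (j d) (D.V 1 y)) -
      D.ρ (j d) (uexp (s • h) (D.V 1 y)) := ⟨_, rfl⟩
    have hwq : w = D.ρ (j d) w + q := by rw [hq, hw, hρ]; abel
    have hsh : IsSelfAdjoint (s • h) := IsSelfAdjoint.real_smul hsa s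
    have hqn : ‖q‖ ≤ ‖h * D.ρ (j d) - D.ρ (j d) * h‖ * ‖y‖ := by
      have h1 := norm_uexp_commutator_le hsh (D.ρ (j d))
      have h2 : ‖s • h * D.ρ (j d) - D.ρ (j d) * (s • h)‖ ≤
          ‖h * D.ρ (j d) - D.ρ (j d) * h‖ := by
        rw [smul_mul_assoc, mul_smul_comm, ← smul_sub, norm_smul, Real.norm_of_nonneg hs.1]
        exact mul_le_of_le_one_left (norm_nonneg _) hs.2
      rw [hq]
      refine ((uexp (s • h) * D.ρ (j d) - D.ρ (j d) * uexp (s • h)).le_opNorm (D.V 1 y)).trans ?_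
      gcongr
      · exact h1.trans h2
      · exact D.norm_V_one_le hj hc1 y
    have hdiff : w - D.V 1 (adjoint (D.V 1) w) = q - D.V 1 (adjoint (D.V 1) q) := by
      conv_lhs => rw [hwq, map_add, map_add, D.V_one_adjoint_ρ hj hc hd hcd]
      abel
    rw [← hw, hka, ← map_sub, ← map_sub, hdiff]
    refine (D.norm_adjoint_V_one_le hj hc1 _).trans ((h.le_opNorm _).trans ?_)
    have h3 : ‖q - D.V 1 (adjoint (D.V 1) q)‖ ≤ 2 * ‖q‖ := by
      refine (norm_sub_le _ _).trans ?_
      have := (D.norm_V_one_le hj hc1 _).trans (D.norm_adjoint_V_one_le hj hc1 q)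
      linarith
    calc ‖h‖ * ‖q - D.V 1 (adjoint (D.V 1) q)‖ ≤ ‖h‖ * (2 * ‖q‖) := by gcongr
      _ ≤ ‖h‖ * (2 * (‖h * D.ρ (j d) - D.ρ (j d) * h‖ * ‖y‖)) := by gcongr
      _ = _ := by ring

end CornerDilation

/-! ### Commutators and membership for truncated logarithms -/

section TruncLog

lemma exists_commutator_truncLog_lt {c s : ℝ} (hc : c ≤ 1) (hs : 0 < s) (S : Finset ℂ)
    (hS : ∀ l ∈ S, l ∈ Metric.sphere (0 : ℂ) 1) {ε : ℝ} (hε : 0 < ε) (R : ℝ) :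
    ∃ δ : ℝ, 0 < δ ∧ ∀ (E : Type*) [CStarAlgebra E] (W x : E), W ∈ unitary E → ‖x‖ ≤ R →
      ‖W * x - x * W‖ ≤ δ → ∀ l ∈ S,
        ‖truncLog c s l W * x - x * truncLog c s l W‖ ≤ ε := by
  classical
  induction S using Finset.induction_on with
  | empty => exact ⟨1, one_pos, by simp⟩
  | insert l S _ ih =>
    obtain ⟨δ₁, hδ₁, h₁⟩ := ih fun l hl => hS l (Finset.mem_insert_of_mem hl)
    have hl := hS l (Finset.mem_insert_self l S)
    let f : C(Metric.sphere (0 : ℂ) 1, ℂ) := ⟨fun z => (truncArg c s (l * z) : ℂ), by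
      exact Complex.continuous_ofReal.comp
        (continuousOn_iff_continuous_domRestrict.1 (continuousOn_truncArg_mul hc hs hl))⟩
    obtain ⟨δ₂, hδ₂, h₂⟩ := exists_commutator_cfc_lt f
      (fun z => (truncArg c s (l * z) : ℂ)) (fun z => rfl) ε hε R
    refine ⟨min δ₁ δ₂, lt_min hδ₁ hδ₂, fun E _ W x hW hx hWx l' hl' => ?_⟩
    rcases Finset.mem_insert.1 hl' with rfl | hl'
    · exact h₂ E W x hW hx (hWx.trans (min_le_right _ _))
    · exact h₁ E W x hW hx (hWx.trans (min_le_left _ _)) l' hl'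

lemma truncLog_mem {c s : ℝ} (hc : c ≤ 1) (hs : 0 < s) {l : ℂ}
    (hl : l ∈ Metric.sphere (0 : ℂ) 1) {E : Type*} [CStarAlgebra E] (R : StarSubalgebra ℂ E)
    [IsClosed (R : Set E)] {W : E} (hW : W ∈ unitary E) (hWR : W ∈ R) : truncLog c s l W ∈ R := by
  have hW' : (⟨W, hWR⟩ : R) ∈ unitary R := by
    rw [Unitary.mem_iff] at hW ⊢
    exact ⟨Subtype.ext hW.1, Subtype.ext hW.2⟩
  have h1 := isStarNormal_of_mem_unitary hW
  have h2 := isStarNormal_of_mem_unitary hW'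
  have hsp : spectrum ℂ (⟨W, hWR⟩ : R) ⊆ Metric.sphere (0 : ℂ) 1 :=
    spectrum.subset_circle_of_unitary hW'
  have := StarAlgHomClass.map_cfc R.subtype (fun z => (truncArg c s (l * z) : ℂ)) ⟨W, hWR⟩
    (Complex.continuous_ofReal.comp_continuousOn ((continuousOn_truncArg_mul hc hs hl).mono hsp))
    continuous_subtype_val h2 h1
  rw [truncLog]
  exact this ▸ (cfc (fun z => (truncArg c s (l * z) : ℂ)) (⟨W, hWR⟩ : R)).2

end TruncLog

/-! ### Rotation of vectors supported in a corner -/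

section CornerRotation
open ContinuousLinearMap

lemma isSelfAdjoint_rep {B H : Type*} [NonUnitalCStarAlgebra B] [NormedAddCommGroup H]
    [InnerProductSpace ℂ H] [CompleteSpace H] (π : B →⋆ₙₐ[ℂ] (H →L[ℂ] H)) {b : B}
    (hb : IsSelfAdjoint b) : IsSelfAdjoint (π b) := by
  rw [isSelfAdjoint_iff, ← map_star, hb.star_eq]

lemma uexp_rep_intertwine {B H L : Type*} [NonUnitalCStarAlgebra B] [NormedAddCommGroup H]
    [InnerProductSpace ℂ H] [CompleteSpace H] [NormedAddCommGroup L] [InnerProductSpace ℂ L]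
    [CompleteSpace L] {π : B →⋆ₙₐ[ℂ] (H →L[ℂ] H)} {σ : B →⋆ₙₐ[ℂ] (L →L[ℂ] L)} {J : H →ₗᵢ[ℂ] L}
    (hJ : ∀ b v, σ b (J v) = J (π b v)) {k : B} (hk : IsSelfAdjoint k) (y : H) :
    J (uexp (π k) y) = uexp (σ k) (J y) := by
  have h := norm_intertwine_uexp_sub_le (T := π k) (isSelfAdjoint_rep σ hk)
    J.toContinuousLinearMap y 0 fun s _ => by
      change ‖J (π k (uexp (s • π k) y)) - σ k (J (uexp (s • π k) y))‖ ≤ 0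
      rw [hJ, sub_self, norm_zero]
  exact sub_eq_zero.1 (norm_le_zero_iff.1 h)

universe u
variable {A : Type u} [NonUnitalCStarAlgebra A] [PartialOrder A] [StarOrderedRing A]

set_option maxHeartbeats 1000000 in
/-- Rotation of one vector to another by the exponential of an element that is supported in a
corner of a hereditary subalgebra and almost commutes with given elements. -/
lemma exists_corner_rotation {C : ℝ} (hA : HasPathProperty A C)
    {A₁ : NonUnitalStarSubalgebra ℂ A} [IsClosed (A₁ : Set A)] (hA₁ : IsHereditary A₁)
    {κ c₁ : ℝ} (hκ : 0 < κ) (hc₁ : 0 < c₁) : ∃ c₀ : ℝ, 0 < c₀ ∧ c₀ ≤ c₁ ∧ c₀ ≤ 1 ∧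
    ∀ (F : Finset A₁) {ε : ℝ}, 0 < ε → ∃ (G : Finset A) (δ : ℝ), 0 < δ ∧
    ∀ (B : Type u) [NonUnitalCStarAlgebra B] [PartialOrder B] [StarOrderedRing B]
      (ι : A₁ →⋆ₙₐ[ℂ] B) (ω : B →ₚ[ℂ] ℂ) (H : Type u) [NormedAddCommGroup H]
      [InnerProductSpace ℂ H] [CompleteSpace H] (π : B →⋆ₙₐ[ℂ] (H →L[ℂ] H)) (ξ : H)
      (J : H →ₗᵢ[ℂ] UnivSpace B) (c d : A₁) (y₁ y₂ : H),
      IsPureState ω → IsIrreducible π → ξ ≠ 0 → (∀ b, ω b = ⟪ξ, π b ξ⟫_ℂ) →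
      (∀ b v, univRep B b (J v) = J (π b v)) → IsSelfAdjoint c → ‖c‖ ≤ 1 → IsSelfAdjoint d →
      d ∈ F → c * d = d → ‖y₁‖ = 1 → ‖y₂‖ = 1 → π (ι d) y₁ = y₁ → π (ι d) y₂ = y₂ →
      (∀ g ∈ G, ∀ x : A₁, (x : A) = c * g * c →
        ‖⟪y₁, π (ι x) y₁⟫_ℂ - ⟪y₂, π (ι x) y₂⟫_ℂ‖ < δ) →
      ∃ (μ : ℂ) (k : Bool → B), ‖μ‖ = 1 ∧ (∀ i, IsSelfAdjoint (k i)) ∧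
        (∀ i, ‖k i‖ ≤ Real.pi - c₀) ∧ (∀ i, ∀ e : A₁, e * c = c → ι e * k i = k i) ∧
        (∀ i, ∀ x ∈ F, c * x = x → x * c = x → ‖k i * ι x - ι x * k i‖ ≤ ε) ∧
        ‖uexp (π (k true)) y₂ - μ • y₁‖ ≤ 2 * κ * c₀ ∧
        ‖uexp (π (k false)) y₂ - (-μ) • y₁‖ ≤ 2 * κ * c₀ := by
  classical
  obtain ⟨c₀, s, hc0, hc0₁, hc01, hs, T, hT0, hT, hB⟩ := exists_rotations hκ hc₁
  refine ⟨c₀, hc0, hc0₁, hc01, fun F ε hε => ?_⟩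
  have hneg : ∀ p ∈ T, -(p.1 * p.2) ∈ Metric.sphere (0 : ℂ) 1 := fun p hp => by
    have := hT p hp
    rw [mem_sphere_zero_iff_norm] at *
    rwa [norm_neg]
  -- The compression error is `2 ‖h‖` times a commutator with `‖h‖ ≤ 4`; the bound `κ c₀ / 8` makes
  -- it at most `κ c₀`.
  obtain ⟨δ₀, hδ₀, hcomm⟩ := exists_commutator_truncLog_lt hc01 hs
    (T.image (fun p => p.1 * p.2) ∪ T.image (fun p => -(p.1 * p.2))) (fun l hl => by
      rcases Finset.mem_union.1 hl with h | h <;> obtain ⟨p, hp, rfl⟩ := Finset.mem_image.1 h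
      · exact hT p hp
      · exact hneg p hp) (ε := min ε (κ * c₀ / 8)) (lt_min hε (by positivity)) (∑ x ∈ F, ‖x‖)
  obtain ⟨G, δ, hδ, h⟩ := exists_unitary_dilation hA hA₁
    (F.map ⟨Subtype.val, Subtype.val_injective⟩) hδ₀
  refine ⟨G, δ, hδ, fun B _ _ _ ι ω H _ _ _ π ξ J c d y₁ y₂ hω hπ hξ hωξ hJ hc hcn hd hdF hcd hy₁
    hy₂ hdy₁ hdy₂ hG => ?_⟩
  have hcy : ∀ y, π (ι d) y = y → π (ι c) y = y := fun y hy => by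
    conv_lhs => rw [← hy]
    rw [← rep_mul_apply, ← map_mul, hcd, hy]
  obtain ⟨K, i₁, i₂, i₃, D, W, hWR, hW, hWF, hWe⟩ := h B ι ω H π ξ J c y₁ y₂ hω hπ hξ hωξ hJ hc
    hy₁ hy₂ (hcy y₁ hdy₁) (hcy y₂ hdy₂) hG
  have hj := inclUnitization_injective A₁
  have hσ := univRep_injective (B := B)
  have hcl : IsClosed (adjointableOps (univRep B) D.V : Set (K →L[ℂ] K)) :=
    isClosed_adjointableOps hσ
  have hfix : ∀ y, π (ι d) y = y → adjoint (D.V 1) (D.V 1 (J y)) = J y := fun y hy => by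
    rw [D.adjoint_V_V_one hj, hJ, map_mul, rep_mul_apply, hcy y hy, hcy y hy]
  have hnorm : ∀ y, π (ι d) y = y → ‖D.V 1 (J y)‖ = ‖y‖ := fun y hy => by
    refine le_antisymm ((D.norm_V_one_le hj hcn _).trans_eq (J.norm_map y)) ?_
    have := D.norm_adjoint_V_one_le hj hcn (D.V 1 (J y))
    rwa [hfix y hy, J.norm_map] at this
  obtain ⟨p, hp, hp₁, hp₂⟩ := exists_rotation_truncLog (K := K) hc01 hs hT0 hT (r := κ * c₀)
    (by positivity) hB hW (v := D.V 1 (J y₂)) ((hnorm y₂ hdy₂).trans hy₂)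
  obtain ⟨g, hg⟩ := exists_rep_eq_compression (x := 1) (D.V_mem 1) hWR
  have hg' : adjoint (D.V 1) (W (D.V 1 (J y₂))) = J (π g y₂) := by
    rw [← hJ, ← hg]; rfl
  -- Testing the equality of functionals on `V₁ b V₁*` shows that `π g y₂`, the compressed image of
  -- `y₂` under `W`, induces the same functional on `B` as `y₁`. Irreducibility then makes the two
  -- vectors agree up to a phase.
  have hfun : ∀ b, ⟪y₁, π b y₁⟫_ℂ = ⟪π g y₂, π b (π g y₂)⟫_ℂ := fun b => by
    have h1 := hWe (D.V 1 ∘L univRep B b ∘L adjoint (D.V 1))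
      (comp_rep_comp_adjoint_mem (D.V_mem 1) (D.V_mem 1) b)
    change ⟪D.V 1 (J y₁), D.V 1 (univRep B b (adjoint (D.V 1) (D.V 1 (J y₁))))⟫_ℂ =
      ⟪W (D.V 1 (J y₂)), D.V 1 (univRep B b (adjoint (D.V 1) (W (D.V 1 (J y₂)))))⟫_ℂ at h1
    rwa [hfix y₁ hdy₁, hg', hJ, hJ, ← adjoint_inner_left (D.V 1), ← adjoint_inner_left (D.V 1),
      hfix y₁ hdy₁, hg', J.inner_map_map, J.inner_map_map] at h1
  have hgn : ‖π g y₂‖ = 1 := by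
    refine le_antisymm ?_ ?_
    · rw [← J.norm_map, ← hg']
      refine (D.norm_adjoint_V_one_le hj hcn _).trans ?_
      have h1 := W.le_opNorm (D.V 1 (J y₂))
      rw [hnorm y₂ hdy₂, hy₂, mul_one] at h1
      exact h1.trans (norm_le_one_of_mem_unitary hW)
    · have h1 := hfun (ι c)
      rw [hcy y₁ hdy₁, inner_self_eq_norm_sq_to_K, hy₁] at h1
      have h2 : (1 : ℝ) ≤ ‖π g y₂‖ * (1 * ‖π g y₂‖) := by
        calc (1 : ℝ) = ‖⟪π g y₂, π (ι c) (π g y₂)⟫_ℂ‖ := by rw [← h1]; simp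
          _ ≤ ‖π g y₂‖ * ‖π (ι c) (π g y₂)‖ := norm_inner_le_norm _ _
          _ ≤ _ := by
            gcongr
            refine (norm_rep_apply_le π _ _).trans ?_
            gcongr
            exact (NonUnitalStarAlgHom.norm_apply_le ι c).trans hcn
      nlinarith [norm_nonneg (π g y₂)]
  obtain ⟨ν, hν, hνy⟩ := hπ.exists_phase hy₁ hgn (r := 0) fun b _ _ => by
    rw [hfun, sub_self, norm_zero]
  have hνy' : π g y₂ = ν • y₁ := (sub_eq_zero.1 (norm_le_zero_iff.1 hνy)).symm
  have key : ∀ l ∈ T.image (fun p => p.1 * p.2) ∪ T.image (fun p => -(p.1 * p.2)),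
      l ∈ Metric.sphere (0 : ℂ) 1 →
      ‖uexp (truncLog c₀ s l W) (D.V 1 (J y₂)) - l • W (D.V 1 (J y₂))‖ ≤ κ * c₀ →
      ∃ k : B, IsSelfAdjoint k ∧ ‖k‖ ≤ Real.pi - c₀ ∧ (∀ e : A₁, e * c = c → ι e * k = k) ∧
        (∀ x ∈ F, c * x = x → x * c = x → ‖k * ι x - ι x * k‖ ≤ ε) ∧
        ‖uexp (π k) y₂ - (l * ν) • y₁‖ ≤ 2 * κ * c₀ := fun l hlT hl hle => by
    have hcom : ∀ x ∈ F, ‖truncLog c₀ s l W * D.ρ (inclUnitization A₁ x) -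
        D.ρ (inclUnitization A₁ x) * truncLog c₀ s l W‖ ≤ min ε (κ * c₀ / 8) := fun x hx => by
      refine hcomm (K →L[ℂ] K) W _ hW ?_ ?_ l hlT
      · refine (NonUnitalStarAlgHom.norm_apply_le
          (D.ρ : Unitization ℂ A →⋆ₙₐ[ℂ] (K →L[ℂ] K)) _).trans ?_
        rw [inclUnitization_apply, Unitization.norm_inr]
        exact Finset.single_le_sum (f := fun x : A₁ => ‖x‖) (fun x _ => norm_nonneg x) hx
      · exact hWF x (Finset.mem_map_of_mem _ hx)
    obtain ⟨k, hk, hkn, hke, hkx, hky⟩ := D.exists_compression hj hσ hc hcn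
      (truncLog_mem hc01 hs hl _ hW hWR) (isSelfAdjoint_truncLog c₀ s l W)
    have hn := norm_truncLog_le hc01 hs l W
    refine ⟨k, hk, hkn.trans hn, hke, fun x hx h₁ h₂ =>
      (hkx x h₁ h₂).trans ((hcom x hx).trans (min_le_left _ _)), ?_⟩
    have h1 := hky d hd hcd (J y₂) (by rw [hJ, hdy₂])
    have h2 : 2 * ‖truncLog c₀ s l W‖ * ‖truncLog c₀ s l W * D.ρ (inclUnitization A₁ d) -
        D.ρ (inclUnitization A₁ d) * truncLog c₀ s l W‖ * ‖J y₂‖ ≤ κ * c₀ := by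
      rw [J.norm_map, hy₂, mul_one]
      calc _ ≤ 2 * 4 * (κ * c₀ / 8) := by
            gcongr
            · linarith [Real.pi_lt_four]
            · exact (hcom d hdF).trans (min_le_right _ _)
        _ = _ := by ring
    have h3 : ‖adjoint (D.V 1) (uexp (truncLog c₀ s l W) (D.V 1 (J y₂))) -
        J ((l * ν) • y₁)‖ ≤ κ * c₀ := by
      rw [mul_smul, ← hνy', map_smul J, ← hg', ← map_smul, ← map_sub]
      exact (D.norm_adjoint_V_one_le hj hcn _).trans hle
    rw [← J.norm_map, map_sub J, uexp_rep_intertwine hJ hk]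
    calc _ = ‖(adjoint (D.V 1) (uexp (truncLog c₀ s l W) (D.V 1 (J y₂))) - J ((l * ν) • y₁)) -
          (adjoint (D.V 1) (uexp (truncLog c₀ s l W) (D.V 1 (J y₂))) -
            uexp (univRep B k) (J y₂))‖ := by congr 1; abel
      _ ≤ κ * c₀ + κ * c₀ := (norm_sub_le _ _).trans (add_le_add h3 (h1.trans h2))
      _ = _ := by ring
  obtain ⟨k₁, h11, h12, h13, h14, h15⟩ := key (p.1 * p.2)
    (Finset.mem_union_left _ (Finset.mem_image_of_mem _ hp)) (hT p hp) hp₁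
  obtain ⟨k₂, h21, h22, h23, h24, h25⟩ := key (-(p.1 * p.2))
    (Finset.mem_union_right _ (Finset.mem_image_of_mem (fun p : ℂ × ℂ => -(p.1 * p.2)) hp))
    (hneg p hp) hp₂
  rw [neg_mul] at h25
  have hμ : ‖p.1 * p.2 * ν‖ = 1 := by
    rw [norm_mul, hν, mul_one]; exact mem_sphere_zero_iff_norm.1 (hT p hp)
  exact ⟨p.1 * p.2 * ν, fun i => Bool.rec k₂ k₁ i, hμ, Bool.forall_bool.2 ⟨h21, h11⟩,
    Bool.forall_bool.2 ⟨h22, h12⟩, Bool.forall_bool.2 ⟨h23, h13⟩, Bool.forall_bool.2 ⟨h24, h14⟩,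
    h15, h25⟩

end CornerRotation

/-! ### Rotation on the complement and combination of both rotations -/

section VectorRotation

lemma map_uexp {D E : Type*} [CStarAlgebra D] [CStarAlgebra E] (φ : D →⋆ₐ[ℂ] E) (h : D) :
    φ (uexp h) = uexp (φ h) := by
  let +nondep : NormedAlgebra ℚ D := .restrictScalars ℚ ℂ D
  let +nondep : NormedAlgebra ℚ E := .restrictScalars ℚ ℂ E
  have hφ : Continuous φ := by
    have h : ∀ x, ‖φ x‖ ≤ 1 * ‖x‖ := fun x => by
      rw [one_mul]; exact NonUnitalStarAlgHom.norm_apply_le (φ : D →⋆ₙₐ[ℂ] E) x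
    exact AddMonoidHomClass.continuous_of_bound φ 1 h
  rw [uexp, NormedSpace.map_exp φ hφ, map_smul, uexp]

variable {B H : Type*} [NonUnitalCStarAlgebra B] [NormedAddCommGroup H]
  [InnerProductSpace ℂ H] [CompleteSpace H]

/-- The unital extension of a representation. -/
noncomputable def repLift (π : B →⋆ₙₐ[ℂ] (H →L[ℂ] H)) : Unitization ℂ B →⋆ₐ[ℂ] (H →L[ℂ] H) :=
  Unitization.starLift π

lemma repLift_inr (π : B →⋆ₙₐ[ℂ] (H →L[ℂ] H)) (b : B) : repLift π (b : Unitization ℂ B) = π b :=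
  DFunLike.congr_fun (Unitization.starLift.symm_apply_apply π) b

lemma repLift_uexp (π : B →⋆ₙₐ[ℂ] (H →L[ℂ] H)) (b : B) :
    repLift π (uexp (b : Unitization ℂ B)) = uexp (π b) := by
  rw [map_uexp, repLift_inr]

lemma uexp_cayleyLog_apply (π : B →⋆ₙₐ[ℂ] (H →L[ℂ] H)) {b : B} (hb : IsSelfAdjoint b) (m : H) :
    uexp (π (cayleyLog b)) (m - Complex.I • π b m) = m + Complex.I • π b m := by
  have h := congr_arg (fun T => repLift π T m) (uexp_cayleyLog_mul hb)
  simp only [map_mul, map_sub, map_add, map_smul, map_one, repLift_uexp, repLift_inr] at h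
  exact h

/-- If `b` sends `m = p + q` to `-i (q - p)`, then `(1 - ib) m = 2p` and `(1 + ib) m = 2q`, so the
Cayley transform of `b` takes `p` to `q`. Equal norms make `⟪m, -i (q - p)⟫` real, as transitivity
requires; the sign of the real part bounds `‖q - p‖` by `‖m‖`. -/
lemma IsIrreducible.exists_cayley_preimage {π : B →⋆ₙₐ[ℂ] (H →L[ℂ] H)} (hπ : IsIrreducible π)
    {p q : H} (hpq : ‖p‖ = ‖q‖) (hp : p ≠ 0) (hre : 0 ≤ (⟪p, q⟫_ℂ).re) :
    ∃ b : B, IsSelfAdjoint b ∧ ‖b‖ ≤ 4 * (‖q - p‖ / ‖p + q‖) ∧ ‖q - p‖ ≤ ‖p + q‖ ∧ p + q ≠ 0 ∧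
      π b (p + q) = -Complex.I • (q - p) := by
  have h1 : ‖p + q‖ ^ 2 = ‖p‖ ^ 2 + 2 * (⟪p, q⟫_ℂ).re + ‖q‖ ^ 2 := norm_add_sq (𝕜 := ℂ) p q
  have h2 : ‖q - p‖ ^ 2 = ‖q‖ ^ 2 - 2 * (⟪q, p⟫_ℂ).re + ‖p‖ ^ 2 := norm_sub_sq (𝕜 := ℂ) q p
  have h3 : (⟪q, p⟫_ℂ).re = (⟪p, q⟫_ℂ).re := by rw [← inner_conj_symm, Complex.conj_re]
  have h4 : (⟪q, p⟫_ℂ).im = -(⟪p, q⟫_ℂ).im := by rw [← inner_conj_symm, Complex.conj_im]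
  have hle : ‖q - p‖ ≤ ‖p + q‖ :=
    (pow_le_pow_iff_left₀ (norm_nonneg _) (norm_nonneg _) two_ne_zero).1 (by linarith)
  have hp0 : 0 < ‖p‖ := norm_pos_iff.2 hp
  have hm : p + q ≠ 0 := by
    intro h
    rw [h, norm_zero] at h1
    nlinarith [sq_nonneg ‖q‖]
  have hreal : (⟪p + q, -Complex.I • (q - p)⟫_ℂ).im = 0 := by
    rw [inner_smul_right, inner_add_left, inner_sub_right, inner_sub_right,
      inner_self_eq_norm_sq_to_K, inner_self_eq_norm_sq_to_K, hpq]
    simp [h3]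
  obtain ⟨b, hb, hbn, hbm⟩ := hπ.exists_preimage hm hreal
  rw [norm_smul, norm_neg, Complex.norm_I, one_mul] at hbn
  exact ⟨b, hb, hbn, hle, hm, hbm⟩

/-- Rotation of one vector to another by the exponential of an element orthogonal to a given
element that nearly annihilates both vectors. -/
lemma IsIrreducible.exists_complement_rotation {π : B →⋆ₙₐ[ℂ] (H →L[ℂ] H)}
    (hπ : IsIrreducible π) {g : B} (hg : IsSelfAdjoint g) (hg1 : ‖g‖ ≤ 1) {ζ₁ ζ₂ : H} {ν : ℂ}
    (hν : ‖ν‖ = 1) {η : ℝ} (hη : 0 < η) (h₁ : ‖π g ζ₁‖ ≤ η / 32) (h₂ : ‖π g ζ₂‖ ≤ η / 32)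
    (h₁₂ : |‖ζ₁‖ - ‖ζ₂‖| ≤ η / 32) (hre : 0 ≤ (⟪ζ₂, ν • ζ₁⟫_ℂ).re) :
    ∃ l : B, IsSelfAdjoint l ∧ ‖l‖ ≤ 2 * Real.arctan 16 ∧ (∀ e, e * g = e → e * l = 0) ∧
      (∀ e, g * e = e → l * e = 0) ∧ ‖uexp (π l) ζ₂ - ν • ζ₁‖ ≤ η := by
  rw [abs_le] at h₁₂
  -- For short vectors no rotation is needed. Otherwise the ratio of the two norms is at most `2`.
  rcases le_or_gt ‖ζ₁‖ (η / 4) with hsmall | hbig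
  · refine ⟨0, IsSelfAdjoint.zero B, ?_, fun e _ => mul_zero e, fun e _ => zero_mul e, ?_⟩
    · rw [norm_zero]
      have := Real.arctan_nonneg.2 (by norm_num : (0 : ℝ) ≤ 16)
      positivity
    · rw [map_zero, uexp_zero]
      change ‖ζ₂ - ν • ζ₁‖ ≤ η
      refine (norm_sub_le _ _).trans ?_
      rw [norm_smul, hν]
      linarith
  have hn1 : 0 < ‖ζ₁‖ := by linarith
  have hn2 : 0 < ‖ζ₂‖ := by linarith
  obtain ⟨r, hr⟩ : ∃ r : ℝ, r = ‖ζ₂‖ / ‖ζ₁‖ := ⟨_, rfl⟩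
  have hr0 : 0 < r := by rw [hr]; positivity
  have hr2 : r ≤ 2 := by rw [hr, div_le_iff₀ hn1]; linarith
  have hrn : r * ‖ζ₁‖ = ‖ζ₂‖ := by rw [hr, div_mul_cancel₀ _ hn1.ne']
  obtain ⟨q, hq⟩ : ∃ q : H, q = (r : ℂ) • ν • ζ₁ := ⟨_, rfl⟩
  have hqn : ‖ζ₂‖ = ‖q‖ := by
    rw [hq, norm_smul, norm_smul, hν, one_mul, Complex.norm_real, Real.norm_of_nonneg hr0.le, hrn]
  have hqre : 0 ≤ (⟪ζ₂, q⟫_ℂ).re := by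
    rw [hq, inner_smul_right, Complex.re_ofReal_mul]
    positivity
  obtain ⟨b, hb, hbn, hle, hm, hbm⟩ := hπ.exists_cayley_preimage hqn (norm_pos_iff.1 hn2) hqre
  have hb4 : ‖b‖ ≤ 4 := hbn.trans (by
    have : ‖q - ζ₂‖ / ‖ζ₂ + q‖ ≤ 1 := div_le_one_of_le₀ hle (norm_nonneg _)
    linarith)
  -- `b₁ = (1 - g) b (1 - g)` has norm at most `4 · 4 = 16`; this is the origin of `2 arctan 16`.
  obtain ⟨b₁, hb₁⟩ : ∃ b₁, b₁ = b - g * b - b * g + g * b * g := ⟨_, rfl⟩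
  have hb₁sa : IsSelfAdjoint b₁ := by
    rw [isSelfAdjoint_iff, hb₁]
    simp only [star_add, star_sub, star_mul, hb.star_eq, hg.star_eq, mul_assoc]
    abel
  have hb₁n : ‖b₁‖ ≤ 16 := by
    have e1 : ‖g * b‖ ≤ 1 * 4 := (norm_mul_le _ _).trans (by gcongr)
    have e2 : ‖b * g‖ ≤ 4 * 1 := (norm_mul_le _ _).trans (by gcongr)
    have e3 : ‖g * b * g‖ ≤ 1 * 4 * 1 := (norm_mul_le _ _).trans (by gcongr)
    rw [hb₁]
    have := norm_add_le (b - g * b - b * g) (g * b * g)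
    have := norm_sub_le (b - g * b) (b * g)
    have := norm_sub_le b (g * b)
    linarith
  refine ⟨cayleyLog b₁, isSelfAdjoint_cayleyLog b₁, norm_cayleyLog_le_of_norm_le hb₁sa hb₁n,
    fun e he => mul_cayleyLog_eq_zero hb₁sa ?_, fun e he => cayleyLog_mul_eq_zero hb₁sa ?_, ?_⟩
  · rw [hb₁]
    simp only [mul_add, mul_sub, ← mul_assoc, he]
    abel
  · rw [hb₁]
    simp only [add_mul, sub_mul, mul_assoc, he]
    abel
  have hgq : ‖π g q‖ ≤ 2 * (η / 32) := by
    rw [hq, map_smul, map_smul, norm_smul, norm_smul, hν, one_mul, Complex.norm_real,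
      Real.norm_of_nonneg hr0.le]
    gcongr
  obtain ⟨w, hw⟩ : ∃ w, w = -Complex.I • (q - ζ₂) := ⟨_, rfl⟩
  have hgm : ‖π g (ζ₂ + q)‖ ≤ 3 * (η / 32) := by
    rw [map_add]; exact (norm_add_le _ _).trans (by linarith)
  have hgw : ‖π g w‖ ≤ 3 * (η / 32) := by
    rw [hw, map_smul, norm_smul, norm_neg, Complex.norm_I, one_mul, map_sub]
    exact (norm_sub_le _ _).trans (by linarith)
  obtain ⟨x, hx⟩ : ∃ x, x = π b (π g (ζ₂ + q)) := ⟨_, rfl⟩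
  have hxn : ‖x‖ ≤ 12 * (η / 32) := by
    rw [hx]
    refine (norm_rep_apply_le π _ _).trans ?_
    calc ‖b‖ * ‖π g (ζ₂ + q)‖ ≤ 4 * (3 * (η / 32)) := by gcongr
      _ = _ := by ring
  have hgx : ‖π g x‖ ≤ ‖x‖ :=
    (norm_rep_apply_le π _ _).trans (mul_le_of_le_one_left (norm_nonneg _) hg1)
  obtain ⟨f, hf⟩ : ∃ f, f = π g x - x - π g w := ⟨_, rfl⟩
  have hfn : ‖f‖ ≤ 27 * (η / 32) := by
    rw [hf]
    have := norm_sub_le (π g x - x) (π g w)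
    have := norm_sub_le (π g x) x
    linarith
  have hb₁m : π b₁ (ζ₂ + q) = w + f := by
    rw [hb₁, map_add π, map_sub π, map_sub π]
    change π b (ζ₂ + q) - π (g * b) (ζ₂ + q) - π (b * g) (ζ₂ + q) + π (g * b * g) (ζ₂ + q) = _
    rw [rep_mul_apply, rep_mul_apply, rep_mul_apply, rep_mul_apply, hbm, ← hx, ← hw, hf]
    abel
  have hiw : Complex.I • w = q - ζ₂ := by
    rw [hw, smul_smul, mul_neg, Complex.I_mul_I]; simp
  have key := uexp_cayleyLog_apply π hb₁sa (ζ₂ + q)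
  rw [hb₁m, smul_add, hiw] at key
  have hsa : IsSelfAdjoint (π (cayleyLog b₁)) := isSelfAdjoint_rep π (isSelfAdjoint_cayleyLog b₁)
  -- Cutting down `b` perturbs the Cayley relation by `f`, and unitarity turns this into an error of
  -- at most `‖f‖`. The budget is `27 / 32` for `f` and `1 / 32` for rescaling the target.
  have e1 : (2 : ℂ) • (uexp (π (cayleyLog b₁)) ζ₂ - q) =
      Complex.I • f + uexp (π (cayleyLog b₁)) (Complex.I • f) := by
    have e2 : ζ₂ + q - (q - ζ₂ + Complex.I • f) = (2 : ℂ) • ζ₂ - Complex.I • f := by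
      rw [two_smul]; abel
    rw [e2, map_sub, map_smul, sub_eq_iff_eq_add] at key
    rw [smul_sub, key, two_smul ℂ q]
    abel
  have e3 : 2 * ‖uexp (π (cayleyLog b₁)) ζ₂ - q‖ ≤ 2 * ‖f‖ := by
    calc 2 * ‖uexp (π (cayleyLog b₁)) ζ₂ - q‖ =
        ‖(2 : ℂ) • (uexp (π (cayleyLog b₁)) ζ₂ - q)‖ := by rw [norm_smul]; simp
      _ ≤ ‖Complex.I • f‖ + ‖uexp (π (cayleyLog b₁)) (Complex.I • f)‖ := by
        rw [e1]; exact norm_add_le _ _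
      _ = 2 * ‖f‖ := by
        rw [norm_uexp_apply hsa, norm_smul, Complex.norm_I]; ring
  have e4 : ‖q - ν • ζ₁‖ ≤ η / 32 := by
    have : q - ν • ζ₁ = ((r - 1 : ℝ) : ℂ) • ν • ζ₁ := by
      rw [hq]; push_cast; rw [sub_smul, one_smul]
    rw [this, norm_smul, norm_smul, hν, one_mul, Complex.norm_real, Real.norm_eq_abs,
      ← abs_norm ζ₁, ← abs_mul, sub_mul, hrn, one_mul, abs_le]
    constructor <;> linarith
  calc ‖uexp (π (cayleyLog b₁)) ζ₂ - ν • ζ₁‖ ≤ ‖uexp (π (cayleyLog b₁)) ζ₂ - q‖ + ‖q - ν • ζ₁‖ :=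
        norm_sub_le_norm_sub_add_norm_sub _ _ _
    _ ≤ η := by linarith

lemma uexp_apply_of_apply_eq_zero {T : H →L[ℂ] H} (hT : IsSelfAdjoint T) {v : H} (h : T v = 0) :
    uexp T v = v := by
  have key := norm_intertwine_uexp_sub_le (T := (0 : H →L[ℂ] H)) hT (ContinuousLinearMap.id ℂ H) v 0
    fun s _ => by
      rw [smul_zero, uexp_zero]
      change ‖(0 : H) - T v‖ ≤ 0
      rw [h, sub_zero, norm_zero]
  rw [uexp_zero] at key
  exact (sub_eq_zero.1 (norm_le_zero_iff.1 key)).symm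

/-- Combination of rotations in two orthogonal corners. -/
lemma IsIrreducible.exists_rotation_add {π : B →⋆ₙₐ[ℂ] (H →L[ℂ] H)}
    (hπ : IsIrreducible π) {g f : B} (hg : IsSelfAdjoint g) (hg1 : ‖g‖ ≤ 1) (hgf : g * f = f)
    {ξ₁ ξ₂ : H} {μ : ℂ} (hμ : ‖μ‖ = 1) {η η₁ M : ℝ} (hη : 0 < η) (hM : 2 * Real.arctan 16 ≤ M)
    (hζ₁ : ‖π g (ξ₁ - π g ξ₁)‖ ≤ η / 32) (hζ₂ : ‖π g (ξ₂ - π g ξ₂)‖ ≤ η / 32)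
    (hζ : |‖ξ₁ - π g ξ₁‖ - ‖ξ₂ - π g ξ₂‖| ≤ η / 32)
    (he₁ : ‖π g ξ₁ - π f ξ₁‖ ≤ η / 32) (he₂ : ‖π g ξ₂ - π f ξ₂‖ ≤ η / 32)
    {k : Bool → B} (hk : ∀ i, IsSelfAdjoint (k i)) (hkM : ∀ i, ‖k i‖ ≤ M)
    (hgk : ∀ i, g * k i = k i) (ht : ‖uexp (π (k true)) (π f ξ₂) - μ • π f ξ₁‖ ≤ η₁)
    (hf : ‖uexp (π (k false)) (π f ξ₂) - (-μ) • π f ξ₁‖ ≤ η₁) :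
    ∃ (K : B) (i : Bool) (ν : ℂ), IsSelfAdjoint K ∧ ‖K‖ ≤ M ∧ ‖ν‖ = 1 ∧
      (∀ x, g * x = x → x * g = x → K * x - x * K = k i * x - x * k i) ∧
      ‖uexp (π K) ξ₂ - ν • ξ₁‖ ≤ η₁ + 2 * η := by
  -- The sign of the phase is chosen to suit the complement; both signs are available in the corner.
  obtain ⟨i, ν, hν, hre, hki⟩ : ∃ (i : Bool) (ν : ℂ), ‖ν‖ = 1 ∧
      0 ≤ (⟪ξ₂ - π g ξ₂, ν • (ξ₁ - π g ξ₁)⟫_ℂ).re ∧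
      ‖uexp (π (k i)) (π f ξ₂) - ν • π f ξ₁‖ ≤ η₁ := by
    rcases le_total 0 (⟪ξ₂ - π g ξ₂, μ • (ξ₁ - π g ξ₁)⟫_ℂ).re with h | h
    · exact ⟨true, μ, hμ, h, ht⟩
    · refine ⟨false, -μ, by rwa [norm_neg], ?_, hf⟩
      rw [neg_smul, inner_neg_right, Complex.neg_re]
      linarith
  obtain ⟨l, hl, hln, hel, hle, hlζ⟩ := hπ.exists_complement_rotation hg hg1 hν hη hζ₁ hζ₂ hζ hre
  have hkg : k i * g = k i := by
    have := congr_arg star (hgk i)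
    rwa [star_mul, (hk i).star_eq, hg.star_eq] at this
  have hkl : k i * l = 0 := hel _ hkg
  have hlk : l * k i = 0 := hle _ (hgk i)
  have hπk := isSelfAdjoint_rep π (hk i)
  have hπl := isSelfAdjoint_rep π hl
  refine ⟨k i + l, i, ν, (hk i).add hl, ?_, hν, fun x h1 h2 => ?_, ?_⟩
  · rw [IsSelfAdjoint.norm_add_eq_max (hk i) hl hkl]
    exact max_le (hkM i) (hln.trans hM)
  · rw [add_mul, mul_add, hle x h1, hel x h2, add_zero, add_zero]
  obtain ⟨e₁, hE₁⟩ : ∃ e₁, e₁ = π g ξ₁ - π f ξ₁ := ⟨_, rfl⟩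
  obtain ⟨e₂, hE₂⟩ : ∃ e₂, e₂ = π g ξ₂ - π f ξ₂ := ⟨_, rfl⟩
  rw [← hE₁] at he₁
  rw [← hE₂] at he₂
  have hkζ : ∀ ξ, π (k i) (ξ - π g ξ) = 0 := fun ξ => by
    rw [map_sub, ← rep_mul_apply, hkg, sub_self]
  have hlf : ∀ ξ, π l (π f ξ) = 0 := fun ξ => by
    rw [← rep_mul_apply, hle f hgf, map_zero]; rfl
  have hπcomm : Commute (π (k i)) (π l) := by
    rw [Commute, SemiconjBy, ← map_mul, ← map_mul, hkl, hlk]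
  obtain ⟨S, hS⟩ : ∃ S, S = uexp (π (k i)) := ⟨_, rfl⟩
  obtain ⟨T, hT⟩ : ∃ T, T = uexp (π l) := ⟨_, rfl⟩
  have hST : uexp (π (k i + l)) = S * T := by rw [map_add, uexp_add hπcomm, hS, hT]
  have hTf : T (π f ξ₂) = π f ξ₂ := by
    rw [hT]; exact uexp_apply_of_apply_eq_zero hπl (hlf ξ₂)
  have hSζ : S (ν • (ξ₁ - π g ξ₁)) = ν • (ξ₁ - π g ξ₁) := by
    rw [hS, map_smul, uexp_apply_of_apply_eq_zero hπk (hkζ ξ₁)]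
  rw [← hT] at hlζ
  rw [← hS] at hki
  have hSn : ∀ v, ‖S v‖ ≤ ‖v‖ := fun v => by rw [hS]; exact norm_uexp_apply_le hπk v
  have hTn : ∀ v, ‖T v‖ ≤ ‖v‖ := fun v => by rw [hT]; exact norm_uexp_apply_le hπl v
  -- Each vector is a part moved only by `k i`, a part moved only by `l`, and a small transition
  -- term.
  have hξ₁ : ξ₁ = π f ξ₁ + (ξ₁ - π g ξ₁) + e₁ := by rw [hE₁]; abel
  have hξ₂ : ξ₂ = π f ξ₂ + (ξ₂ - π g ξ₂) + e₂ := by rw [hE₂]; abel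
  have e : uexp (π (k i + l)) ξ₂ - ν • ξ₁ = (S (π f ξ₂) - ν • π f ξ₁) +
      S (T (ξ₂ - π g ξ₂) - ν • (ξ₁ - π g ξ₁)) + S (T e₂) - ν • e₁ := by
    have h1 : (S * T) ξ₂ = S (π f ξ₂) + S (T (ξ₂ - π g ξ₂)) + S (T e₂) := by
      conv_lhs => rw [hξ₂]
      change S (T _) = _
      rw [map_add T, map_add T, hTf, map_add S, map_add S]
    have h2 : ν • ξ₁ = ν • π f ξ₁ + ν • (ξ₁ - π g ξ₁) + ν • e₁ := by
      conv_lhs => rw [hξ₁]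
      rw [smul_add, smul_add]
    rw [hST, h1, h2, map_sub S, hSζ]
    abel
  have n1 := (hSn _).trans hlζ
  have n2 := (hSn _).trans ((hTn _).trans he₂)
  have n3 : ‖ν • e₁‖ ≤ η / 32 := by rwa [norm_smul, hν, one_mul]
  rw [e]
  refine (norm_sub_le _ _).trans ?_
  have := norm_add_le (S (π f ξ₂) - ν • π f ξ₁ + S (T (ξ₂ - π g ξ₂) - ν • (ξ₁ - π g ξ₁))) (S (T e₂))
  have := norm_add_le (S (π f ξ₂) - ν • π f ξ₁) (S (T (ξ₂ - π g ξ₂) - ν • (ξ₁ - π g ξ₁)))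
  linarith

end VectorRotation

/-! ### Cutting vectors by an approximate unit -/

section Cut

/-- The piecewise linear function that vanishes below `r⁻¹` and is one above `2 r⁻¹`. -/
noncomputable def cutFun (r t : ℝ) : ℝ := max 0 (min 1 (t * r - 1))

lemma continuous_cutFun (r : ℝ) : Continuous (cutFun r) := by
  unfold cutFun; fun_prop

lemma cutFun_zero (r : ℝ) : cutFun r 0 = 0 := by simp [cutFun]

lemma cutFun_nonneg (r t : ℝ) : 0 ≤ cutFun r t := le_max_left _ _

lemma cutFun_le_one (r t : ℝ) : cutFun r t ≤ 1 := max_le zero_le_one (min_le_left _ _)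

lemma cutFun_mul {r r' : ℝ} (hr : 0 < r) (h : 2 * r ≤ r') (t : ℝ) :
    cutFun r' t * cutFun r t = cutFun r t := by
  rcases le_or_gt (t * r) 1 with h1 | h1
  · have : cutFun r t = 0 :=
      max_eq_left ((min_le_right _ _).trans (by linarith))
    rw [this, mul_zero]
  · have ht : 0 < t := by
      by_contra! h2
      nlinarith
    have : cutFun r' t = 1 := by
      have h3 : 1 ≤ t * r' - 1 := by nlinarith
      rw [cutFun, min_eq_left h3, max_eq_right zero_le_one]
    rw [this, one_mul]

lemma abs_sub_cutFun_mul_le {r t : ℝ} (hr : 0 < r) (ht : 0 ≤ t) :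
    |t - cutFun r t * t| ≤ 2 / r := by
  have h0 := cutFun_nonneg r t
  have h1 := cutFun_le_one r t
  rw [abs_of_nonneg (by nlinarith), le_div_iff₀ hr]
  rcases le_or_gt (t * r) 2 with h2 | h2
  · nlinarith [mul_nonneg h0 (mul_nonneg ht hr.le)]
  · have : cutFun r t = 1 := by
      rw [cutFun, min_eq_left (by linarith), max_eq_right zero_le_one]
    rw [this]; linarith

variable {A : Type*} [NonUnitalCStarAlgebra A]

lemma exists_approximateUnit (F : Finset A) {ε : ℝ} (hε : 0 < ε) :
    ∃ a : A, IsSelfAdjoint a ∧ (∀ t ∈ quasispectrum ℝ a, 0 ≤ t) ∧ ‖a‖ ≤ 1 ∧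
      ∀ x ∈ F, ‖x - a * x‖ ≤ ε ∧ ‖x - x * a‖ ≤ ε := by
  let := CStarAlgebra.spectralOrder A
  have := CStarAlgebra.spectralOrderedRing A
  have hu := CStarAlgebra.increasingApproximateUnit A
  have h1 : ∀ x ∈ F, ∀ᶠ a in CStarAlgebra.approximateUnit A,
      ‖x - a * x‖ ≤ ε ∧ ‖x - x * a‖ ≤ ε := fun x _ => by
    have hl := (tendsto_const_nhds (x := x)).sub (hu.tendsto_mul_right x)
    have hr := (tendsto_const_nhds (x := x)).sub (hu.tendsto_mul_left x)
    rw [sub_self] at hl hr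
    have hl' := (tendsto_zero_iff_norm_tendsto_zero.1 hl).eventually (eventually_le_nhds hε)
    have hr' := (tendsto_zero_iff_norm_tendsto_zero.1 hr).eventually (eventually_le_nhds hε)
    exact hl'.and hr'
  obtain ⟨a, ha0, ha1, haF⟩ := (hu.eventually_nonneg.and (hu.eventually_norm.and
    ((eventually_all_finset F).2 h1))).exists
  exact ⟨a, IsSelfAdjoint.of_nonneg ha0, fun t ht => quasispectrum_nonneg_of_nonneg a ha0 t ht,
    ha1, haF⟩

/-- An increasing sequence of positive contractions, each a unit for its predecessors, that starts
with an approximate unit for a given finite set. -/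
lemma exists_cut_sequence (F : Finset A) {ε : ℝ} (hε : 0 < ε) :
    ∃ f : ℕ → A, (∀ j, ∃ e, IsSelfAdjoint e ∧ ‖e‖ ≤ 1 ∧ f j = e * e) ∧
      (∀ i j, i < j → f j * f i = f i ∧ f i * f j = f i) ∧
      ∀ x ∈ F, ‖x - f 0 * x * f 0‖ ≤ ε := by
  obtain ⟨ε', hε'⟩ : ∃ ε', ε' = ε / 8 := ⟨_, rfl⟩
  have hε'0 : 0 < ε' := by rw [hε']; positivity
  obtain ⟨a, ha, haspec, ha1, haF⟩ := exists_approximateUnit F hε'0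
  obtain ⟨M, hM⟩ : ∃ M, M = ∑ x ∈ F, ‖x‖ := ⟨_, rfl⟩
  have hM0 : 0 ≤ M := by rw [hM]; positivity
  obtain ⟨r, hr⟩ : ∃ r, r = 2 * (M + 1) / ε' := ⟨_, rfl⟩
  have hr0 : 0 < r := by rw [hr]; positivity
  have hrM : 2 / r * M ≤ ε' := by
    rw [div_mul_eq_mul_div, div_le_iff₀ hr0, hr, mul_div_cancel₀ _ hε'0.ne']
    linarith
  -- Doubling the scale puts the support of each function where the next one equals `1`. The initial
  -- scale `r` makes `f 0` almost a unit for `a`.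
  let f : ℕ → A := fun j => cfcₙ (cutFun (r * 2 ^ j)) a
  have hcont : ∀ j, ContinuousOn (cutFun (r * 2 ^ j)) (quasispectrum ℝ a) := fun j =>
    (continuous_cutFun _).continuousOn
  have hmul : ∀ i j, i < j → f j * f i = f i ∧ f i * f j = f i := fun i j hij => by
    have h2 : 2 * (r * 2 ^ i) ≤ r * 2 ^ j := by
      have : (2 : ℝ) ^ (i + 1) ≤ 2 ^ j := pow_le_pow_right₀ one_le_two hij
      rw [pow_succ] at this
      nlinarith
    refine ⟨?_, ?_⟩
    · rw [← cfcₙ_mul _ _ a (hcont j) (cutFun_zero _) (hcont i) (cutFun_zero _)]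
      exact cfcₙ_congr fun t _ => cutFun_mul (by positivity) h2 t
    · rw [← cfcₙ_mul _ _ a (hcont i) (cutFun_zero _) (hcont j) (cutFun_zero _)]
      exact cfcₙ_congr fun t _ => (mul_comm _ _).trans (cutFun_mul (by positivity) h2 t)
  have hsq : ∀ j, ∃ e, IsSelfAdjoint e ∧ ‖e‖ ≤ 1 ∧ f j = e * e := fun j => by
    have hc : ContinuousOn (fun t => √(cutFun (r * 2 ^ j) t)) (quasispectrum ℝ a) :=
      (Real.continuous_sqrt.comp (continuous_cutFun _)).continuousOn
    have h0 : √(cutFun (r * 2 ^ j) 0) = 0 := by rw [cutFun_zero, Real.sqrt_zero]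
    refine ⟨cfcₙ (fun t => √(cutFun (r * 2 ^ j) t)) a, cfcₙ_predicate _ a,
      norm_cfcₙ_le fun t _ => ?_, ?_⟩
    · rw [Real.norm_of_nonneg (Real.sqrt_nonneg _)]
      exact Real.sqrt_le_one.2 (cutFun_le_one _ _)
    · rw [← cfcₙ_mul _ _ a hc h0 hc h0]
      exact cfcₙ_congr fun t _ => (Real.mul_self_sqrt (cutFun_nonneg _ _)).symm
  have hf0n : ‖f 0‖ ≤ 1 := norm_cfcₙ_le fun t _ => by
    rw [Real.norm_of_nonneg (cutFun_nonneg _ _)]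
    exact cutFun_le_one _ _
  have hf0 : f 0 = cfcₙ (cutFun r) a := by simp [f]
  have hc0 : ContinuousOn (cutFun r) (quasispectrum ℝ a) := (continuous_cutFun r).continuousOn
  have hfa : ‖a - f 0 * a‖ ≤ 2 / r := by
    have e1 : a - f 0 * a = cfcₙ (fun t => t - cutFun r t * t) a := by
      rw [cfcₙ_sub (fun t => t) (fun t => cutFun r t * t) a continuousOn_id rfl
        (hc0.mul continuousOn_id) (by simp), cfcₙ_mul (cutFun r) (fun t => t) a hc0
        (cutFun_zero r) continuousOn_id rfl, cfcₙ_id' ℝ a, hf0]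
    rw [e1]
    exact norm_cfcₙ_le fun t ht => abs_sub_cutFun_mul_le hr0 (haspec t ht)
  have hcomm : f 0 * a = a * f 0 := by
    rw [hf0]
    have h := (cfcₙ_commute_cfcₙ (cutFun r) id a).eq
    rwa [cfcₙ_id ℝ a] at h
  have hfa' : ‖a - a * f 0‖ ≤ 2 / r := hcomm ▸ hfa
  have hxM : ∀ x ∈ F, ‖x‖ ≤ M := fun x hx => by
    rw [hM]; exact Finset.single_le_sum (f := fun x : A => ‖x‖) (fun x _ => norm_nonneg x) hx
  refine ⟨f, hsq, hmul, fun x hx => ?_⟩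
  obtain ⟨h1, h2⟩ := haF x hx
  have b1 : ‖x - f 0 * x‖ ≤ 3 * ε' := by
    have e : x - f 0 * x = (x - a * x) + (a - f 0 * a) * x - f 0 * (x - a * x) := by
      noncomm_ring
    have n1 : ‖(a - f 0 * a) * x‖ ≤ ε' := (norm_mul_le _ _).trans
      ((mul_le_mul hfa (hxM x hx) (norm_nonneg _) (by positivity)).trans hrM)
    have n2 : ‖f 0 * (x - a * x)‖ ≤ ε' := (norm_mul_le _ _).trans
      ((mul_le_of_le_one_left (norm_nonneg _) hf0n).trans h1)
    rw [e]
    have := norm_sub_le ((x - a * x) + (a - f 0 * a) * x) (f 0 * (x - a * x))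
    have := norm_add_le (x - a * x) ((a - f 0 * a) * x)
    linarith
  have b2 : ‖x - x * f 0‖ ≤ 3 * ε' := by
    have e : x - x * f 0 = (x - x * a) + x * (a - a * f 0) - (x - x * a) * f 0 := by
      noncomm_ring
    have n1 : ‖x * (a - a * f 0)‖ ≤ ε' := (norm_mul_le _ _).trans
      ((mul_le_mul (hxM x hx) hfa' (norm_nonneg _) hM0).trans (by rw [mul_comm]; exact hrM))
    have n2 : ‖(x - x * a) * f 0‖ ≤ ε' := (norm_mul_le _ _).trans
      ((mul_le_of_le_one_right (norm_nonneg _) hf0n).trans h2)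
    rw [e]
    have := norm_sub_le ((x - x * a) + x * (a - a * f 0)) ((x - x * a) * f 0)
    have := norm_add_le (x - x * a) (x * (a - a * f 0))
    linarith
  have e : x - f 0 * x * f 0 = (x - f 0 * x) + f 0 * (x - x * f 0) := by noncomm_ring
  have n1 : ‖f 0 * (x - x * f 0)‖ ≤ 3 * ε' := (norm_mul_le _ _).trans
    ((mul_le_of_le_one_left (norm_nonneg _) hf0n).trans b2)
  rw [e]
  have := norm_add_le (x - f 0 * x) (f 0 * (x - x * f 0))
  linarith

/-- Over `N` consecutive blocks the two sequences together increase by at most `2 ≤ N σ`. Blocks of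
length four leave room for the vector part `f_j`, the units `d = f_{j+1}`, `c = f_{j+2}`, `g =
f_{j+3}`, and `f_{j+4}` to control the overlap `g (1 - g)`. -/
lemma exists_small_increment {s t : ℕ → ℝ} (hs0 : ∀ j, 0 ≤ s j) (ht0 : ∀ j, 0 ≤ t j)
    (hs1 : ∀ j, s j ≤ 1) (ht1 : ∀ j, t j ≤ 1) {σ : ℝ} {N : ℕ} (hN : 2 ≤ N * σ) (hN0 : 0 < N)
    (hs : Monotone s) (ht : Monotone t) :
    ∃ j < 4 * N, s (j + 4) - s j ≤ σ ∧ t (j + 4) - t j ≤ σ := by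
  have hsum : ∑ m ∈ Finset.range N, ((s (4 * (m + 1)) + t (4 * (m + 1))) -
      (s (4 * m) + t (4 * m))) ≤ ∑ m ∈ Finset.range N, σ := by
    rw [Finset.sum_range_sub (fun m => s (4 * m) + t (4 * m)), Finset.sum_const, Finset.card_range,
      nsmul_eq_mul]
    linarith [hs0 (4 * 0), ht0 (4 * 0), hs1 (4 * N), ht1 (4 * N)]
  obtain ⟨m, hm, hle⟩ := Finset.exists_le_of_sum_le (Finset.nonempty_range_iff.2 hN0.ne') hsum
  have h1 := hs (show 4 * m ≤ 4 * (m + 1) by lia)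
  have h2 := ht (show 4 * m ≤ 4 * (m + 1) by lia)
  refine ⟨4 * m, by have := Finset.mem_range.1 hm; lia, ?_, ?_⟩
  · rw [show 4 * m + 4 = 4 * (m + 1) by ring]; linarith
  · rw [show 4 * m + 4 = 4 * (m + 1) by ring]; linarith

variable {H : Type*} [NormedAddCommGroup H] [InnerProductSpace ℂ H] [CompleteSpace H]

/-- A substitute for orthogonality of increments of projections: `⟪g ξ, f ξ⟫ = ⟪ξ, f ξ⟫ = ‖e ξ‖² ≥
‖f ξ‖²`. -/
lemma norm_rep_sub_sq_le (π : A →⋆ₙₐ[ℂ] (H →L[ℂ] H)) {f g e : A} (he : IsSelfAdjoint e)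
    (he1 : ‖e‖ ≤ 1) (hfe : f = e * e) (hg : IsSelfAdjoint g) (hgf : g * f = f) (ξ : H) :
    ‖π g ξ - π f ξ‖ ^ 2 ≤ ‖π g ξ‖ ^ 2 - ‖π f ξ‖ ^ 2 := by
  have h1 : ‖π g ξ - π f ξ‖ ^ 2 = ‖π g ξ‖ ^ 2 - 2 * (⟪π g ξ, π f ξ⟫_ℂ).re + ‖π f ξ‖ ^ 2 :=
    norm_sub_sq (𝕜 := ℂ) _ _
  have h2 : (⟪π g ξ, π f ξ⟫_ℂ).re = ‖π e ξ‖ ^ 2 := by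
    rw [inner_rep_of_isSelfAdjoint hg, ← rep_mul_apply, hgf, hfe, rep_mul_apply,
      ← inner_rep_of_isSelfAdjoint he]
    exact inner_self_eq_norm_sq (𝕜 := ℂ) _
  have h3 : ‖π f ξ‖ ≤ ‖π e ξ‖ := by
    rw [hfe, rep_mul_apply]
    exact (norm_rep_apply_le π e _).trans (mul_le_of_le_one_left (norm_nonneg _) he1)
  have h4 : ‖π f ξ‖ ^ 2 ≤ ‖π e ξ‖ ^ 2 := by gcongr
  linarith

end Cut

/-! ### Paths of unitaries and the exact correction -/

section Path
variable {B : Type*} [NonUnitalCStarAlgebra B]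

/-- The scalar part is a character vanishing on `B`. Exponentials of elements of `B` thus lie in the
unitary group whether or not `B` has a unit. -/
lemma fst_uexp_inr (k : B) : (uexp (k : Unitization ℂ B)).fst = 1 := by
  let τ : Unitization ℂ B →⋆ₐ[ℂ] ℂ := Unitization.starLift 0
  have hτ : ∀ x, τ x = x.fst := fun x => by
    have h : τ ((x.snd : B) : Unitization ℂ B) = 0 :=
      DFunLike.congr_fun (Unitization.starLift.symm_apply_apply (0 : B →⋆ₙₐ[ℂ] ℂ)) x.snd
    conv_lhs => rw [← Unitization.inl_fst_add_inr_snd_eq x]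
    rw [map_add, h, add_zero, ← Unitization.algebraMap_eq_inl, AlgHomClass.commutes]
    rfl
  rw [← hτ, map_uexp, hτ, Unitization.fst_inr, uexp_zero]

/-- The path `exp(-i t k) exp(-i t h)`. -/
noncomputable def expPath (k h : B) (t : ℝ) : Unitization ℂ B :=
  uexp (t • (-(k : Unitization ℂ B))) * uexp (t • (-(h : Unitization ℂ B)))

lemma isSelfAdjoint_smul_neg_inr {k : B} (hk : IsSelfAdjoint k) (t : ℝ) :
    IsSelfAdjoint (t • (-(k : Unitization ℂ B))) :=
  IsSelfAdjoint.real_smul (hk.inr ℂ).neg t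

lemma expPath_mem_unitaryGroup {k h : B} (hk : IsSelfAdjoint k) (hh : IsSelfAdjoint h) (t : ℝ) :
    expPath k h t ∈ unitaryGroup B := by
  refine ⟨mul_mem (uexp_mem_unitary (isSelfAdjoint_smul_neg_inr hk t))
    (uexp_mem_unitary (isSelfAdjoint_smul_neg_inr hh t)), fun _ => ?_⟩
  have e : ∀ b : B, t • (-(b : Unitization ℂ B)) = ((t • (-b) : B) : Unitization ℂ B) := fun b => by
    rw [Unitization.inr_smul, Unitization.inr_neg]
  rw [expPath, Unitization.fst_mul, e, e, fst_uexp_inr, fst_uexp_inr, one_mul]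

lemma expPath_zero (k h : B) : expPath k h 0 = 1 := by
  rw [expPath, zero_smul, zero_smul, uexp_zero, one_mul]

lemma norm_expPath_sub_le {k h : B} (hk : IsSelfAdjoint k) (hh : IsSelfAdjoint h) (s t : ℝ) :
    ‖expPath k h s - expPath k h t‖ ≤ (‖k‖ + ‖h‖) * |s - t| := by
  have h1 := norm_uexp_smul_sub_le (hk.inr ℂ).neg s t
  have h2 := norm_uexp_smul_sub_le (hh.inr ℂ).neg s t
  rw [norm_neg, Unitization.norm_inr] at h1 h2
  have e : expPath k h s - expPath k h t =
      (uexp (s • (-(k : Unitization ℂ B))) - uexp (t • (-(k : Unitization ℂ B)))) *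
        uexp (s • (-(h : Unitization ℂ B))) + uexp (t • (-(k : Unitization ℂ B))) *
        (uexp (s • (-(h : Unitization ℂ B))) - uexp (t • (-(h : Unitization ℂ B)))) := by
    rw [expPath, expPath]; noncomm_ring
  rw [e]
  refine (norm_add_le _ _).trans ?_
  rw [add_mul]
  exact add_le_add
    ((norm_mul_le_left (norm_uexp_le (isSelfAdjoint_smul_neg_inr hh s))).trans h1)
    ((norm_mul_le_right (norm_uexp_le (isSelfAdjoint_smul_neg_inr hk t))).trans h2)

lemma lipschitzWith_expPath {k h : B} (hk : IsSelfAdjoint k) (hh : IsSelfAdjoint h) :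
    LipschitzWith (‖k‖₊ + ‖h‖₊) (expPath k h) :=
  LipschitzWith.of_dist_le_mul fun s t => by
    rw [dist_eq_norm, Real.dist_eq]
    exact norm_expPath_sub_le hk hh s t

lemma eVariationOn_expPath_le {k h : B} (hk : IsSelfAdjoint k) (hh : IsSelfAdjoint h) :
    eVariationOn (expPath k h) (Set.Icc 0 1) ≤ ENNReal.ofReal (‖k‖ + ‖h‖) := by
  have h1 := ((lipschitzWith_expPath hk hh).lipschitzOnWith (s := Set.univ)).comp_eVariationOn_le
    (g := id) (s := Set.Icc (0 : ℝ) 1) (Set.mapsTo_univ _ _)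
  have h2 := (monotone_id.monotoneOn (Set.Icc (0 : ℝ) 1)).eVariationOn_eq
    (Set.left_mem_Icc.2 zero_le_one) (Set.right_mem_Icc.2 zero_le_one)
  rw [Set.inter_self, id, id, sub_zero, ENNReal.ofReal_one] at h2
  refine h1.trans ((mul_le_mul_right h2.le _).trans ?_)
  rw [mul_one, ENNReal.ofReal_add (norm_nonneg _) (norm_nonneg _), ofReal_norm, ofReal_norm]
  exact (ENNReal.coe_add _ _).le

lemma inr_Ad (w : Unitization ℂ B) (x : B) :
    ((Ad w x : B) : Unitization ℂ B) = w * (x : Unitization ℂ B) * star w := by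
  rw [Ad]
  ext <;> simp

lemma norm_Ad_expPath_sub_le {k h : B} (hk : IsSelfAdjoint k) (hh : IsSelfAdjoint h) (x : B)
    {t : ℝ} (ht : t ∈ Set.Icc (0 : ℝ) 1) :
    ‖Ad (expPath k h t) x - x‖ ≤ ‖k * x - x * k‖ + ‖h * x - x * h‖ := by
  have hu := (expPath_mem_unitaryGroup hk hh t).1
  have hcomm : ∀ {b : B}, IsSelfAdjoint b → ‖uexp (t • (-(b : Unitization ℂ B))) *
      (x : Unitization ℂ B) - (x : Unitization ℂ B) * uexp (t • (-(b : Unitization ℂ B)))‖ ≤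
        ‖b * x - x * b‖ := fun {b} hb => by
    refine (norm_uexp_commutator_le (isSelfAdjoint_smul_neg_inr hb t) _).trans ?_
    rw [smul_mul_assoc, mul_smul_comm, ← smul_sub, norm_smul, Real.norm_of_nonneg ht.1]
    refine (mul_le_of_le_one_left (norm_nonneg _) ht.2).trans_eq ?_
    rw [neg_mul, mul_neg, ← neg_sub', norm_neg, ← Unitization.inr_mul, ← Unitization.inr_mul,
      ← Unitization.inr_sub, Unitization.norm_inr]
  rw [← Unitization.norm_inr (𝕜 := ℂ), Unitization.inr_sub, inr_Ad]
  have e : expPath k h t * (x : Unitization ℂ B) * star (expPath k h t) - (x : Unitization ℂ B) =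
      (expPath k h t * (x : Unitization ℂ B) - (x : Unitization ℂ B) * expPath k h t) *
        star (expPath k h t) := by
    rw [sub_mul, mul_assoc (x : Unitization ℂ B), (Unitary.mem_iff.1 hu).2, mul_one]
  rw [e]
  refine (norm_mul_le_left (norm_le_one_of_mem_unitary (Unitary.star_mem hu))).trans ?_
  have e2 : expPath k h t * (x : Unitization ℂ B) - (x : Unitization ℂ B) * expPath k h t =
      (uexp (t • (-(k : Unitization ℂ B))) * (x : Unitization ℂ B) -
        (x : Unitization ℂ B) * uexp (t • (-(k : Unitization ℂ B)))) *
          uexp (t • (-(h : Unitization ℂ B))) +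
      uexp (t • (-(k : Unitization ℂ B))) *
        (uexp (t • (-(h : Unitization ℂ B))) * (x : Unitization ℂ B) -
          (x : Unitization ℂ B) * uexp (t • (-(h : Unitization ℂ B)))) := by
    rw [expPath]; noncomm_ring
  rw [e2]
  refine (norm_add_le _ _).trans (add_le_add ?_ ?_)
  · exact (norm_mul_le_left (norm_uexp_le (isSelfAdjoint_smul_neg_inr hh t))).trans (hcomm hk)
  · exact (norm_mul_le_right (norm_uexp_le (isSelfAdjoint_smul_neg_inr hk t))).trans (hcomm hh)

variable {H : Type*} [NormedAddCommGroup H] [InnerProductSpace ℂ H] [CompleteSpace H]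

lemma inner_rep_Ad_expPath (π : B →⋆ₙₐ[ℂ] (H →L[ℂ] H)) {k h : B} (hk : IsSelfAdjoint k)
    (hh : IsSelfAdjoint h) (ξ : H) (b : B) :
    ⟪ξ, π (Ad (expPath k h 1) b) ξ⟫_ℂ =
      ⟪uexp (π h) (uexp (π k) ξ), π b (uexp (π h) (uexp (π k) ξ))⟫_ℂ := by
  have e : star (expPath k h 1) = uexp (h : Unitization ℂ B) * uexp (k : Unitization ℂ B) := by
    rw [expPath, star_mul, one_smul, one_smul, star_uexp (hk.inr ℂ).neg, star_uexp (hh.inr ℂ).neg,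
      neg_neg, neg_neg]
  have hs : repLift π (star (expPath k h 1)) ξ = uexp (π h) (uexp (π k) ξ) := by
    rw [e, map_mul, repLift_uexp, repLift_uexp]; rfl
  rw [← repLift_inr π (Ad _ b), inr_Ad, map_mul, map_mul]
  change ⟪ξ, repLift π (expPath k h 1) (repLift π (b : Unitization ℂ B)
    (repLift π (star (expPath k h 1)) ξ))⟫_ℂ = _
  rw [← ContinuousLinearMap.adjoint_inner_left, ← ContinuousLinearMap.star_eq_adjoint, ← map_star,
    hs, repLift_inr]

/-- Exact rotation of nearby unit vectors by a small correction. -/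
lemma IsIrreducible.exists_small_rotation {π : B →⋆ₙₐ[ℂ] (H →L[ℂ] H)} (hπ : IsIrreducible π)
    {x y : H} (hx : ‖x‖ = 1) (hy : ‖y‖ = 1) {ρ : ℝ} (hρ : ρ ≤ 1) (h : ‖x - y‖ ≤ ρ) :
    ∃ b : B, IsSelfAdjoint b ∧ ‖b‖ ≤ 8 * ρ ∧ uexp (π b) x = y := by
  have h1 : ‖x - y‖ ^ 2 = ‖x‖ ^ 2 - 2 * (⟪x, y⟫_ℂ).re + ‖y‖ ^ 2 := norm_sub_sq (𝕜 := ℂ) x y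
  have h2 : ‖x - y‖ ^ 2 ≤ 1 := pow_le_one₀ (norm_nonneg _) (h.trans hρ)
  have hx0 : x ≠ 0 := by rw [← norm_ne_zero_iff, hx]; exact one_ne_zero
  obtain ⟨b, hb, hbn, -, -, hbm⟩ := hπ.exists_cayley_preimage (p := x) (q := y)
    (hx.trans hy.symm) hx0 (by rw [hx, hy] at h1; linarith)
  -- The lower bound gives `‖b‖ ≤ 4ρ`, and the logarithm of the Cayley transform at most doubles
  -- this.
  have h3 : 1 ≤ ‖x + y‖ := by
    have e : x + y = (2 : ℂ) • x - (x - y) := by rw [two_smul]; abel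
    have := norm_sub_norm_le ((2 : ℂ) • x) (x - y)
    rw [norm_smul, hx] at this
    norm_num at this
    rw [e]; linarith
  have hb4 : ‖b‖ ≤ 4 * ρ := by
    refine hbn.trans ?_
    gcongr
    rw [norm_sub_rev]
    exact (div_le_self (norm_nonneg _) h3).trans h
  refine ⟨cayleyLog b, isSelfAdjoint_cayleyLog b, ?_, ?_⟩
  · exact (norm_cayleyLog_le hb).trans (by linarith)
  · have key := uexp_cayleyLog_apply π hb (x + y)
    have hi : Complex.I • -Complex.I • (y - x) = y - x := by
      rw [smul_smul, mul_neg, Complex.I_mul_I, neg_neg, one_smul]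
    rw [hbm, hi, show x + y - (y - x) = (2 : ℂ) • x by rw [two_smul]; abel,
      show x + y + (y - x) = (2 : ℂ) • y by rw [two_smul]; abel, map_smul] at key
    exact smul_right_injective _ two_ne_zero key

/-- An approximate rotation between vectors of two states gives a path of unitaries. -/
lemma exists_path_of_rotation [PartialOrder B] [StarOrderedRing B] {ω₁ ω₂ : B →ₚ[ℂ] ℂ}
    {π : B →⋆ₙₐ[ℂ] (H →L[ℂ] H)} (hπ : IsIrreducible π) {ξ₁ ξ₂ : H} (hξ₁ : ‖ξ₁‖ = 1)
    (hξ₂ : ‖ξ₂‖ = 1) (hω₁ : ∀ b, ω₁ b = ⟪ξ₁, π b ξ₁⟫_ℂ) (hω₂ : ∀ b, ω₂ b = ⟪ξ₂, π b ξ₂⟫_ℂ) {k : B}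
    (hk : IsSelfAdjoint k) {ν : ℂ} (hν : ‖ν‖ = 1) {ρ : ℝ} (hρ : ρ ≤ 1)
    (h : ‖uexp (π k) ξ₂ - ν • ξ₁‖ ≤ ρ) :
    ∃ w : ℝ → Unitization ℂ B, Continuous w ∧ (∀ t, w t ∈ unitaryGroup B) ∧ w 0 = 1 ∧
      (∀ b, ω₁ b = ω₂ (Ad (w 1) b)) ∧
      eVariationOn w (Set.Icc 0 1) ≤ ENNReal.ofReal (‖k‖ + 8 * ρ) ∧
      ∀ x, ∀ t ∈ Set.Icc (0 : ℝ) 1, ‖Ad (w t) x - x‖ ≤ ‖k * x - x * k‖ + 16 * ρ * ‖x‖ := by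
  obtain ⟨b, hb, hbn, hbx⟩ := hπ.exists_small_rotation (x := uexp (π k) ξ₂) (y := ν • ξ₁)
    (by rw [norm_uexp_apply (isSelfAdjoint_rep π hk), hξ₂]) (by rw [norm_smul, hν, hξ₁, one_mul])
    hρ h
  refine ⟨expPath k b, (lipschitzWith_expPath hk hb).continuous, expPath_mem_unitaryGroup hk hb,
    expPath_zero k b, fun x => ?_, (eVariationOn_expPath_le hk hb).trans
      (ENNReal.ofReal_le_ofReal (by linarith)), fun x t ht =>
      (norm_Ad_expPath_sub_le hk hb x ht).trans ?_⟩
  · rw [hω₂, inner_rep_Ad_expPath π hk hb, hbx, hω₁, map_smul, inner_smul_left, inner_smul_right,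
      ← mul_assoc, ← Complex.normSq_eq_conj_mul_self, Complex.normSq_eq_norm_sq, hν]
    simp
  · gcongr
    refine (norm_sub_le _ _).trans ?_
    have h1 := norm_mul_le b x
    have h2 := norm_mul_le x b
    have h3 : ‖b‖ * ‖x‖ ≤ 8 * ρ * ‖x‖ := by gcongr
    linarith

/-- Equivalent pure states are vector states of one irreducible representation. -/
lemma exists_irreducible_pair [PartialOrder B] [StarOrderedRing B] {ω₁ ω₂ : B →ₚ[ℂ] ℂ}
    (h₁ : IsPureState ω₁) (h₂ : IsPureState ω₂) (h : GNSEquivalent ω₁ ω₂) :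
    IsIrreducible ω₁.gnsNonUnitalStarAlgHom ∧ ∃ ξ₁ ξ₂ : ω₁.GNS, ‖ξ₁‖ = 1 ∧ ‖ξ₂‖ = 1 ∧
      (∀ b, ω₁ b = ⟪ξ₁, ω₁.gnsNonUnitalStarAlgHom b ξ₁⟫_ℂ) ∧
      (∀ b, ω₂ b = ⟪ξ₂, ω₁.gnsNonUnitalStarAlgHom b ξ₂⟫_ℂ) := by
  obtain ⟨U, hU⟩ := h
  have hone : ∀ {ω : B →ₚ[ℂ] ℂ} {ξ : ω.GNS}, IsPureState ω → ‖ξ‖ ^ 2 = ‖toDual ω‖ → ‖ξ‖ = 1 :=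
    fun hω hξ => by
      rw [hω.1.2] at hξ
      exact (pow_eq_one_iff_of_nonneg (norm_nonneg _) two_ne_zero).1 hξ
  obtain ⟨ξ₁, hc₁, hξ₁, hn₁⟩ := exists_gns_cyclic ω₁
  obtain ⟨ξ₂, hc₂, hξ₂, hn₂⟩ := exists_gns_cyclic ω₂
  refine ⟨h₁.isIrreducible_of_cyclic (denseRange_gns ω₁ hc₁) hξ₁, ξ₁, U.symm ξ₂, hone h₁ hn₁,
    ?_, hξ₁, fun b => ?_⟩
  · rw [LinearIsometryEquiv.norm_map, hone h₂ hn₂]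
  · rw [hξ₂, ← U.inner_map_map, hU, U.apply_symm_apply]

end Path

/-! ### Estimates for normalized vectors -/

section Estimates

lemma abs_sub_le_of_sq {a b r : ℝ} (ha : 0 ≤ a) (hb : 0 ≤ b) (hr : 0 ≤ r)
    (h : |a ^ 2 - b ^ 2| ≤ r ^ 2) : |a - b| ≤ r := by
  rw [abs_le] at h ⊢
  constructor
  · by_contra! h1
    nlinarith
  · by_contra! h1
    nlinarith

lemma norm_div_sub_div_le {a₁ a₂ : ℂ} {n₁ n₂ θ δ R : ℝ} (hθ : 0 < θ) (h₁ : θ ≤ n₁) (h₂ : θ ≤ n₂)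
    (hR : 0 ≤ R) (ha : ‖a₁ - a₂‖ ≤ δ) (hn : |n₁ - n₂| ≤ δ) (haR : ‖a₂‖ ≤ R * n₂) :
    ‖a₁ / n₁ - a₂ / n₂‖ ≤ (1 + R) * δ / θ := by
  have hn₁ : 0 < n₁ := hθ.trans_le h₁
  have hn₂ : 0 < n₂ := hθ.trans_le h₂
  have hn₁' : (n₁ : ℂ) ≠ 0 := by exact_mod_cast hn₁.ne'
  have hn₂' : (n₂ : ℂ) ≠ 0 := by exact_mod_cast hn₂.ne'
  have hδ : 0 ≤ δ := (norm_nonneg _).trans ha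
  have e : a₁ / n₁ - a₂ / n₂ = ((a₁ - a₂) + a₂ / n₂ * ((n₂ - n₁ : ℝ) : ℂ)) / n₁ := by
    push_cast
    field_simp
    ring
  have h3 : ‖a₂ / n₂‖ ≤ R := by
    rw [norm_div, Complex.norm_real, Real.norm_of_nonneg hn₂.le, div_le_iff₀ hn₂]
    exact haR
  rw [e, norm_div, Complex.norm_real, Real.norm_of_nonneg hn₁.le]
  refine div_le_div₀ (by positivity) ?_ hθ h₁
  refine (norm_add_le _ _).trans ?_
  rw [norm_mul, Complex.norm_real, Real.norm_eq_abs, abs_sub_comm n₂, add_mul, one_mul]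
  gcongr

variable {B H : Type*} [NonUnitalCStarAlgebra B] [NormedAddCommGroup H]
  [InnerProductSpace ℂ H] [CompleteSpace H] (π : B →⋆ₙₐ[ℂ] (H →L[ℂ] H))

lemma inner_rep_mul_self {f : B} (hf : IsSelfAdjoint f) (ξ : H) :
    ⟪ξ, π (f * f) ξ⟫_ℂ = ((‖π f ξ‖ ^ 2 : ℝ) : ℂ) := by
  rw [rep_mul_apply, ← inner_rep_of_isSelfAdjoint hf, inner_self_eq_norm_sq_to_K]
  push_cast; rfl

lemma norm_sub_rep_sq {g : B} (hg : IsSelfAdjoint g) (ξ : H) :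
    ‖ξ - π g ξ‖ ^ 2 = ‖ξ‖ ^ 2 - (⟪ξ, π (g + g - g * g) ξ⟫_ℂ).re := by
  have h1 : ‖ξ - π g ξ‖ ^ 2 = ‖ξ‖ ^ 2 - 2 * (⟪ξ, π g ξ⟫_ℂ).re + ‖π g ξ‖ ^ 2 :=
    norm_sub_sq (𝕜 := ℂ) ξ (π g ξ)
  have h2 := inner_rep_mul_self π hg ξ
  rw [h1, map_sub π, map_add π]
  change _ = ‖ξ‖ ^ 2 - (⟪ξ, π g ξ + π g ξ - π (g * g) ξ⟫_ℂ).re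
  rw [inner_sub_right, inner_add_right, h2, Complex.sub_re, Complex.add_re, Complex.ofReal_re]
  ring

lemma inner_rep_normalize {f x : B} (hf : IsSelfAdjoint f) (ξ : H) :
    ⟪((‖π f ξ‖⁻¹ : ℝ) : ℂ) • π f ξ, π x (((‖π f ξ‖⁻¹ : ℝ) : ℂ) • π f ξ)⟫_ℂ =
      ⟪ξ, π (f * x * f) ξ⟫_ℂ / ((‖π f ξ‖ ^ 2 : ℝ) : ℂ) := by
  rw [map_smul, inner_smul_left, inner_smul_right, Complex.conj_ofReal, rep_mul_apply,
    rep_mul_apply, ← inner_rep_of_isSelfAdjoint hf]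
  push_cast
  rw [← mul_assoc, div_eq_inv_mul, ← mul_inv, sq]

lemma norm_inner_rep_conj_le {f x : B} (hf : IsSelfAdjoint f) {R : ℝ} (hx : ‖x‖ ≤ R) (ξ : H) :
    ‖⟪ξ, π (f * x * f) ξ⟫_ℂ‖ ≤ R * ‖π f ξ‖ ^ 2 := by
  rw [rep_mul_apply, rep_mul_apply, ← inner_rep_of_isSelfAdjoint hf]
  refine (norm_inner_le_norm _ _).trans ?_
  have h1 : ‖π x (π f ξ)‖ ≤ R * ‖π f ξ‖ := (norm_rep_apply_le π _ _).trans (by gcongr)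
  calc ‖π f ξ‖ * ‖π x (π f ξ)‖ ≤ ‖π f ξ‖ * (R * ‖π f ξ‖) := by gcongr
    _ = _ := by ring

/-- Passage from normalized to unnormalized vectors. -/
lemma norm_rotation_sub_le {H : Type*} [NormedAddCommGroup H] [InnerProductSpace ℂ H]
    {S : H →L[ℂ] H} {p₁ p₂ : H} {ν : ℂ}
    (hν : ‖ν‖ = 1) {r r' : ℝ} (h₁ : p₁ ≠ 0) (h₂ : p₂ ≠ 0) (h₂1 : ‖p₂‖ ≤ 1)
    (h₁₂ : |‖p₁‖ - ‖p₂‖| ≤ r')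
    (h : ‖S (((‖p₂‖⁻¹ : ℝ) : ℂ) • p₂) - ν • ((‖p₁‖⁻¹ : ℝ) : ℂ) • p₁‖ ≤ r) :
    ‖S p₂ - ν • p₁‖ ≤ r + r' := by
  have hn₁ : ‖p₁‖ ≠ 0 := norm_ne_zero_iff.2 h₁
  have hn₂ : ‖p₂‖ ≠ 0 := norm_ne_zero_iff.2 h₂
  obtain ⟨y₁, hy₁⟩ : ∃ y₁, y₁ = ((‖p₁‖⁻¹ : ℝ) : ℂ) • p₁ := ⟨_, rfl⟩
  obtain ⟨y₂, hy₂⟩ : ∃ y₂, y₂ = ((‖p₂‖⁻¹ : ℝ) : ℂ) • p₂ := ⟨_, rfl⟩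
  have e₁ : p₁ = ((‖p₁‖ : ℝ) : ℂ) • y₁ := by
    rw [hy₁, smul_smul, ← Complex.ofReal_mul, mul_inv_cancel₀ hn₁, Complex.ofReal_one, one_smul]
  have e₂ : p₂ = ((‖p₂‖ : ℝ) : ℂ) • y₂ := by
    rw [hy₂, smul_smul, ← Complex.ofReal_mul, mul_inv_cancel₀ hn₂, Complex.ofReal_one, one_smul]
  have hy₁n : ‖y₁‖ = 1 := by
    rw [hy₁, norm_smul, Complex.norm_real, norm_inv, norm_norm, inv_mul_cancel₀ hn₁]
  rw [← hy₁, ← hy₂] at h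
  have e : S p₂ - ν • p₁ = ((‖p₂‖ : ℝ) : ℂ) • (S y₂ - ν • y₁) +
      (((‖p₂‖ - ‖p₁‖ : ℝ) : ℂ) * ν) • y₁ := by
    conv_lhs => rw [e₁, e₂]
    rw [map_smul]
    push_cast
    module
  rw [e]
  refine (norm_add_le _ _).trans (add_le_add ?_ ?_)
  · rw [norm_smul, Complex.norm_real, norm_norm]
    exact (mul_le_of_le_one_left (norm_nonneg _) h₂1).trans h
  · rw [norm_smul, norm_mul, hν, hy₁n, mul_one, mul_one, Complex.norm_real, Real.norm_eq_abs,
      abs_sub_comm]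
    exact h₁₂

end Estimates

/-! ### Almost central rotation for arbitrary vectors -/

section Main
universe u
variable {A : Type u} [NonUnitalCStarAlgebra A] [PartialOrder A] [StarOrderedRing A]

set_option maxHeartbeats 1000000 in
/-- Almost central approximate rotations between vectors of nearby states. -/
lemma exists_almost_central_rotation {C : ℝ} (hA : HasPathProperty A C)
    {A₁ : NonUnitalStarSubalgebra ℂ A} [IsClosed (A₁ : Set A)] (hA₁ : IsHereditary A₁)
    (F : Finset A₁) {ε c₁ : ℝ} (hε : 0 < ε) (hc₁ : 0 < c₁)
    (hc₁' : c₁ ≤ Real.pi - 2 * Real.arctan 16) :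
    ∃ c₀ : ℝ, 0 < c₀ ∧ c₀ ≤ c₁ ∧ c₀ ≤ 1 ∧ ∃ (G : Finset A₁) (δ : ℝ), 0 < δ ∧
    ∀ (B : Type u) [NonUnitalCStarAlgebra B] [PartialOrder B] [StarOrderedRing B]
      (ι : A₁ →⋆ₙₐ[ℂ] B) (ω : B →ₚ[ℂ] ℂ) (H : Type u) [NormedAddCommGroup H]
      [InnerProductSpace ℂ H] [CompleteSpace H] (π : B →⋆ₙₐ[ℂ] (H →L[ℂ] H)) (ξ₁ ξ₂ : H)
      (J : H →ₗᵢ[ℂ] UnivSpace B),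
      IsPureState ω → IsIrreducible π → (∀ b, ω b = ⟪ξ₁, π b ξ₁⟫_ℂ) →
      (∀ b v, univRep B b (J v) = J (π b v)) → ‖ξ₁‖ = 1 → ‖ξ₂‖ = 1 →
      (∀ x ∈ G, ‖⟪ξ₁, π (ι x) ξ₁⟫_ℂ - ⟪ξ₂, π (ι x) ξ₂⟫_ℂ‖ < δ) →
      ∃ (k : B) (ν : ℂ), IsSelfAdjoint k ∧ ‖k‖ ≤ Real.pi - c₀ ∧ ‖ν‖ = 1 ∧
        ‖uexp (π k) ξ₂ - ν • ξ₁‖ ≤ c₀ / 16 ∧ ∀ x ∈ F, ‖k * ι x - ι x * k‖ ≤ ε := by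
  classical
  obtain ⟨c₀, hc0, hc0₁, hc01, hrot⟩ := exists_corner_rotation hA hA₁ (κ := 1 / 64)
    (by norm_num) hc₁
  refine ⟨c₀, hc0, hc0₁, hc01, ?_⟩
  -- With `κ = 1 / 64` the corner costs `2 κ c₀ = c₀ / 32`, normalization one more `η`, and the
  -- combination `2η`; the total is `c₀ / 16`.
  obtain ⟨η, hη⟩ : ∃ η, η = c₀ / 96 := ⟨_, rfl⟩
  have hη0 : 0 < η := by rw [hη]; positivity
  obtain ⟨N, hN⟩ := exists_nat_ge (2 / (η / 32) ^ 2)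
  have hN2 : 2 ≤ N * (η / 32) ^ 2 := by
    rwa [div_le_iff₀ (by positivity)] at hN
  have hN0 : 0 < N := by
    rcases Nat.eq_zero_or_pos N with h | h
    · rw [h, Nat.cast_zero, zero_mul] at hN2; linarith
    · exact h
  obtain ⟨f, hfsq, hff, hfF⟩ := exists_cut_sequence F (ε := ε / 16) (by positivity)
  choose e he he1 hfe using hfsq
  have hf : ∀ j, IsSelfAdjoint (f j) := fun j => by
    rw [isSelfAdjoint_iff, hfe, star_mul, (he j).star_eq]
  have hfn : ∀ j, ‖f j‖ ≤ 1 := fun j => by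
    rw [hfe]; exact (norm_mul_le _ _).trans (mul_le_one₀ (he1 j) (norm_nonneg _) (he1 j))
  -- The good index `j` depends on `B` and the states, so every candidate `j < 4N` enters the finite
  -- sets in advance. The elements `f 0 * x * f 0` replace `x` because `c` must act on them as a
  -- unit.
  obtain ⟨G, δ, hδ, h⟩ := hrot (F.image (fun x => f 0 * x * f 0) ∪
    (Finset.range (4 * N)).image fun j => f (j + 1)) (ε := ε / 2) (by positivity)
  have hX : ∀ (j : ℕ) (g : A), ∃ x : A₁, (x : A) = (f (j + 2) : A) * g * f (j + 2) := fun j g =>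
    ⟨⟨_, hA₁.conjugate_mem (f (j + 2)).2 (congr_arg Subtype.val (hf (j + 2))) g⟩, rfl⟩
  choose X hX using hX
  obtain ⟨R, hR⟩ : ∃ R, R = ∑ g ∈ G, ‖g‖ := ⟨_, rfl⟩
  have hR0 : 0 ≤ R := by rw [hR]; positivity
  have hXn : ∀ j, ∀ g ∈ G, ‖X j g‖ ≤ R := fun j g hg => by
    have h1 : ‖(f (j + 2) : A) * g * f (j + 2)‖ ≤ 1 * ‖g‖ * 1 :=
      (norm_mul_le _ _).trans (mul_le_mul ((norm_mul_le _ _).trans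
        (by gcongr; exact hfn _)) (hfn _) (norm_nonneg _) (by positivity))
    rw [one_mul, mul_one, ← hX] at h1
    rw [hR]
    exact h1.trans (Finset.single_le_sum (f := fun g : A => ‖g‖) (fun g _ => norm_nonneg g) hg)
  -- Below this threshold the corner parts are negligible; above it, dividing by the squared norms
  -- costs at most a factor `1 / θ`, which `δ₁` absorbs.
  obtain ⟨θ, hθ⟩ : ∃ θ, θ = (η / 4) ^ 2 := ⟨_, rfl⟩
  have hθ0 : 0 < θ := by rw [hθ]; positivity
  obtain ⟨δ₁, hδ₁⟩ : ∃ δ₁, δ₁ = min ((η / 32) ^ 2) (δ * θ / (2 * (1 + R))) := ⟨_, rfl⟩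
  have hδ₁0 : 0 < δ₁ := by rw [hδ₁]; exact lt_min (by positivity) (by positivity)
  have hδ₁1 : δ₁ ≤ (η / 32) ^ 2 := by rw [hδ₁]; exact min_le_left _ _
  have hδ₁2 : (1 + R) * δ₁ / θ < δ := by
    have h1 : δ₁ ≤ δ * θ / (2 * (1 + R)) := by rw [hδ₁]; exact min_le_right _ _
    rw [le_div_iff₀ (by positivity)] at h1
    rw [div_lt_iff₀ hθ0]
    nlinarith [mul_pos hδ hθ0]
  -- The elements `f_j²` and `2g - g²` compare the norms of the corner parts and of the complements.
  -- The elements `f_j X f_j` compare the normalized corner states on `c G c`.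
  refine ⟨(Finset.range (4 * N)).biUnion fun j => {f j * f j,
    f (j + 3) + f (j + 3) - f (j + 3) * f (j + 3)} ∪ G.image fun g => f j * X j g * f j, δ₁, hδ₁0,
    fun B _ _ _ ι ω H _ _ _ π ξ₁ ξ₂ J hω hπ hωξ hJ hξ₁ hξ₂ hclose => ?_⟩
  have hclose' : ∀ j < 4 * N, ∀ x ∈ ({f j * f j,
      f (j + 3) + f (j + 3) - f (j + 3) * f (j + 3)} ∪ G.image fun g => f j * X j g * f j),
      ‖⟪ξ₁, π (ι x) ξ₁⟫_ℂ - ⟪ξ₂, π (ι x) ξ₂⟫_ℂ‖ < δ₁ := fun j hj x hx =>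
    hclose x (Finset.mem_biUnion.2 ⟨j, Finset.mem_range.2 hj, hx⟩)
  let r : A₁ →⋆ₙₐ[ℂ] (H →L[ℂ] H) := π.comp ι
  have hr : ∀ a, r a = π (ι a) := fun a => rfl
  have hrn : ∀ j, ∀ ξ : H, ‖ξ‖ = 1 → ‖r (f j) ξ‖ ≤ 1 := fun j ξ hξ =>
    (norm_rep_apply_le r _ _).trans (by rw [hξ, mul_one]; exact hfn j)
  have hinc : ∀ i j, i < j → ∀ ξ : H, ‖r (f j) ξ - r (f i) ξ‖ ^ 2 ≤
      ‖r (f j) ξ‖ ^ 2 - ‖r (f i) ξ‖ ^ 2 := fun i j hij ξ =>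
    norm_rep_sub_sq_le r (he i) (he1 i) (hfe i) (hf j) (hff i j hij).1 ξ
  have hmono : ∀ ξ : H, Monotone fun j => ‖r (f j) ξ‖ ^ 2 := fun ξ =>
    monotone_nat_of_le_succ fun j => by
      have := hinc j (j + 1) j.lt_succ_self ξ
      nlinarith [sq_nonneg ‖r (f (j + 1)) ξ - r (f j) ξ‖]
  obtain ⟨j, hjN, hj₁, hj₂⟩ := exists_small_increment (s := fun j => ‖r (f j) ξ₁‖ ^ 2)
    (t := fun j => ‖r (f j) ξ₂‖ ^ 2) (fun j => sq_nonneg _) (fun j => sq_nonneg _)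
    (fun j => pow_le_one₀ (norm_nonneg _) (hrn j ξ₁ hξ₁))
    (fun j => pow_le_one₀ (norm_nonneg _) (hrn j ξ₂ hξ₂)) hN2 hN0 (hmono ξ₁) (hmono ξ₂)
  have hloc : ∀ ξ : H, ‖r (f (j + 4)) ξ‖ ^ 2 - ‖r (f j) ξ‖ ^ 2 ≤ (η / 32) ^ 2 →
      ‖r (f (j + 3)) (ξ - r (f (j + 3)) ξ)‖ ≤ η / 32 ∧
        ‖r (f (j + 3)) ξ - r (f j) ξ‖ ≤ η / 32 := fun ξ hξ => by
    have m1 := hmono ξ (show j ≤ j + 3 by lia)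
    have m2 := hmono ξ (show j + 3 ≤ j + 4 by lia)
    simp only at m1 m2
    have i1 := hinc j (j + 3) (by lia) ξ
    have i2 := hinc (j + 3) (j + 4) (by lia) ξ
    refine ⟨?_, ?_⟩
    · have e1 : r (f (j + 3)) (ξ - r (f (j + 3)) ξ) =
          r (f (j + 3)) (r (f (j + 4)) ξ - r (f (j + 3)) ξ) := by
        rw [map_sub, map_sub, ← rep_mul_apply r (f (j + 3)) (f (j + 4)),
          (hff (j + 3) (j + 4) (by lia)).2]
      rw [e1]
      refine (norm_rep_apply_le r _ _).trans ((mul_le_of_le_one_left (norm_nonneg _)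
        (hfn _)).trans ?_)
      exact (pow_le_pow_iff_left₀ (norm_nonneg _) (by positivity) two_ne_zero).1 (by linarith)
    · exact (pow_le_pow_iff_left₀ (norm_nonneg _) (by positivity) two_ne_zero).1 (by linarith)
  obtain ⟨hl₁, hl₁'⟩ := hloc ξ₁ hj₁
  obtain ⟨hl₂, hl₂'⟩ := hloc ξ₂ hj₂
  have hp : |‖r (f j) ξ₁‖ ^ 2 - ‖r (f j) ξ₂‖ ^ 2| ≤ δ₁ := by
    have h1 := (hclose' j hjN _ (Finset.mem_union_left _ (Finset.mem_insert_self _ _))).le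
    rw [← hr, inner_rep_mul_self r (hf j), inner_rep_mul_self r (hf j), ← Complex.ofReal_sub,
      Complex.norm_real, Real.norm_eq_abs] at h1
    exact h1
  have hp' : |‖r (f j) ξ₁‖ - ‖r (f j) ξ₂‖| ≤ η / 32 :=
    abs_sub_le_of_sq (norm_nonneg _) (norm_nonneg _) (by positivity) (hp.trans hδ₁1)
  have hζ : |‖ξ₁ - r (f (j + 3)) ξ₁‖ - ‖ξ₂ - r (f (j + 3)) ξ₂‖| ≤ η / 32 := by
    refine abs_sub_le_of_sq (norm_nonneg _) (norm_nonneg _) (by positivity) (le_trans ?_ hδ₁1)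
    have h1 := (hclose' j hjN _ (Finset.mem_union_left _ (Finset.mem_insert_of_mem
      (Finset.mem_singleton_self _)))).le
    rw [norm_sub_rep_sq r (hf _), norm_sub_rep_sq r (hf _), hξ₁, hξ₂, sub_sub_sub_cancel_left,
      abs_sub_comm, ← Complex.sub_re]
    exact (Complex.abs_re_le_norm _).trans h1
  obtain ⟨μ, k, hμ, hk, hkn, hgk, hkx, hkt, hkf⟩ : ∃ (μ : ℂ) (k : Bool → B), ‖μ‖ = 1 ∧
      (∀ i, IsSelfAdjoint (k i)) ∧ (∀ i, ‖k i‖ ≤ Real.pi - c₀) ∧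
      (∀ i, ι (f (j + 3)) * k i = k i) ∧
      (∀ i, ∀ x ∈ F, ‖k i * ι (f 0 * x * f 0) - ι (f 0 * x * f 0) * k i‖ ≤ ε / 2) ∧
      ‖uexp (π (k true)) (π (ι (f j)) ξ₂) - μ • π (ι (f j)) ξ₁‖ ≤ c₀ / 32 + η ∧
      ‖uexp (π (k false)) (π (ι (f j)) ξ₂) - (-μ) • π (ι (f j)) ξ₁‖ ≤ c₀ / 32 + η := by
    by_cases hbig : θ ≤ ‖r (f j) ξ₁‖ ^ 2 ∧ θ ≤ ‖r (f j) ξ₂‖ ^ 2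
    · have hne : ∀ ξ : H, θ ≤ ‖r (f j) ξ‖ ^ 2 → r (f j) ξ ≠ 0 := fun ξ hξ h0 => by
        rw [h0, norm_zero] at hξ
        norm_num at hξ
        linarith
      have hunit : ∀ ξ : H, θ ≤ ‖r (f j) ξ‖ ^ 2 →
          ‖((‖r (f j) ξ‖⁻¹ : ℝ) : ℂ) • r (f j) ξ‖ = 1 := fun ξ hξ => by
        rw [norm_smul, Complex.norm_real, norm_inv, norm_norm,
          inv_mul_cancel₀ (norm_ne_zero_iff.2 (hne ξ hξ))]
      have hfix : ∀ ξ : H, π (ι (f (j + 1))) (((‖r (f j) ξ‖⁻¹ : ℝ) : ℂ) • r (f j) ξ) =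
          ((‖r (f j) ξ‖⁻¹ : ℝ) : ℂ) • r (f j) ξ := fun ξ => by
        rw [map_smul, ← hr, ← rep_mul_apply, (hff j (j + 1) (by lia)).1]
      have hξ₁0 : ξ₁ ≠ 0 := by rw [← norm_ne_zero_iff, hξ₁]; exact one_ne_zero
      obtain ⟨μ, k, hμ, hk, hkn, hgk, hkx, hkt, hkf⟩ := h B ι ω H π ξ₁ J (f (j + 2)) (f (j + 1))
        (((‖r (f j) ξ₁‖⁻¹ : ℝ) : ℂ) • r (f j) ξ₁) (((‖r (f j) ξ₂‖⁻¹ : ℝ) : ℂ) • r (f j) ξ₂)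
        hω hπ hξ₁0 hωξ hJ (hf _) (hfn _) (hf _)
        (Finset.mem_union_right _ (Finset.mem_image_of_mem _ (Finset.mem_range.2 hjN)))
        (hff (j + 1) (j + 2) (by lia)).1 (hunit ξ₁ hbig.1) (hunit ξ₂ hbig.2) (hfix ξ₁) (hfix ξ₂)
        fun g hg x hx => by
          have hxX : x = X j g := Subtype.ext (hx.trans (hX j g).symm)
          rw [hxX, ← hr, inner_rep_normalize r (hf j), inner_rep_normalize r (hf j)]
          refine lt_of_le_of_lt (norm_div_sub_div_le hθ0 hbig.1 hbig.2 hR0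
            (hclose' j hjN _ (Finset.mem_union_right _ (Finset.mem_image_of_mem _ hg))).le hp
            (norm_inner_rep_conj_le r (hf j) (hXn j g hg) ξ₂)) hδ₁2
      refine ⟨μ, k, hμ, hk, hkn, fun i => hgk i _ (hff (j + 2) (j + 3) (by lia)).1,
        fun i x hx => hkx i _ (Finset.mem_union_left _ (Finset.mem_image_of_mem _ hx)) ?_ ?_, ?_, ?_⟩
      · rw [← mul_assoc, ← mul_assoc, (hff 0 (j + 2) (by lia)).1]
      · rw [mul_assoc, (hff 0 (j + 2) (by lia)).2]
      · refine norm_rotation_sub_le hμ (hne ξ₁ hbig.1) (hne ξ₂ hbig.2) (hrn j ξ₂ hξ₂)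
          (hp'.trans (by linarith)) (hkt.trans (by linarith))
      · refine norm_rotation_sub_le (by rwa [norm_neg]) (hne ξ₁ hbig.1) (hne ξ₂ hbig.2)
          (hrn j ξ₂ hξ₂) (hp'.trans (by linarith)) (hkf.trans (by linarith))
    -- The two norms differ by at most `η / 32`, so one small corner part forces both to be small,
    -- and no rotation is needed there.
    · have hsmall : ‖r (f j) ξ₁‖ + ‖r (f j) ξ₂‖ ≤ η := by
        rw [abs_le] at hp'
        by_contra! hlt
        refine hbig ⟨?_, ?_⟩
        · rw [hθ]; gcongr; linarith
        · rw [hθ]; gcongr; linarith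
      have hpi : (0 : ℝ) ≤ Real.pi - c₀ := by linarith [Real.pi_gt_three]
      have hzero : ∀ ν : ℂ, ‖ν‖ = 1 →
          ‖uexp (π 0) (π (ι (f j)) ξ₂) - ν • π (ι (f j)) ξ₁‖ ≤ c₀ / 32 + η := fun ν hν => by
        rw [map_zero, uexp_zero]
        change ‖r (f j) ξ₂ - ν • r (f j) ξ₁‖ ≤ _
        refine (norm_sub_le _ _).trans ?_
        rw [norm_smul, hν]
        linarith
      refine ⟨1, fun _ => 0, norm_one, fun _ => IsSelfAdjoint.zero B, fun _ => ?_,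
        fun _ => mul_zero _, fun _ x _ => ?_, hzero 1 norm_one,
        hzero (-1) (by rw [norm_neg, norm_one])⟩
      · rwa [norm_zero]
      · rw [mul_zero, zero_mul, sub_zero, norm_zero]; positivity
  have hιf : IsSelfAdjoint (ι (f (j + 3))) := by
    rw [isSelfAdjoint_iff, ← map_star, (hf _).star_eq]
  obtain ⟨K, i, ν, hK, hKn, hν, hKx, hKξ⟩ := hπ.exists_rotation_add (g := ι (f (j + 3)))
    (f := ι (f j)) hιf ((NonUnitalStarAlgHom.norm_apply_le ι _).trans (hfn _))
    (by rw [← map_mul, (hff j (j + 3) (by lia)).1]) hμ hη0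
    (M := Real.pi - c₀) (by linarith) hl₁ hl₂ hζ hl₁' hl₂' hk hkn hgk hkt hkf
  refine ⟨K, ν, hK, hKn, hν, hKξ.trans (by rw [hη]; linarith), fun x hx => ?_⟩
  obtain ⟨y, hy⟩ : ∃ y, y = ι (f 0 * x * f 0) := ⟨_, rfl⟩
  have hKy : ‖K * y - y * K‖ ≤ ε / 2 := by
    rw [hKx y, hy]
    · exact hkx i x hx
    · rw [hy, ← map_mul, ← mul_assoc, ← mul_assoc, (hff 0 (j + 3) (by lia)).1]
    · rw [hy, ← map_mul, mul_assoc, (hff 0 (j + 3) (by lia)).2]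
  have hxy : ‖ι x - y‖ ≤ ε / 16 := by
    rw [hy, ← map_sub]
    exact (NonUnitalStarAlgHom.norm_apply_le ι _).trans (hfF x hx)
  have hK4 : ‖K‖ ≤ 4 := hKn.trans (by linarith [Real.pi_lt_four])
  have hsplit : K * ι x - ι x * K = (K * y - y * K) + (K * (ι x - y) - (ι x - y) * K) := by
    noncomm_ring
  have n1 : ‖K * (ι x - y)‖ ≤ 4 * (ε / 16) := (norm_mul_le _ _).trans (by gcongr)
  have n2 : ‖(ι x - y) * K‖ ≤ ε / 16 * 4 := (norm_mul_le _ _).trans (by gcongr)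
  rw [hsplit]
  have := norm_add_le (K * y - y * K) (K * (ι x - y) - (ι x - y) * K)
  have := norm_sub_le (K * (ι x - y)) ((ι x - y) * K)
  linarith

end Main

end PureStateHomogeneity

/-! ### Assembly of the path -/

theorem mainTheorem12 {A : Type*} [NonUnitalCStarAlgebra A] [PartialOrder A] [StarOrderedRing A]
    (C : ℝ) (hC : Real.pi ≤ C) (hA : PureStateHomogeneity.HasPathProperty A C)
    (A₁ : NonUnitalStarSubalgebra ℂ A) [IsClosed (A₁ : Set A)]
    (hA₁ : PureStateHomogeneity.IsHereditary A₁) :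
    PureStateHomogeneity.HasPathProperty A₁ C := by
  intro F ε hε
  obtain ⟨M, hM⟩ : ∃ M, M = ∑ x ∈ F, ‖x‖ := ⟨_, rfl⟩
  have hM0 : 0 ≤ M := by rw [hM]; positivity
  have harc : 0 < Real.pi - 2 * Real.arctan 16 := by linarith [Real.arctan_lt_pi_div_two 16]
  obtain ⟨c₀, hc0, hc0₁, hc01, G, δ, hδ, h⟩ :=
    PureStateHomogeneity.exists_almost_central_rotation hA hA₁ F (ε := ε / 2)
      -- The first bound lets the complementary rotation fit below `π - c₀`. The second keeps the
      -- final correction, which moves `x` by at most `16 (c₀ / 16) ‖x‖`, below `ε / 2`.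
      (c₁ := min (Real.pi - 2 * Real.arctan 16) (ε / (4 * (M + 1)))) (by positivity)
      (lt_min harc (by positivity)) (min_le_left _ _)
  refine ⟨G, δ, hδ, fun B _ _ _ ι _ ω₁ ω₂ hω₁ hω₂ hequiv hclose ε' hε' => ?_⟩
  obtain ⟨hπ, ξ₁, ξ₂, hξ₁, hξ₂, h₁, h₂⟩ :=
    PureStateHomogeneity.exists_irreducible_pair hω₁ hω₂ hequiv
  obtain ⟨J, hJ⟩ := PureStateHomogeneity.exists_gns_incl ω₁
  obtain ⟨k, ν, hk, hkn, hν, hkξ, hkF⟩ := h B ι ω₁ ω₁.GNS ω₁.gnsNonUnitalStarAlgHom ξ₁ ξ₂ J hω₁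
    hπ h₁ hJ hξ₁ hξ₂ fun x hx => by rw [← h₁, ← h₂]; exact hclose x hx
  obtain ⟨w, hw, hwu, hw0, hwω, hwl, hwF⟩ := PureStateHomogeneity.exists_path_of_rotation hπ hξ₁
    hξ₂ h₁ h₂ hk hν (by linarith) hkξ
  refine ⟨w, hw.continuousOn, fun t _ => hwu t, hw0, hwω, hwl.trans_lt ?_, fun x hx t ht => ?_⟩
  -- The length is at most `π - c₀ + 8 (c₀ / 16) = π - c₀ / 2`, below `C + ε'` for every `ε'` at
  -- once.
  · rw [ENNReal.ofReal_lt_ofReal_iff (by linarith [Real.pi_pos])]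
    linarith
  · refine (hwF (ι x) t ht).trans_lt ?_
    have h3 : ‖ι x‖ ≤ M := by
      refine (NonUnitalStarAlgHom.norm_apply_le ι x).trans ?_
      rw [hM]
      exact Finset.single_le_sum (f := fun x : A₁ => ‖x‖) (fun x _ => norm_nonneg x) hx
    have h4 : c₀ * (4 * (M + 1)) ≤ ε :=
      (le_div_iff₀ (by positivity)).1 (hc0₁.trans (min_le_right _ _))
    have h5 := hkF x hx
    have h6 : 16 * (c₀ / 16) * ‖ι x‖ ≤ c₀ * M := by
      rw [mul_div_cancel₀ _ (by norm_num : (16 : ℝ) ≠ 0)]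
      gcongr
    nlinarith [mul_nonneg hc0.le hM0]
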